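/- Homology is singular homology with integer coefficients. Let $X$ and $Y$ be topological spaces with $\mathrm{Tor}_1^{\mathbb Z}(H_i(X),H_j(Y))=0$ for all $i,j$. Let $$X\star Y=X\times Y\times[0,1]\big/\big((x,y,0)\sim(x',y,0),\ (x,y,1)\sim(x,y',1)\big)$$ be the join, and for continuous maps $f:X\to X$ and $g:Y\to Y$ let $f\star g:X\star Y\to X\star Y$ be the map induced by $f\times g\times\mathrm{id}_{[0,1]}$. For a space $Z$ let $C_Z=Z\times[0,1]/\big((z,0)\sim(z',0)\big)$ be its cone and $i_Z:H_*(Z)\to H_*(C_Z)$ the map induced by the inclusion $Z\to C_Z$, $z\mapsto[z,1]$. Write $$(\mathrm{Ker}(i_X)\otimes \mathrm{Ker}(i_Y))_n=\bigoplus_{p+q=n}\mathrm{Ker}\big((i_X)_p\big)\otimes \mathrm{Ker}\big((i_Y)_q\big)$$ for the degree $n$ part of $\mathrm{Ker}(i_X)\otimes \mathrm{Ker}(i_Y)$; the map $f_*\otimes g_*$ acts on it, since $f_*$ preserves $\mathrm{Ker}(i_X)$ and $g_*$ preserves $\mathrm{Ker}(i_Y)$. Let $A,B\subset X\star Y$ be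 the images of $X\times Y\times[0,\tfrac34]$ and $X\times Y\times[\tfrac14,1]$, let $\partial:H_{n+1}(X\star Y)\to H_n(A\cap B)$ be the Mayer–Vietoris boundary, let $s:X\times Y\to A\cap B$ be the inclusion $(x,y)\mapsto[x,y,\tfrac12]$, and let $\kappa:\mathrm{Ker}(i_X)\otimes\mathrm{Ker}(i_Y)\to H_*(X)\otimes H_*(Y)\to H_*(X\times Y)$ be the inclusion followed by the homology cross product (the Künneth map). Then for every $n\ge 0$ there is an isomorphism $$\Phi: H_{n+1}(X\star Y)\xrightarrow{\ \simeq\ }(\mathrm{Ker}(i_X)\otimes \mathrm{Ker}(i_Y))_n$$ with $s_*\circ\kappa\circ\Phi=\partial$, and for all continuous maps $f:X\to X$ and $g:Y\to Y$ $$\Phi\circ(f\star g)_*=(f_*\otimes g_*)\circ\Phi .$$ -/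

import Mathlib

/-!
# Singular homology of joins

The singular chain complex and singular homology are those of Mathlib. We add the homology cross
product (defined by the shuffle formula, whose Leibniz rule is proved here), joins and cones of
topological spaces, and the Mayer-Vietoris boundary.
-/

/-- A `(p, q)`-shuffle, seen as a monotone lattice path in the grid `{0, …, p} × {0, …, q}` whose
`k`-th vertex `(fst k, snd k)` lies on the antidiagonal `x + y = k`. It is meant for `n = p + q`;
the path then goes from `(0, 0)` to `(p, q)` by unit steps. -/
@[ext]
structure Shuffle (p q n : ℕ) where
  fst : Fin (n + 1) →o Fin (p + 1)
  snd : Fin (n + 1) →o Fin (q + 1)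
  add_eq : ∀ k, (fst k : ℕ) + (snd k : ℕ) = k

namespace Shuffle

noncomputable instance (p q n : ℕ) : Fintype (Shuffle p q n) :=
  haveI : Finite (Shuffle p q n) :=
    Finite.of_injective
      (fun φ => ((φ.fst : Fin (n + 1) → Fin (p + 1)), (φ.snd : Fin (n + 1) → Fin (q + 1))))
      (fun φ ψ h => by
        simp only [Prod.mk.injEq, DFunLike.coe_fn_eq] at h
        exact Shuffle.ext h.1 h.2)
  Fintype.ofFinite _

/-- The sign of a shuffle. The exponent is the number of unit squares between the path and the
path that goes first along `{0, …, p}` (this one has height `k - p`, truncated at `0`, on the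
`k`-th antidiagonal); it is the number of inversions of the shuffle. -/
def sign {p q n : ℕ} (φ : Shuffle p q n) : ℤ :=
  (-1) ^ ∑ k : Fin (n + 1), ((φ.snd k : ℕ) - ((k : ℕ) - p))

/-- The sequence of vertices `f` without its `i`-th vertex. -/
def face {m n : ℕ} (f : Fin (n + 2) →o Fin (m + 1)) (i : Fin (n + 2)) :
    Fin (n + 1) →o Fin (m + 1) :=
  f.comp (Fin.succAboveOrderEmb i).toOrderHom

/-- Composition with the inclusion that misses the value `j`. -/
def coface {m n : ℕ} (j : Fin (m + 2)) (f : Fin (n + 1) →o Fin (m + 1)) :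
    Fin (n + 1) →o Fin (m + 2) :=
  (Fin.succAboveOrderEmb j).toOrderHom.comp f

variable {p q n : ℕ}

lemma fst_mono (φ : Shuffle p q n) {i j : ℕ} (hi : i < n + 1) (hj : j < n + 1) (h : i ≤ j) :
    (φ.fst ⟨i, hi⟩ : ℕ) ≤ φ.fst ⟨j, hj⟩ := φ.fst.monotone (Fin.mk_le_mk.2 h)

lemma snd_mono (φ : Shuffle p q n) {i j : ℕ} (hi : i < n + 1) (hj : j < n + 1) (h : i ≤ j) :
    (φ.snd ⟨i, hi⟩ : ℕ) ≤ φ.snd ⟨j, hj⟩ := φ.snd.monotone (Fin.mk_le_mk.2 h)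

lemma add_eq' (φ : Shuffle p q n) {i : ℕ} (hi : i < n + 1) :
    (φ.fst ⟨i, hi⟩ : ℕ) + (φ.snd ⟨i, hi⟩ : ℕ) = i := φ.add_eq _

/-- The `i`-th vertex is the only one in its column. -/
def ColAt (φ : Shuffle p q n) (i : Fin (n + 1)) : Prop := ∀ k, φ.fst k = φ.fst i → k = i
/-- The `i`-th vertex is the only one in its row. -/
def RowAt (φ : Shuffle p q n) (i : Fin (n + 1)) : Prop := ∀ k, φ.snd k = φ.snd i → k = i

lemma not_col_row (φ : Shuffle p q (n + 1)) (i : Fin (n + 2)) : ¬ (φ.ColAt i ∧ φ.RowAt i) := by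
  rintro ⟨hc, hr⟩
  obtain ⟨i, hi⟩ := i
  have key : ∀ a b (ha : a < n + 2) (hb : b < n + 2), b = a + 1 →
      φ.fst ⟨a, ha⟩ = φ.fst ⟨b, hb⟩ ∨ φ.snd ⟨a, ha⟩ = φ.snd ⟨b, hb⟩ := by
    intro a b ha hb hab
    have h1 := φ.add_eq' ha
    have h2 := φ.add_eq' hb
    have h3 := φ.fst_mono ha hb (by omega)
    have h4 := φ.snd_mono ha hb (by omega)
    simp only [Fin.ext_iff]
    omega
  rcases Nat.eq_zero_or_pos i with h | h
  · subst h
    rcases key 0 1 (by omega) (by omega) rfl with h | h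
    · simpa [Fin.ext_iff] using hc _ h.symm
    · simpa [Fin.ext_iff] using hr _ h.symm
  · rcases key (i - 1) i (by omega) (by omega) (by omega) with h | h
    · have := hc _ h
      simp only [Fin.ext_iff] at this
      omega
    · have := hr _ h
      simp only [Fin.ext_iff] at this
      omega

lemma face_apply {m n : ℕ} (f : Fin (n + 2) →o Fin (m + 1)) (i : Fin (n + 2)) (k : Fin (n + 1)) :
    face f i k = f (i.succAbove k) := rfl

lemma coface_apply {m n : ℕ} (j : Fin (m + 2)) (f : Fin (n + 1) →o Fin (m + 1)) (k) :
    coface j f k = j.succAbove (f k) := rfl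

lemma succAbove_val {n : ℕ} (i : Fin (n + 2)) (k : Fin (n + 1)) :
    (i.succAbove k : ℕ) = if (k : ℕ) < i then (k : ℕ) else k + 1 := by
  unfold Fin.succAbove
  simp only [Fin.lt_def, Fin.val_castSucc]
  split_ifs <;> simp

lemma exists_nat (φ : Shuffle p q n) : ∃ a : ℕ → ℕ, (∀ k, (φ.fst k : ℕ) = a k) ∧
    (∀ k, (φ.snd k : ℕ) = k - a k) ∧ (∀ k ≤ n, a k ≤ k ∧ a k ≤ p ∧ k ≤ a k + q) ∧
    (∀ k < n, a k ≤ a (k + 1) ∧ a (k + 1) ≤ a k + 1) := by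
  refine ⟨fun k => if h : k < n + 1 then φ.fst ⟨k, h⟩ else 0, ?_, ?_, ?_, ?_⟩
  · intro k
    simp only [k.isLt, dif_pos, Fin.eta]
  · intro k
    have := φ.add_eq k
    simp only [k.isLt, dif_pos, Fin.eta]
    omega
  · intro k hk
    have h1 := φ.add_eq' (show k < n + 1 by omega)
    have h2 := (φ.fst ⟨k, by omega⟩).isLt
    have h3 := (φ.snd ⟨k, by omega⟩).isLt
    simp only [show k < n + 1 by omega, dif_pos]
    omega
  · intro k hk
    have h1 := φ.add_eq' (show k < n + 1 by omega)
    have h2 := φ.add_eq' (show k + 1 < n + 1 by omega)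
    have h3 := φ.fst_mono (show k < n + 1 by omega) (show k + 1 < n + 1 by omega) (by omega)
    have h4 := φ.snd_mono (show k < n + 1 by omega) (show k + 1 < n + 1 by omega) (by omega)
    simp only [show k < n + 1 by omega, show k + 1 < n + 1 by omega, dif_pos]
    omega

lemma mono_of_step {a : ℕ → ℕ} {n : ℕ} (h : ∀ k < n, a k ≤ a (k + 1) ∧ a (k + 1) ≤ a k + 1)
    {i j : ℕ} (hij : i ≤ j) (hj : j ≤ n) : a i ≤ a j ∧ a j + i ≤ a i + j := by
  induction j, hij using Nat.le_induction with
  | base => omega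
  | succ j hij ih =>
    have := ih (by omega)
    have := h j (by omega)
    omega

lemma exists_of_nat {a : ℕ → ℕ} (h0 : ∀ k ≤ n, a k ≤ k ∧ a k ≤ p ∧ k ≤ a k + q)
    (h1 : ∀ k < n, a k ≤ a (k + 1) ∧ a (k + 1) ≤ a k + 1) :
    ∃ φ : Shuffle p q n, (∀ k, (φ.fst k : ℕ) = a k) ∧ (∀ k, (φ.snd k : ℕ) = k - a k) := by
  refine ⟨⟨⟨fun k => ⟨a k, ?_⟩, ?_⟩, ⟨fun k => ⟨k - a k, ?_⟩, ?_⟩, ?_⟩, ?_, ?_⟩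
  · have := h0 k (by omega); omega
  · intro k l hkl
    exact Fin.mk_le_mk.2 (mono_of_step h1 (Fin.le_def.1 hkl) (by omega)).1
  · have := h0 k (by omega); omega
  · intro k l hkl
    have := (mono_of_step h1 (Fin.le_def.1 hkl) (by omega))
    have := h0 k (by omega)
    have := h0 l (by omega)
    refine Fin.mk_le_mk.2 ?_
    omega
  · intro k
    have := h0 k (by omega)
    change a k + (k - a k) = k
    omega
  · intro k; rfl
  · intro k; rfl

lemma ColAt.lt {φ : Shuffle p q n} {i : Fin (n + 1)} (h : φ.ColAt i) {a : ℕ → ℕ}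
    (ha : ∀ k, (φ.fst k : ℕ) = a k) {k : ℕ} (hk : k < i) : a k < a i := by
  have h1 := φ.fst_mono (show k < n + 1 by omega) i.isLt hk.le
  have h2 := h ⟨k, by omega⟩
  simp only [Fin.ext_iff, ha, Fin.eta] at h1 h2
  omega

lemma ColAt.gt {φ : Shuffle p q n} {i : Fin (n + 1)} (h : φ.ColAt i) {a : ℕ → ℕ}
    (ha : ∀ k, (φ.fst k : ℕ) = a k) {k : ℕ} (hk : i < k) (hn : k ≤ n) : a i < a k := by
  have h1 := φ.fst_mono i.isLt (show k < n + 1 by omega) hk.le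
  have h2 := h ⟨k, by omega⟩
  simp only [Fin.ext_iff, ha, Fin.eta] at h1 h2
  omega

/-- Deletion of a column. -/
lemma exists_delete_col (φ : Shuffle (p + 1) q (n + 1)) (i : Fin (n + 2))
    (h : φ.ColAt i) :
    ∃ ψ : Shuffle p q n, face φ.fst i = coface (φ.fst i) ψ.fst ∧ face φ.snd i = ψ.snd := by
  obtain ⟨a, h1, h2, h3, h4⟩ := φ.exists_nat
  have lt := fun k => h.lt h1 (k := k)
  have gt := fun k => h.gt h1 (k := k)
  obtain ⟨ψ, e1, e2⟩ := exists_of_nat (p := p) (q := q) (n := n)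
    (a := fun k => if k < i then a k else a (k + 1) - 1) (by
      intro k hk
      have := h3 k (by omega)
      have := h3 (k + 1) (by omega)
      have := lt k
      have := gt (k + 1)
      have := h3 i (by omega)
      try dsimp only
      split_ifs <;> omega) (by
      intro k hk
      have := h4 k (by omega)
      have := h4 (k + 1) (by omega)
      have := lt k
      have := gt (k + 1)
      try dsimp only
      split_ifs with ha hb hb
      · omega
      · have hi : (i : ℕ) = k + 1 := by omega
        have := lt k
        have := gt (k + 1 + 1)
        rw [hi] at *
        omega
      · omega
      · omega)
  refine ⟨ψ, ?_, ?_⟩ <;> ext k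
  · rw [face_apply, coface_apply, h1, succAbove_val, succAbove_val, e1, h1]
    have := lt k
    have := gt (k + 1)
    split_ifs <;> omega
  · rw [face_apply, h2, succAbove_val, e2]
    have := lt k
    have := gt (k + 1)
    split_ifs <;> omega

/-- Insertion of a column. -/
lemma exists_insert_col (hn : p + q = n) (j : Fin (p + 2)) (ψ : Shuffle p q n) :
    ∃ (φ : Shuffle (p + 1) q (n + 1)) (i : Fin (n + 2)), φ.ColAt i ∧ φ.fst i = j ∧
      face φ.fst i = coface j ψ.fst ∧ face φ.snd i = ψ.snd := by
  obtain ⟨a, h1, h2, h3, h4⟩ := ψ.exists_nat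
  obtain ⟨i, hi, hlt⟩ : ∃ i ≤ n + 1, ∀ k ≤ n, k < i ↔ a k < j := by
    classical
    have hex : ∃ i, n + 1 ≤ i ∨ j ≤ a i := ⟨n + 1, Or.inl le_rfl⟩
    refine ⟨Nat.find hex, Nat.find_le (Or.inl le_rfl), fun k hk => ⟨fun h => ?_, fun h => ?_⟩⟩
    · have := Nat.find_min hex h
      omega
    · by_contra hc
      have hs := Nat.find_spec hex
      have := (mono_of_step h4 (not_lt.1 hc) hk).1
      omega
  have b0 := h3 0 (by omega)
  have bn := h3 n (by omega)
  have c0 := hlt 0 (by omega)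
  have cn := hlt n (by omega)
  have cp := hlt (i - 1)
  have ci : i ≤ n → j ≤ a i := fun h => not_lt.1 fun hc => lt_irrefl _ ((hlt i h).2 hc)
  have cs := h4 (i - 1)
  have dp := h3 (i - 1)
  have dj := j.isLt
  obtain ⟨φ, e1, e2⟩ := exists_of_nat (p := p + 1) (q := q) (n := n + 1)
    (a := fun k => if k < i then a k else if k = i then j else a (k - 1) + 1) (by
      intro k hk
      have := h3 k
      have := h3 (k - 1)
      try dsimp only
      split_ifs with ha hb
      · omega
      · subst hb
        rcases Nat.eq_zero_or_pos k with h | h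
        · subst h; omega
        · rw [Nat.sub_add_cancel h] at cs
          by_cases hkn : k < n + 1
          · omega
          · obtain rfl : k = n + 1 := by omega
            simp only [Nat.add_sub_cancel] at *
            omega
      · omega) (by
      intro k hk
      have := h4 k
      have := h4 (k - 1)
      try dsimp only
      rcases lt_trichotomy (k + 1) i with h | h | h
      · simp only [h, show k < i by omega, if_true]
        omega
      · subst h
        simp only [show k < k + 1 by omega, if_true, lt_irrefl, if_false] at *
        simp only [Nat.add_sub_cancel] at *
        by_cases hkn : k < n
        · omega
        · obtain rfl : k = n := by omega
          omega
      · by_cases hki : k = i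
        · subst hki
          simp only [lt_irrefl, if_true, if_false, show ¬ (k + 1 < k) by omega,
            show ¬ (k + 1 = k) by omega, Nat.add_sub_cancel] at *
          rcases Nat.eq_zero_or_pos k with h | h
          · subst h; omega
          · rw [Nat.sub_add_cancel h] at cs
            omega
        · simp only [show ¬ k + 1 < i by omega, show ¬ k < i by omega,
            show ¬ k + 1 = i by omega, hki, if_false, Nat.add_sub_cancel]
          rw [Nat.sub_add_cancel (show 1 ≤ k by omega)] at this
          omega)
  refine ⟨φ, ⟨i, by omega⟩, ?_, ?_, ?_, ?_⟩
  · intro k hk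
    rw [Fin.ext_iff, e1, e1] at hk
    simp only [lt_irrefl, if_false, if_true] at hk
    rw [Fin.ext_iff]
    try dsimp only
    have := hlt k
    have := hlt (k - 1)
    split_ifs at hk <;> omega
  · rw [Fin.ext_iff, e1]; simp
  · ext k
    rw [face_apply, coface_apply, e1, succAbove_val, succAbove_val, h1]
    have := hlt k
    try dsimp only
    split_ifs <;> first | omega | skip
    all_goals simp
  · ext k
    rw [face_apply, e2, succAbove_val, h2]
    have := hlt k
    try dsimp only
    split_ifs <;> first | omega | skip
    all_goals simp


/-- The exponent in the sign of a shuffle. -/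
def area (φ : Shuffle p q n) : ℕ := ∑ k : Fin (n + 1), ((φ.snd k : ℕ) - ((k : ℕ) - p))

lemma area_add (hn : p + q = n) (φ : Shuffle p q n) :
    φ.area + ∑ r ∈ Finset.range (q + 1), r = ∑ k, (φ.snd k : ℕ) := by
  have h : ∑ k : Fin (n + 1), ((k : ℕ) - p) = ∑ r ∈ Finset.range (q + 1), r := by
    rw [Fin.sum_univ_eq_sum_range (fun k => k - p) (n + 1), ← hn, add_assoc,
      Finset.sum_range_add]
    rw [Finset.sum_eq_zero (fun k hk => by have := Finset.mem_range.1 hk; omega)]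
    simp
  rw [← h, area, ← Finset.sum_add_distrib]
  refine Finset.sum_congr rfl fun k _ => ?_
  have := φ.add_eq k
  have := (φ.fst k).isLt
  omega

lemma sign_col (hn : p + q = n) (φ : Shuffle (p + 1) q (n + 1)) (i : Fin (n + 2))
    (ψ : Shuffle p q n) (h2 : face φ.snd i = ψ.snd) :
    φ.sign * (-1) ^ (i : ℕ) = (-1) ^ (φ.fst i : ℕ) * ψ.sign := by
  have e1 := φ.area_add (by omega)
  have e2 := ψ.area_add hn
  rw [Fin.sum_univ_succAbove _ i] at e1
  simp only [← face_apply, h2] at e1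
  have e3 := φ.add_eq i
  change (-1) ^ φ.area * _ = _ * (-1) ^ ψ.area
  rw [← pow_add, ← pow_add, show φ.area + (i : ℕ) = 2 * (φ.snd i : ℕ) + (φ.fst i + ψ.area) by omega,
    pow_add, pow_mul]
  simp

lemma sum_col {M : Type*} [AddCommGroup M] (hn : p + q = n)
    (F : (Fin (n + 1) →o Fin (p + 2)) → (Fin (n + 1) →o Fin (q + 1)) → M) :
    open Classical in
    ∑ x : Shuffle (p + 1) q (n + 1) × Fin (n + 2) with x.1.ColAt x.2,
      (x.1.sign * (-1) ^ (x.2 : ℕ)) • F (face x.1.fst x.2) (face x.1.snd x.2) =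
    ∑ y : Fin (p + 2) × Shuffle p q n,
      ((-1) ^ (y.1 : ℕ) * y.2.sign) • F (coface y.1 y.2.fst) y.2.snd := by
  classical
  have hdel : ∀ x : Shuffle (p + 1) q (n + 1) × Fin (n + 2), x.1.ColAt x.2 →
      ∃ ψ : Shuffle p q n, face x.1.fst x.2 = coface (x.1.fst x.2) ψ.fst ∧
        face x.1.snd x.2 = ψ.snd := fun x hx => exists_delete_col x.1 x.2 hx
  choose d hd1 hd2 using hdel
  refine Finset.sum_bij (fun x hx => (x.1.fst x.2, d x (Finset.mem_filter.1 hx).2)) ?_ ?_ ?_ ?_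
  · intros; simp
  · rintro ⟨φ, i⟩ hx ⟨φ', i'⟩ hx' h
    have hx := (Finset.mem_filter.1 hx).2
    have hx' := (Finset.mem_filter.1 hx').2
    simp only [Prod.mk.injEq] at h
    have k1 := hd1 _ hx
    have k1' := hd1 _ hx'
    have k2 := hd2 _ hx
    have k2' := hd2 _ hx'
    rw [← h.2, ← h.1, ← k1] at k1'
    rw [← h.2, ← k2] at k2'
    obtain ⟨a, h1, h2, h3, h4⟩ := φ.exists_nat
    obtain ⟨a', h1', h2', h3', h4'⟩ := φ'.exists_nat
    have hi : i = i' := by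
      rcases lt_trichotomy (i : ℕ) i' with hlt | heq | hlt
      · exfalso
        have := DFunLike.congr_fun k1' ⟨i, by omega⟩
        simp only [face_apply, Fin.ext_iff, h1, h1', succAbove_val, hlt, lt_irrefl, if_true,
          if_false] at this
        have g1 := hx.gt h1 (k := i + 1) (by simp) (by omega)
        have g2 := hx'.lt h1' (k := i) hlt
        have := congrArg Fin.val h.1
        simp only [h1, h1'] at this
        try dsimp only at *
        omega
      · exact Fin.ext heq
      · exfalso
        have := DFunLike.congr_fun k1' ⟨i', by omega⟩
        simp only [face_apply, Fin.ext_iff, h1, h1', succAbove_val, hlt, lt_irrefl, if_true,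
          if_false] at this
        have g1 := hx'.gt h1' (k := i' + 1) (by simp) (by omega)
        have g2 := hx.lt h1 (k := i') hlt
        have := congrArg Fin.val h.1
        simp only [h1, h1'] at this
        try dsimp only at *
        omega
    subst hi
    have hf : φ = φ' := by
      apply Shuffle.ext
      · ext k
        by_cases hk : k = i
        · rw [hk]; exact congrArg Fin.val h.1
        · obtain ⟨l, rfl⟩ := Fin.exists_succAbove_eq hk
          exact congrArg Fin.val (DFunLike.congr_fun k1' l).symm
      · ext k
        by_cases hk : k = i
        · have e1 := φ.add_eq i
          have e2 := φ'.add_eq i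
          have := congrArg Fin.val h.1
          try dsimp only at this
          rw [hk]; omega
        · obtain ⟨l, rfl⟩ := Fin.exists_succAbove_eq hk
          exact congrArg Fin.val (DFunLike.congr_fun k2' l).symm
    rw [hf]
  · rintro ⟨j, ψ⟩ -
    obtain ⟨φ, i, hA, hj, h1, h2⟩ := exists_insert_col hn j ψ
    refine ⟨(φ, i), Finset.mem_filter.2 ⟨Finset.mem_univ _, hA⟩, ?_⟩
    have k1 := hd1 (φ, i) hA
    have k2 := hd2 (φ, i) hA
    refine Prod.ext hj (Shuffle.ext ?_ ?_)
    · try dsimp only at *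
      rw [h1, hj] at k1
      ext k
      have := DFunLike.congr_fun k1 k
      simp only [coface_apply] at this
      exact congrArg Fin.val (Fin.succAbove_right_injective this).symm
    · exact k2.symm.trans h2
  · rintro ⟨φ, i⟩ hx
    have hx := (Finset.mem_filter.1 hx).2
    rw [sign_col hn φ i _ (hd2 _ hx), ← hd1 _ hx, ← hd2 _ hx]


/-- The shuffle with the two factors exchanged. -/
def swap (φ : Shuffle p q n) : Shuffle q p n :=
  ⟨φ.snd, φ.fst, fun k => by rw [add_comm]; exact φ.add_eq k⟩

lemma area_swap (hn : p + q = n) (φ : Shuffle p q n) : φ.area + φ.swap.area = p * q := by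
  have e1 := φ.area_add hn
  have e2 := φ.swap.area_add (by omega)
  have e3 : ∑ k, (φ.snd k : ℕ) + ∑ k, (φ.swap.snd k : ℕ) = ∑ r ∈ Finset.range (n + 1), r := by
    rw [← Finset.sum_add_distrib, ← Fin.sum_univ_eq_sum_range (fun k => k) (n + 1)]
    exact Finset.sum_congr rfl fun k _ => φ.swap.add_eq k
  have e4 : ∀ m, ∑ r ∈ Finset.range (p + m + 1), r =
      ∑ r ∈ Finset.range (p + 1), r + ∑ r ∈ Finset.range (m + 1), r + p * m := by
    intro m
    induction m with
    | zero => simp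
    | succ m ih =>
      rw [← add_assoc, Finset.sum_range_succ, ih, Finset.sum_range_succ _ (m + 1)]
      ring
  have := e4 q
  rw [hn] at this
  omega

lemma sign_swap (hn : p + q = n) (φ : Shuffle p q n) :
    φ.sign = (-1) ^ (p * q) * φ.swap.sign := by
  change (-1) ^ φ.area = _ * (-1) ^ φ.swap.area
  rw [← area_swap hn φ, pow_add, mul_assoc, ← pow_add, ← two_mul]
  simp [pow_mul]

lemma sum_row {M : Type*} [AddCommGroup M] (hn : p + q = n)
    (F : (Fin (n + 1) →o Fin (p + 1)) → (Fin (n + 1) →o Fin (q + 2)) → M) :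
    open Classical in
    ∑ x : Shuffle p (q + 1) (n + 1) × Fin (n + 2) with x.1.RowAt x.2,
      (x.1.sign * (-1) ^ (x.2 : ℕ)) • F (face x.1.fst x.2) (face x.1.snd x.2) =
    ∑ y : Fin (q + 2) × Shuffle p q n,
      ((-1) ^ p * (-1) ^ (y.1 : ℕ) * y.2.sign) • F y.2.fst (coface y.1 y.2.snd) := by
  classical
  have h := congrArg (fun z => ((-1) ^ (p * (q + 1)) : ℤ) • z)
    (sum_col (p := q) (q := p) (n := n) (by omega) (fun f g => F g f))
  simp only [Finset.smul_sum, smul_smul] at h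
  refine Eq.trans ?_ (h.trans ?_)
  · refine Finset.sum_bij (fun x _ => (x.1.swap, x.2)) ?_ ?_ ?_ ?_
    · intro x hx
      exact Finset.mem_filter.2 ⟨Finset.mem_univ _, (Finset.mem_filter.1 hx).2⟩
    · rintro ⟨φ, i⟩ _ ⟨φ', i'⟩ _ h
      simp only [Prod.mk.injEq] at h
      exact Prod.ext (congrArg swap h.1) h.2
    · rintro ⟨φ, i⟩ hx
      exact ⟨(φ.swap, i), Finset.mem_filter.2 ⟨Finset.mem_univ _, (Finset.mem_filter.1 hx).2⟩, rfl⟩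
    · rintro ⟨φ, i⟩ hx
      rw [sign_swap (by omega) φ, mul_assoc]
      rfl
  · refine Finset.sum_bij (fun y _ => (y.1, y.2.swap)) ?_ ?_ ?_ ?_
    · intros; simp
    · rintro ⟨φ, i⟩ _ ⟨φ', i'⟩ _ h
      simp only [Prod.mk.injEq] at h
      exact Prod.ext h.1 (congrArg swap h.2)
    · rintro ⟨j, ψ⟩ hx
      exact ⟨(j, ψ.swap), Finset.mem_univ _, rfl⟩
    · rintro ⟨j, ψ⟩ hx
      try dsimp only
      rw [sign_swap (by omega) ψ, mul_comm q p, mul_add, mul_one, pow_add,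
        show ((-1) ^ (p * q) * (-1) ^ p * ((-1) ^ (j : ℕ) * ((-1) ^ (p * q) * ψ.swap.sign)) : ℤ) =
          ((-1) ^ (p * q) * (-1) ^ (p * q)) * ((-1) ^ p * (-1) ^ (j : ℕ) * ψ.swap.sign) by ring,
        ← pow_add, ← two_mul, pow_mul (-1 : ℤ) 2]
      simp only [neg_one_sq, one_pow, one_mul]
      rfl


/-- The `i`-th vertex is a corner: the path goes from `(x, y)` to `(x + 1, y + 1)` around it. -/
def Corner (φ : Shuffle p q (n + 1)) (i : Fin (n + 2)) : Prop :=
  ∃ (m : ℕ) (hm : m + 1 < n + 1), (i : ℕ) = m + 1 ∧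
    (face φ.fst i ⟨m + 1, hm⟩ : ℕ) = face φ.fst i ⟨m, by omega⟩ + 1

lemma corner_iff (φ : Shuffle p q (n + 1)) (i : Fin (n + 2)) {a : ℕ → ℕ}
    (ha : ∀ k, (φ.fst k : ℕ) = a k) :
    φ.Corner i ↔ ∃ m, m + 1 < n + 1 ∧ (i : ℕ) = m + 1 ∧ a (m + 2) = a m + 1 := by
  constructor
  · rintro ⟨m, hm, hi, h⟩
    refine ⟨m, hm, hi, ?_⟩
    simpa [face_apply, ha, succAbove_val, hi] using h
  · rintro ⟨m, hm, hi, h⟩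
    refine ⟨m, hm, hi, ?_⟩
    simpa [face_apply, ha, succAbove_val, hi] using h

lemma corner_of_not (φ : Shuffle p q (n + 1)) (i : Fin (n + 2))
    (hc : ¬ φ.ColAt i) (hr : ¬ φ.RowAt i) : φ.Corner i := by
  obtain ⟨a, h1, h2, h3, h4⟩ := φ.exists_nat
  rw [φ.corner_iff i h1]
  simp only [ColAt, RowAt, not_forall, exists_prop] at hc hr
  obtain ⟨k, hk, hki⟩ := hc
  obtain ⟨l, hl, hli⟩ := hr
  rw [Fin.ext_iff, h1, h1] at hk
  rw [Fin.ext_iff, h2, h2] at hl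
  rw [Fin.ext_iff] at hki hli
  have := h3 i (by omega)
  have := h3 k (by omega)
  have := h3 l (by omega)
  have m1 : (i : ℕ) ≠ 0 → a (i - 1) ≤ a i ∧ a i ≤ a (i - 1) + 1 := fun h => by
    have := h4 (i - 1) (by omega)
    rwa [Nat.sub_add_cancel (by omega)] at this
  have m2 := h4 i
  have k1 : (k : ℕ) < i → a k ≤ a (i - 1) := fun h => (mono_of_step h4 (by omega) (by omega)).1
  have k2 : (i : ℕ) < k → a (i + 1) ≤ a k := fun h => (mono_of_step h4 (by omega) (by omega)).1
  have l1 : (l : ℕ) < i → a (i - 1) + l ≤ a l + (i - 1) :=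
    fun h => (mono_of_step h4 (i := l) (j := i - 1) (by omega) (by omega)).2
  have l2 : (i : ℕ) < l → a l + (i + 1) ≤ a (i + 1) + l :=
    fun h => (mono_of_step h4 (i := i + 1) (j := l) (by omega) (by omega)).2
  refine ⟨i - 1, by omega, by omega, ?_⟩
  rw [show (i : ℕ) - 1 + 2 = i + 1 by omega]
  omega

lemma Corner.not {φ : Shuffle p q (n + 1)} {i : Fin (n + 2)} (h : φ.Corner i) :
    ¬ φ.ColAt i ∧ ¬ φ.RowAt i := by
  obtain ⟨a, h1, h2, h3, h4⟩ := φ.exists_nat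
  obtain ⟨m, hm, hi, h⟩ := (φ.corner_iff i h1).1 h
  have e1 := h4 m (by omega)
  have e2 := h4 (m + 1) (by omega)
  have e3 := h3 m (by omega)
  constructor
  · intro hc
    have c1 := hc ⟨m, by omega⟩
    have c2 := hc ⟨m + 2, by omega⟩
    simp only [Fin.ext_iff, h1, hi] at c1 c2
    omega
  · intro hc
    have c1 := hc ⟨m, by omega⟩
    have c2 := hc ⟨m + 2, by omega⟩
    simp only [Fin.ext_iff, h2, hi] at c1 c2
    omega

/-- Every corner can be flipped in exactly one way. -/
lemma exists_flip (φ : Shuffle p q (n + 1)) (i : Fin (n + 2)) (hc : φ.Corner i) :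
    ∃ ψ : Shuffle p q (n + 1), face ψ.fst i = face φ.fst i ∧ face ψ.snd i = face φ.snd i ∧
      ψ ≠ φ := by
  obtain ⟨a, h1, h2, h3, h4⟩ := φ.exists_nat
  obtain ⟨m, hm, hi, h⟩ := (φ.corner_iff i h1).1 hc
  have e1 := h4 m (by omega)
  have e2 : a (m + 1) ≤ a (m + 2) ∧ a (m + 2) ≤ a (m + 1) + 1 := h4 (m + 1) (by omega)
  obtain ⟨v, hv⟩ : ∃ v, v + a (m + 1) = a m + a (m + 2) :=
    ⟨a m + a (m + 2) - a (m + 1), by omega⟩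
  obtain ⟨ψ, g1, g2⟩ := exists_of_nat (p := p) (q := q) (n := n + 1)
    (a := fun k => if k = m + 1 then v else a k) (by
      intro k hk
      have := h3 m (by omega)
      have := h3 (m + 2) (by omega)
      have := h3 k hk
      try dsimp only
      split_ifs <;> omega) (by
      intro k hk
      have := h4 k hk
      try dsimp only
      by_cases hk1 : k = m + 1
      · subst hk1
        simp only [if_true, show ¬ (m + 1 + 1 = m + 1) by omega, if_false]
        change v ≤ a (m + 2) ∧ a (m + 2) ≤ v + 1
        omega
      · by_cases hk2 : k = m
        · subst hk2
          simp only [if_true, hk1, if_false]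
          omega
        · simp only [hk1, show ¬ (k + 1 = m + 1) by omega, if_false]
          omega)
  refine ⟨ψ, ?_, ?_, ?_⟩
  · ext k
    rw [face_apply, face_apply, g1, h1, succAbove_val, hi]
    try dsimp only
    split_ifs <;> omega
  · ext k
    rw [face_apply, face_apply, g2, h2, succAbove_val, hi]
    try dsimp only
    split_ifs <;> omega
  · rintro rfl
    have := g1 i
    rw [h1, hi, if_pos rfl] at this
    omega

lemma flip_spec {φ ψ : Shuffle p q (n + 1)} {i : Fin (n + 2)} (hc : φ.Corner i)
    (hf : face ψ.fst i = face φ.fst i) (hψ : ψ ≠ φ) :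
    (ψ.snd i : ℕ) = φ.snd i + 1 ∨ (φ.snd i : ℕ) = ψ.snd i + 1 := by
  obtain ⟨a, h1, h2, h3, h4⟩ := φ.exists_nat
  obtain ⟨b, g1, g2, g3, g4⟩ := ψ.exists_nat
  obtain ⟨m, hm, hi, h⟩ := (φ.corner_iff i h1).1 hc
  have f1 := congrArg Fin.val (DFunLike.congr_fun hf ⟨m, by omega⟩)
  have f2 := congrArg Fin.val (DFunLike.congr_fun hf ⟨m + 1, by omega⟩)
  simp only [face_apply, h1, g1, succAbove_val, hi, show m < m + 1 by omega, if_true, lt_irrefl,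
    if_false] at f1 f2
  have e1 := h4 m (by omega)
  have e2 := h4 (m + 1) (by omega)
  have d1 := g4 m (by omega)
  have d2 := g4 (m + 1) (by omega)
  have b1 := h3 (m + 1) (by omega)
  have b2 := g3 (m + 1) (by omega)
  rw [h2, g2, hi]
  by_cases hab : a (m + 1) = b (m + 1)
  · exfalso
    apply hψ
    have : ψ.fst = φ.fst := by
      ext k
      by_cases hk : k = i
      · rw [hk, h1, g1, hi, hab]
      · obtain ⟨l, rfl⟩ := Fin.exists_succAbove_eq hk
        exact congrArg Fin.val (DFunLike.congr_fun hf l)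
    refine Shuffle.ext this ?_
    ext k
    have x1 := φ.add_eq k
    have x2 := ψ.add_eq k
    rw [this] at x2
    omega
  · omega

lemma flip_unique {φ ψ χ : Shuffle p q (n + 1)} {i : Fin (n + 2)} (hc : φ.Corner i)
    (h1 : face ψ.fst i = face φ.fst i) (h2 : face χ.fst i = face φ.fst i)
    (hψ : ψ ≠ φ) (hχ : χ ≠ φ) : ψ = χ := by
  by_contra hne
  have cχ : χ.Corner i := by
    obtain ⟨m, hm, hi, h⟩ := hc
    exact ⟨m, hm, hi, by rw [h2]; exact h⟩
  have s1 := flip_spec hc h1 hψ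
  have s2 := flip_spec hc h2 hχ
  have s3 := flip_spec cχ (h1.trans h2.symm) hne
  omega

lemma sign_flip (hn : p + q = n + 1) {φ ψ : Shuffle p q (n + 1)} {i : Fin (n + 2)}
    (hc : φ.Corner i) (hf : face ψ.fst i = face φ.fst i) (hs : face ψ.snd i = face φ.snd i)
    (hψ : ψ ≠ φ) : ψ.sign = - φ.sign := by
  have e1 := φ.area_add hn
  have e2 := ψ.area_add hn
  rw [Fin.sum_univ_succAbove _ i] at e1 e2
  simp only [← face_apply, hs] at e1 e2
  change (-1) ^ ψ.area = - (-1) ^ φ.area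
  rcases flip_spec hc hf hψ with h | h
  · rw [show ψ.area = φ.area + 1 by omega, pow_succ]; ring
  · rw [show φ.area = ψ.area + 1 by omega, pow_succ]; ring

lemma sum_corner {M : Type*} [AddCommGroup M] (hn : p + q = n + 1)
    (F : (Fin (n + 1) →o Fin (p + 1)) → (Fin (n + 1) →o Fin (q + 1)) → M) :
    open Classical in
    ∑ x : Shuffle p q (n + 1) × Fin (n + 2) with x.1.Corner x.2,
      (x.1.sign * (-1) ^ (x.2 : ℕ)) • F (face x.1.fst x.2) (face x.1.snd x.2) = 0 := by
  classical
  have hflip : ∀ x : Shuffle p q (n + 1) × Fin (n + 2), x.1.Corner x.2 →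
      ∃ ψ : Shuffle p q (n + 1), face ψ.fst x.2 = face x.1.fst x.2 ∧
        face ψ.snd x.2 = face x.1.snd x.2 ∧ ψ ≠ x.1 := fun x hx => exists_flip x.1 x.2 hx
  choose d hd1 hd2 hd3 using hflip
  have hd4 : ∀ x hx, (d x hx).Corner x.2 := by
    intro x hx
    obtain ⟨m, hm, hi, h⟩ := id hx
    exact ⟨m, hm, hi, by rw [hd1 x hx]; exact h⟩
  refine Finset.sum_involution (fun x hx => (d x (Finset.mem_filter.1 hx).2, x.2)) ?_ ?_ ?_ ?_
  · intro x hx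
    have hx := (Finset.mem_filter.1 hx).2
    dsimp only
    rw [sign_flip hn hx (hd1 x hx) (hd2 x hx) (hd3 x hx), hd1 x hx, hd2 x hx, ← add_smul]
    simp
  · intro x hx _ h
    exact hd3 x (Finset.mem_filter.1 hx).2 (congrArg Prod.fst h)
  · intro x hx
    exact Finset.mem_filter.2 ⟨Finset.mem_univ _, hd4 x (Finset.mem_filter.1 hx).2⟩
  · intro x hx
    have hx := (Finset.mem_filter.1 hx).2
    refine Prod.ext ?_ rfl
    refine flip_unique (hd4 x hx) ?_ ?_ ?_ ?_
    · exact hd1 _ (hd4 x hx)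
    · exact (hd1 x hx).symm
    · exact hd3 _ (hd4 x hx)
    · exact (hd3 x hx).symm

/-- The faces of the sum of all shuffles are the shuffles of the faces. -/
lemma sum_face {M : Type*} [AddCommGroup M] (hn : p + q = n + 1)
    (F : (Fin (n + 1) →o Fin (p + 1)) → (Fin (n + 1) →o Fin (q + 1)) → M) :
    open Classical in
    ∑ φ : Shuffle p q (n + 1), ∑ i : Fin (n + 2),
      (φ.sign * (-1) ^ (i : ℕ)) • F (face φ.fst i) (face φ.snd i) =
    ∑ x : Shuffle p q (n + 1) × Fin (n + 2) with x.1.ColAt x.2,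
      (x.1.sign * (-1) ^ (x.2 : ℕ)) • F (face x.1.fst x.2) (face x.1.snd x.2) +
    ∑ x : Shuffle p q (n + 1) × Fin (n + 2) with x.1.RowAt x.2,
      (x.1.sign * (-1) ^ (x.2 : ℕ)) • F (face x.1.fst x.2) (face x.1.snd x.2) := by
  classical
  rw [← Finset.sum_product', Finset.univ_product_univ,
    ← Finset.sum_filter_add_sum_filter_not Finset.univ
      (fun x : Shuffle p q (n + 1) × Fin (n + 2) => x.1.ColAt x.2)]
  congr 1
  rw [← Finset.sum_filter_add_sum_filter_not
      (Finset.univ.filter fun x : Shuffle p q (n + 1) × Fin (n + 2) => ¬ x.1.ColAt x.2)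
      (fun x : Shuffle p q (n + 1) × Fin (n + 2) => x.1.RowAt x.2),
    Finset.filter_filter, Finset.filter_filter]
  refine (congrArg₂ (· + ·) ?_ ?_).trans (add_zero _)
  · refine Finset.sum_congr (Finset.filter_congr fun x _ => ?_) fun _ _ => rfl
    have := not_col_row x.1 x.2
    tauto
  · rw [← sum_corner hn F]
    refine Finset.sum_congr (Finset.filter_congr fun x _ => ?_) fun _ _ => rfl
    exact ⟨fun h => corner_of_not _ _ h.1 h.2, fun h => h.not⟩

/-- In the zero simplex every column condition fails. -/
lemma not_colAt (φ : Shuffle 0 q (n + 1)) (i : Fin (n + 2)) : ¬ φ.ColAt i := by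
  intro h
  have h0 := h 0 (Subsingleton.elim (α := Fin 1) _ _)
  have h1 := h 1 (Subsingleton.elim (α := Fin 1) _ _)
  rw [← h1] at h0
  simp at h0

lemma not_rowAt (φ : Shuffle p 0 (n + 1)) (i : Fin (n + 2)) : ¬ φ.RowAt i :=
  not_colAt φ.swap i

end Shuffle

open CategoryTheory AlgebraicTopology

universe u

noncomputable section

section Homology

variable (R : Type u) [CommRing R]

/-- The singular chain complex of `X` with coefficients in `R`. -/
abbrev singChains (X : TopCat.{u}) : ChainComplex (ModuleCat.{u} R) ℕ :=
  ((singularChainComplexFunctor (ModuleCat.{u} R)).obj (ModuleCat.of R R)).obj X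

/-- The chain map induced by a continuous map. -/
abbrev singChainsMap {X Y : TopCat.{u}} (f : X ⟶ Y) : singChains R X ⟶ singChains R Y :=
  ((singularChainComplexFunctor (ModuleCat.{u} R)).obj (ModuleCat.of R R)).map f

/-- The singular homology `H_n(X; R)`. -/
abbrev singH (n : ℕ) (X : TopCat.{u}) : ModuleCat.{u} R :=
  ((singularHomologyFunctor (ModuleCat.{u} R) n).obj (ModuleCat.of R R)).obj X

/-- The map induced by a continuous map in singular homology. -/
abbrev singHMap (n : ℕ) {X Y : TopCat.{u}} (f : X ⟶ Y) : singH R n X →ₗ[R] singH R n Y :=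
  (((singularHomologyFunctor (ModuleCat.{u} R) n).obj (ModuleCat.of R R)).map f).hom

/-- The homology class of a cycle. -/
abbrev cycleClass (n : ℕ) (X : TopCat.{u}) : (singChains R X).cycles n →ₗ[R] singH R n X :=
  ((singChains R X).homologyπ n).hom

end Homology

section Pair

open scoped Simplicial
/-- The singular simplex `(σ, τ) : Δⁿ → X × Y` with components `σ` and `τ`. -/
def pairSimplex {X Y : TopCat.{u}} {n : ℕ} (σ : (TopCat.toSSet.obj X) _⦋n⦌)
    (τ : (TopCat.toSSet.obj Y) _⦋n⦌) : (TopCat.toSSet.obj (TopCat.of (X × Y))) _⦋n⦌ :=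
  (TopCat.toSSetObjEquiv (TopCat.of (X × Y)) (.op ⦋n⦌)).symm
    ((TopCat.toSSetObjEquiv X (.op ⦋n⦌) σ).prodMk (TopCat.toSSetObjEquiv Y (.op ⦋n⦌) τ))

lemma map_pairSimplex {X Y : TopCat.{u}} {m n : ℕ} (α : ⦋m⦌ ⟶ ⦋n⦌)
    (σ : (TopCat.toSSet.obj X) _⦋n⦌) (τ : (TopCat.toSSet.obj Y) _⦋n⦌) :
    (TopCat.toSSet.obj (TopCat.of (X × Y))).map α.op (pairSimplex σ τ) =
      pairSimplex ((TopCat.toSSet.obj X).map α.op σ) ((TopCat.toSSet.obj Y).map α.op τ) := by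
  rfl

end Pair

section Cross

open scoped Simplicial

variable (R : Type u) [CommRing R] {X Y : TopCat.{u}}

/-- The cross product of a singular `p`-simplex `σ` and a singular `q`-simplex `τ`: the signed sum,
over all `(p, q)`-shuffles `φ`, of the singular `n`-simplices `(σ ∘ φ.fst, τ ∘ φ.snd)` of `X × Y`,
where `n = p + q`. It is multiplied by a scalar in `R`. -/
def crossSimplex (p q n : ℕ) (σ : (TopCat.toSSet.obj X) _⦋p⦌) (τ : (TopCat.toSSet.obj Y) _⦋q⦌) :
    ModuleCat.of R R ⟶ (singChains R (TopCat.of (X × Y))).X n :=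
  ∑ φ : Shuffle p q n, φ.sign • (TopCat.toSSet.obj (TopCat.of (X × Y))).ιChainComplex
    (pairSimplex ((TopCat.toSSet.obj X).map (SimplexCategory.mkHom φ.fst).op σ)
      ((TopCat.toSSet.obj Y).map (SimplexCategory.mkHom φ.snd).op τ))

/-- The map `b ↦ σ × b` for a singular simplex `σ`. -/
def crossSimplexChain (p q n : ℕ) (σ : (TopCat.toSSet.obj X) _⦋p⦌) :
    (singChains R Y).X q ⟶ (singChains R (TopCat.of (X × Y))).X n :=
  Limits.Sigma.desc (fun τ => crossSimplex R p q n σ τ)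

/-- The cross product of singular chains, for `n = p + q`. -/
def chainCross (p q n : ℕ) :
    (singChains R X).X p →ₗ[R] (singChains R Y).X q →ₗ[R]
      (singChains R (TopCat.of (X × Y))).X n :=
  (show (singChains R X).X p ⟶ ModuleCat.of R ((singChains R Y).X q →ₗ[R]
      (singChains R (TopCat.of (X × Y))).X n) from
    Limits.Sigma.desc fun σ => ModuleCat.ofHom
      (LinearMap.toSpanSingleton R _ (crossSimplexChain R p q n σ).hom)).hom

/-- The chain `r • σ` for a singular simplex `σ`. -/
abbrev simplexChain {n : ℕ} (σ : (TopCat.toSSet.obj X) _⦋n⦌) (r : R) : (singChains R X).X n :=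
  (SSet.ιChainComplex (R := ModuleCat.of R R) _ σ).hom r

lemma chainCross_ι (p q n : ℕ) (σ : (TopCat.toSSet.obj X) _⦋p⦌)
    (τ : (TopCat.toSSet.obj Y) _⦋q⦌) (r s : R) :
    chainCross R p q n (simplexChain R σ r) (simplexChain R τ s) =
      (crossSimplex R p q n σ τ).hom (r * s) := by
  have h1 : SSet.ιChainComplex _ τ ≫ crossSimplexChain R p q n σ = crossSimplex R p q n σ τ :=
    Limits.Sigma.ι_desc _ _
  have h2 := Limits.Sigma.ι_desc (fun σ => ModuleCat.ofHom
      (LinearMap.toSpanSingleton R _ (crossSimplexChain R (X := X) (Y := Y) p q n σ).hom)) σ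
  have h3 := LinearMap.congr_fun (congrArg ModuleCat.Hom.hom h2) r
  have h4 := LinearMap.congr_fun (congrArg ModuleCat.Hom.hom h1) s
  have h5 : chainCross R p q n (simplexChain R σ r) =
      r • (crossSimplexChain R (X := X) (Y := Y) p q n σ).hom := h3
  rw [h5, LinearMap.smul_apply]
  refine (congrArg (r • ·) h4).trans ?_
  rw [← map_smul, smul_eq_mul]

lemma chain_ext {n : ℕ} {M : Type u} [AddCommGroup M] [Module R M]
    {f g : (singChains R X).X n →ₗ[R] M}
    (h : ∀ σ, f (simplexChain R σ 1) = g (simplexChain R σ 1)) : f = g := by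
  have : ModuleCat.ofHom f = ModuleCat.ofHom g := by
    refine SSet.chainComplex_hom_ext fun σ => ?_
    ext
    exact h σ
  exact congrArg ModuleCat.Hom.hom this

lemma d_simplexChain {n : ℕ} (σ : (TopCat.toSSet.obj X) _⦋n + 1⦌) (r : R) :
    ((singChains R X).d (n + 1) n).hom (simplexChain R σ r) =
      ∑ i : Fin (n + 2), ((-1) ^ (i : ℕ) : ℤ) •
        simplexChain R ((TopCat.toSSet.obj X).map (SimplexCategory.δ i).op σ) r := by
  have := LinearMap.congr_fun (congrArg ModuleCat.Hom.hom
    (SSet.ιChainComplex_d (TopCat.toSSet.obj X) (ModuleCat.of R R) σ)) r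
  refine this.trans ?_
  simp [ModuleCat.hom_sum]
  rfl

end Cross

section Leibniz

open scoped Simplicial

variable (R : Type u) [CommRing R] {X Y : TopCat.{u}}

/-- The chain given by the pair of simplices `(f^* σ, g^* τ)`. -/
abbrev gridChain {p q n : ℕ} (σ : (TopCat.toSSet.obj X) _⦋p⦌)
    (τ : (TopCat.toSSet.obj Y) _⦋q⦌) (f : Fin (n + 1) →o Fin (p + 1))
    (g : Fin (n + 1) →o Fin (q + 1)) : (singChains R (TopCat.of (X × Y))).X n :=
  simplexChain R (pairSimplex ((TopCat.toSSet.obj X).map (SimplexCategory.mkHom f).op σ)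
    ((TopCat.toSSet.obj Y).map (SimplexCategory.mkHom g).op τ)) (1 : R)

lemma chainCross_simplexChain (p q n : ℕ) (σ : (TopCat.toSSet.obj X) _⦋p⦌)
    (τ : (TopCat.toSSet.obj Y) _⦋q⦌) :
    chainCross R p q n (simplexChain R σ 1) (simplexChain R τ 1) =
      ∑ φ : Shuffle p q n, φ.sign • gridChain R σ τ φ.fst φ.snd := by
  rw [chainCross_ι, mul_one, crossSimplex]
  simp only [ModuleCat.hom_sum, LinearMap.sum_apply]
  rfl

lemma map_coface {p n : ℕ} (σ : (TopCat.toSSet.obj X) _⦋p + 1⦌) (j : Fin (p + 2))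
    (f : Fin (n + 1) →o Fin (p + 1)) :
    (TopCat.toSSet.obj X).map (SimplexCategory.mkHom (Shuffle.coface j f)).op σ =
      (TopCat.toSSet.obj X).map (SimplexCategory.mkHom f).op
        ((TopCat.toSSet.obj X).map (SimplexCategory.δ j).op σ) := by
  rw [← ConcreteCategory.comp_apply, ← Functor.map_comp]
  rfl

lemma map_face {p n : ℕ} (σ : (TopCat.toSSet.obj X) _⦋p⦌) (i : Fin (n + 2))
    (f : Fin (n + 2) →o Fin (p + 1)) :
    (TopCat.toSSet.obj X).map (SimplexCategory.mkHom (Shuffle.face f i)).op σ =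
      (TopCat.toSSet.obj X).map (SimplexCategory.δ i).op
        ((TopCat.toSSet.obj X).map (SimplexCategory.mkHom f).op σ) := by
  rw [← ConcreteCategory.comp_apply, ← Functor.map_comp]
  rfl

open Classical in
lemma d_chainCross_simplexChain {p q n : ℕ} (h : p + q = n + 1) (σ : (TopCat.toSSet.obj X) _⦋p⦌)
    (τ : (TopCat.toSSet.obj Y) _⦋q⦌) :
    ((singChains R (TopCat.of (X × Y))).d (n + 1) n).hom
        (chainCross R p q (n + 1) (simplexChain R σ 1) (simplexChain R τ 1)) =
      ∑ x : Shuffle p q (n + 1) × Fin (n + 2) with x.1.ColAt x.2,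
        (x.1.sign * (-1) ^ (x.2 : ℕ)) •
          gridChain R σ τ (Shuffle.face x.1.fst x.2) (Shuffle.face x.1.snd x.2) +
      ∑ x : Shuffle p q (n + 1) × Fin (n + 2) with x.1.RowAt x.2,
        (x.1.sign * (-1) ^ (x.2 : ℕ)) •
          gridChain R σ τ (Shuffle.face x.1.fst x.2) (Shuffle.face x.1.snd x.2) := by
  rw [← Shuffle.sum_face h, chainCross_simplexChain, map_sum]
  refine Finset.sum_congr rfl fun φ _ => ?_
  rw [map_zsmul, d_simplexChain, Finset.smul_sum]
  refine Finset.sum_congr rfl fun i _ => ?_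
  rw [smul_smul, map_pairSimplex, gridChain, map_face, map_face]

open Classical in
lemma sum_col_gridChain {p q n : ℕ} (h : p + q = n) (σ : (TopCat.toSSet.obj X) _⦋p + 1⦌)
    (τ : (TopCat.toSSet.obj Y) _⦋q⦌) :
    ∑ x : Shuffle (p + 1) q (n + 1) × Fin (n + 2) with x.1.ColAt x.2,
        (x.1.sign * (-1) ^ (x.2 : ℕ)) •
          gridChain R σ τ (Shuffle.face x.1.fst x.2) (Shuffle.face x.1.snd x.2) =
      chainCross R p q n (((singChains R X).d (p + 1) p).hom (simplexChain R σ 1))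
        (simplexChain R τ 1) := by
  rw [Shuffle.sum_col h, d_simplexChain, map_sum, LinearMap.sum_apply,
    ← Finset.univ_product_univ, Finset.sum_product]
  refine Finset.sum_congr rfl fun j _ => ?_
  rw [map_zsmul, LinearMap.smul_apply, chainCross_simplexChain, Finset.smul_sum]
  refine Finset.sum_congr rfl fun ψ _ => ?_
  rw [smul_smul, gridChain, map_coface]

open Classical in
lemma sum_row_gridChain {p q n : ℕ} (h : p + q = n) (σ : (TopCat.toSSet.obj X) _⦋p⦌)
    (τ : (TopCat.toSSet.obj Y) _⦋q + 1⦌) :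
    ∑ x : Shuffle p (q + 1) (n + 1) × Fin (n + 2) with x.1.RowAt x.2,
        (x.1.sign * (-1) ^ (x.2 : ℕ)) •
          gridChain R σ τ (Shuffle.face x.1.fst x.2) (Shuffle.face x.1.snd x.2) =
      ((-1) ^ p : ℤ) • chainCross R p q n (simplexChain R σ 1)
        (((singChains R Y).d (q + 1) q).hom (simplexChain R τ 1)) := by
  rw [Shuffle.sum_row h, d_simplexChain, map_sum,
    ← Finset.univ_product_univ, Finset.sum_product, Finset.smul_sum]
  refine Finset.sum_congr rfl fun j _ => ?_
  rw [map_zsmul, chainCross_simplexChain, Finset.smul_sum, Finset.smul_sum]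
  refine Finset.sum_congr rfl fun ψ _ => ?_
  rw [smul_smul, smul_smul, gridChain, map_coface, mul_assoc]

/-- The Leibniz rule `d (a × b) = d a × b + (-1) ^ |a| • a × d b`, in positive degrees. -/
lemma d_chainCross_succ_succ {p q n : ℕ} (h : p + 1 + q = n) (a : (singChains R X).X (p + 1))
    (b : (singChains R Y).X (q + 1)) :
    ((singChains R (TopCat.of (X × Y))).d (n + 1) n).hom (chainCross R (p + 1) (q + 1) (n + 1) a b) =
      chainCross R p (q + 1) n (((singChains R X).d (p + 1) p).hom a) b +
      ((-1) ^ (p + 1) : ℤ) •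
        chainCross R (p + 1) q n a (((singChains R Y).d (q + 1) q).hom b) := by
  have : (chainCross R (p + 1) (q + 1) (n + 1)).compr₂
      ((singChains R (TopCat.of (X × Y))).d (n + 1) n).hom =
      (chainCross R p (q + 1) n).comp ((singChains R X).d (p + 1) p).hom +
      ((-1) ^ (p + 1) : ℤ) •
        (chainCross R (p + 1) q n).compl₂ ((singChains R Y).d (q + 1) q).hom := by
    refine chain_ext R fun σ => chain_ext R fun τ => ?_
    refine (d_chainCross_simplexChain R (by omega) σ τ).trans ?_
    rw [sum_col_gridChain R (by omega), sum_row_gridChain R h]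
    rfl
  exact LinearMap.congr_fun (LinearMap.congr_fun this a) b

/-- The Leibniz rule when `a` has degree `0`. -/
lemma d_chainCross_zero_succ {q n : ℕ} (h : q = n) (a : (singChains R X).X 0)
    (b : (singChains R Y).X (q + 1)) :
    ((singChains R (TopCat.of (X × Y))).d (n + 1) n).hom (chainCross R 0 (q + 1) (n + 1) a b) =
      chainCross R 0 q n a (((singChains R Y).d (q + 1) q).hom b) := by
  classical
  have : (chainCross R 0 (q + 1) (n + 1)).compr₂
      ((singChains R (TopCat.of (X × Y))).d (n + 1) n).hom =
        (chainCross R 0 q n).compl₂ ((singChains R Y).d (q + 1) q).hom := by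
    refine chain_ext R fun σ => chain_ext R fun τ => ?_
    refine (d_chainCross_simplexChain R (by omega) σ τ).trans ?_
    rw [sum_row_gridChain R (by omega), Finset.filter_false_of_mem
      (fun x _ => Shuffle.not_colAt x.1 x.2)]
    simp
  exact LinearMap.congr_fun (LinearMap.congr_fun this a) b

/-- The Leibniz rule when `b` has degree `0`. -/
lemma d_chainCross_succ_zero {p n : ℕ} (h : p = n) (a : (singChains R X).X (p + 1))
    (b : (singChains R Y).X 0) :
    ((singChains R (TopCat.of (X × Y))).d (n + 1) n).hom (chainCross R (p + 1) 0 (n + 1) a b) =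
      chainCross R p 0 n (((singChains R X).d (p + 1) p).hom a) b := by
  classical
  have : (chainCross R (p + 1) 0 (n + 1)).compr₂
      ((singChains R (TopCat.of (X × Y))).d (n + 1) n).hom =
      (chainCross R p 0 n).comp ((singChains R X).d (p + 1) p).hom := by
    refine chain_ext R fun σ => chain_ext R fun τ => ?_
    refine (d_chainCross_simplexChain R (by omega) σ τ).trans ?_
    rw [sum_col_gridChain R (by omega), Finset.filter_false_of_mem (s := Finset.univ)
      (p := fun x : Shuffle (p + 1) 0 (n + 1) × Fin (n + 2) => x.1.RowAt x.2)
      (fun x _ => Shuffle.not_rowAt x.1 x.2)]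
    simp
  exact LinearMap.congr_fun (LinearMap.congr_fun this a) b

end Leibniz

section HomologyCross

variable (R : Type u) [CommRing R]

lemma cycleClass_surjective (n : ℕ) (X : TopCat.{u}) :
    Function.Surjective (cycleClass R n X) :=
  (ModuleCat.epi_iff_surjective _).1 inferInstance

/-- The chain underlying a cycle. -/
abbrev cycleChain (n : ℕ) (X : TopCat.{u}) :
    (singChains R X).cycles n →ₗ[R] (singChains R X).X n :=
  ((singChains R X).iCycles n).hom

lemma cycleChain_injective (n : ℕ) (X : TopCat.{u}) :
    Function.Injective (cycleChain R n X) :=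
  (ModuleCat.mono_iff_injective _).1 inferInstance

lemma d_cycleChain (n m : ℕ) (X : TopCat.{u}) (z : (singChains R X).cycles n) :
    ((singChains R X).d n m).hom (cycleChain R n X z) = 0 :=
  LinearMap.congr_fun (congrArg ModuleCat.Hom.hom ((singChains R X).iCycles_d n m)) z

lemma exists_of_cycleClass_eq_zero (n : ℕ) (X : TopCat.{u}) (z : (singChains R X).cycles n)
    (hz : cycleClass R n X z = 0) :
    ∃ a, ((singChains R X).d (n + 1) n).hom a = cycleChain R n X z := by
  let S := ShortComplex.mk _ _ ((singChains R X).toCycles_comp_homologyπ (n + 1) n)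
  have hS : S.Exact := S.exact_of_g_is_cokernel
    ((singChains R X).homologyIsCokernel (n + 1) n (by simp))
  obtain ⟨a, ha⟩ := S.moduleCat_exact_iff.1 hS z hz
  refine ⟨a, ?_⟩
  rw [← ha]
  exact (LinearMap.congr_fun (congrArg ModuleCat.Hom.hom
    ((singChains R X).toCycles_i (n + 1) n)) a).symm

lemma cycleClass_eq_zero (n : ℕ) (X : TopCat.{u}) (z : (singChains R X).cycles n) (a)
    (ha : ((singChains R X).d (n + 1) n).hom a = cycleChain R n X z) :
    cycleClass R n X z = 0 := by
  have : z = ((singChains R X).toCycles (n + 1) n).hom a := by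
    apply cycleChain_injective
    rw [← ha]
    exact (LinearMap.congr_fun (congrArg ModuleCat.Hom.hom
      ((singChains R X).toCycles_i (n + 1) n)) a).symm
  rw [this]
  exact LinearMap.congr_fun (congrArg ModuleCat.Hom.hom
    ((singChains R X).toCycles_comp_homologyπ (n + 1) n)) a

/-- The cycle with a given underlying chain. -/
def cycleOf (n : ℕ) (X : TopCat.{u}) (x : (singChains R X).X n)
    (hx : ∀ m, ((singChains R X).d n m).hom x = 0) : (singChains R X).cycles n :=
  ((singChains R X).liftCycles (ModuleCat.ofHom (LinearMap.toSpanSingleton R _ x)) _ rfl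
    (ModuleCat.hom_ext (LinearMap.ext_ring
      ((congrArg _ (one_smul R x)).trans (hx _))))).hom (1 : R)

lemma cycleChain_cycleOf (n : ℕ) (X : TopCat.{u}) (x : (singChains R X).X n)
    (hx : ∀ m, ((singChains R X).d n m).hom x = 0) :
    cycleChain R n X (cycleOf R n X x hx) = x := by
  have := LinearMap.congr_fun (congrArg ModuleCat.Hom.hom ((singChains R X).liftCycles_i
    (ModuleCat.ofHom (LinearMap.toSpanSingleton R _ x)) _ rfl
    (ModuleCat.hom_ext (LinearMap.ext_ring
      ((congrArg _ (one_smul R x)).trans (hx _)))))) (1 : R)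
  exact this.trans (one_smul R x)

variable {X Y : TopCat.{u}}

lemma d_chainCross_cycles {p q n : ℕ} (h : p + q = n) (z : (singChains R X).cycles p)
    (w : (singChains R Y).cycles q) (m : ℕ) :
    ((singChains R (TopCat.of (X × Y))).d n m).hom
      (chainCross R p q n (cycleChain R p X z) (cycleChain R q Y w)) = 0 := by
  by_cases hm : m + 1 = n
  · subst hm
    rcases p with _ | p <;> rcases q with _ | q
    · omega
    · rw [d_chainCross_zero_succ R (by omega), d_cycleChain, map_zero]
    · rw [d_chainCross_succ_zero R (by omega), d_cycleChain, map_zero, LinearMap.zero_apply]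
    · rw [d_chainCross_succ_succ R (by omega), d_cycleChain, d_cycleChain]
      simp
  · rw [(singChains R (TopCat.of (X × Y))).shape n m (by simpa using hm)]
    rfl

/-- The cross product of cycles. -/
def cycleCross {p q n : ℕ} (h : p + q = n) :
    (singChains R X).cycles p →ₗ[R] (singChains R Y).cycles q →ₗ[R]
      (singChains R (TopCat.of (X × Y))).cycles n :=
  LinearMap.mk₂ R
    (fun z w => cycleOf R n _ (chainCross R p q n (cycleChain R p X z) (cycleChain R q Y w))
      (d_chainCross_cycles R h z w))
    (fun _ _ _ => cycleChain_injective R _ _ (by simp [cycleChain_cycleOf]))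
    (fun _ _ _ => cycleChain_injective R _ _ (by simp [cycleChain_cycleOf]))
    (fun _ _ _ => cycleChain_injective R _ _ (by simp [cycleChain_cycleOf]))
    (fun _ _ _ => cycleChain_injective R _ _ (by simp [cycleChain_cycleOf]))

lemma cycleChain_cycleCross {p q n : ℕ} (h : p + q = n) (z : (singChains R X).cycles p)
    (w : (singChains R Y).cycles q) :
    cycleChain R n _ (cycleCross R h z w) =
      chainCross R p q n (cycleChain R p X z) (cycleChain R q Y w) :=
  cycleChain_cycleOf R n _ _ (d_chainCross_cycles R h z w)

lemma cycleClass_cycleCross_left {p q n : ℕ} (h : p + q = n) (z : (singChains R X).cycles p)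
    (hz : cycleClass R p X z = 0) (w : (singChains R Y).cycles q) :
    cycleClass R n _ (cycleCross R h z w) = 0 := by
  obtain ⟨a, ha⟩ := exists_of_cycleClass_eq_zero R p X z hz
  refine cycleClass_eq_zero R n _ _ (chainCross R (p + 1) q (n + 1) a (cycleChain R q Y w)) ?_
  rw [cycleChain_cycleCross, ← ha]
  rcases q with _ | q
  · rw [d_chainCross_succ_zero R (by omega)]
  · rw [d_chainCross_succ_succ R (by omega), d_cycleChain]
    simp

lemma cycleClass_cycleCross_right {p q n : ℕ} (h : p + q = n) (z : (singChains R X).cycles p)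
    (w : (singChains R Y).cycles q) (hw : cycleClass R q Y w = 0) :
    cycleClass R n _ (cycleCross R h z w) = 0 := by
  obtain ⟨b, hb⟩ := exists_of_cycleClass_eq_zero R q Y w hw
  refine cycleClass_eq_zero R n _ _
    (((-1) ^ p : ℤ) • chainCross R p (q + 1) (n + 1) (cycleChain R p X z) b) ?_
  rw [cycleChain_cycleCross, ← hb, map_zsmul]
  rcases p with _ | p
  · rw [d_chainCross_zero_succ R (by omega)]
    simp
  · rw [d_chainCross_succ_succ R (by omega), d_cycleChain, map_zero, LinearMap.zero_apply,
      zero_add, smul_smul, ← mul_pow]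
    simp

/-- The linear map out of a quotient `π : Z → H` induced by a linear map on `Z`. -/
def descSurj {Z H M : Type*} [AddCommGroup Z] [Module R Z] [AddCommGroup H] [Module R H]
    [AddCommGroup M] [Module R M] (π : Z →ₗ[R] H) (hπ : Function.Surjective π) (f : Z →ₗ[R] M)
    (hf : ∀ z, π z = 0 → f z = 0) : H →ₗ[R] M :=
  ((LinearMap.ker π).liftQ f hf).comp (π.quotKerEquivOfSurjective hπ).symm.toLinearMap

lemma descSurj_apply {Z H M : Type*} [AddCommGroup Z] [Module R Z] [AddCommGroup H] [Module R H]
    [AddCommGroup M] [Module R M] (π : Z →ₗ[R] H) (hπ : Function.Surjective π) (f : Z →ₗ[R] M)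
    (hf : ∀ z, π z = 0 → f z = 0) (z : Z) : descSurj R π hπ f hf (π z) = f z := by
  have h : (π.quotKerEquivOfSurjective hπ).symm (π z) = Submodule.Quotient.mk z := by
    rw [LinearEquiv.symm_apply_eq]
    rfl
  change (LinearMap.ker π).liftQ f hf ((π.quotKerEquivOfSurjective hπ).symm (π z)) = f z
  rw [h]
  rfl

section

variable {Z₁ Z₂ H₁ H₂ M : Type*} [AddCommGroup Z₁] [Module R Z₁] [AddCommGroup Z₂] [Module R Z₂]
  [AddCommGroup H₁] [Module R H₁] [AddCommGroup H₂] [Module R H₂] [AddCommGroup M] [Module R M]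
  (π₁ : Z₁ →ₗ[R] H₁) (h₁ : Function.Surjective π₁) (π₂ : Z₂ →ₗ[R] H₂)
  (h₂ : Function.Surjective π₂) (f : Z₁ →ₗ[R] Z₂ →ₗ[R] M)
  (hf₁ : ∀ z w, π₁ z = 0 → f z w = 0) (hf₂ : ∀ z w, π₂ w = 0 → f z w = 0)

/-- The bilinear map on quotients induced by a bilinear map. -/
def descSurj₂ : H₁ →ₗ[R] H₂ →ₗ[R] M :=
  descSurj R π₁ h₁
    (descSurj R π₂ h₂ f.flip (fun w hw => LinearMap.ext fun z => hf₂ z w hw)).flip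
    (fun z hz => LinearMap.ext fun y => by
      obtain ⟨w, rfl⟩ := h₂ y
      rw [LinearMap.flip_apply, descSurj_apply]
      exact hf₁ z w hz)

lemma descSurj₂_apply (z : Z₁) (w : Z₂) :
    descSurj₂ R π₁ h₁ π₂ h₂ f hf₁ hf₂ (π₁ z) (π₂ w) = f z w := by
  rw [descSurj₂, descSurj_apply, LinearMap.flip_apply, descSurj_apply]
  rfl

end

/-- The homology cross product `H_p(X) ⊗ H_q(Y) → H_n(X × Y)`, `n = p + q`: `[z] × [w] = [z × w]`. -/
def homologyCross {p q n : ℕ} (h : p + q = n) :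
    singH R p X →ₗ[R] singH R q Y →ₗ[R] singH R n (TopCat.of (X × Y)) :=
  descSurj₂ R (cycleClass R p X) (cycleClass_surjective R p X)
    (cycleClass R q Y) (cycleClass_surjective R q Y)
    ((cycleCross R h).compr₂ (cycleClass R n _))
    (fun z w hz => cycleClass_cycleCross_left R h z hz w)
    (fun z w hw => cycleClass_cycleCross_right R h z w hw)

lemma homologyCross_apply {p q n : ℕ} (h : p + q = n) (z : (singChains R X).cycles p)
    (w : (singChains R Y).cycles q) :
    homologyCross R h (cycleClass R p X z) (cycleClass R q Y w) =
      cycleClass R n _ (cycleCross R h z w) :=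
  descSurj₂_apply R _ _ _ _ _ _ _ z w

open scoped TensorProduct DirectSum

variable (X Y)

/-- The degree `n` part of `H_*(X) ⊗ H_*(Y)`. -/
abbrev homologyTensor (n : ℕ) : Type u :=
  ⨁ i : Finset.HasAntidiagonal.antidiagonal n, (singH R i.1.1 X ⊗[R] singH R i.1.2 Y)

/-- The Künneth map: the homology cross product on the degree `n` part of `H_*(X) ⊗ H_*(Y)`. -/
def kunnethMap (n : ℕ) :
    homologyTensor R X Y n →ₗ[R] singH R n (TopCat.of (X × Y)) :=
  DirectSum.toModule R _ _ fun i =>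
    TensorProduct.lift (homologyCross R (Finset.HasAntidiagonal.mem_antidiagonal.1 i.2))

end HomologyCross

section Join

open scoped unitInterval

variable (X Y : TopCat.{u})

/-- The identifications `(x, y, 0) ∼ (x', y, 0)` and `(x, y, 1) ∼ (x, y', 1)`. -/
inductive JoinRel : X × Y × I → X × Y × I → Prop
  | zero (x x' : X) (y : Y) : JoinRel (x, y, 0) (x', y, 0)
  | one (x : X) (y y' : Y) : JoinRel (x, y, 1) (x, y', 1)

/-- The join `X ⋆ Y`, a quotient of `X × Y × [0, 1]`. -/
abbrev topJoin : TopCat.{u} := TopCat.of (Quot (JoinRel X Y))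

/-- The relation on `X × [0, 1]` collapsing `X × {0}` to a point. -/
inductive ConeRel : X × I → X × I → Prop
  | zero (x x' : X) : ConeRel (x, 0) (x', 0)

/-- The cone `C_X`. -/
abbrev topCone : TopCat.{u} := TopCat.of (Quot (ConeRel X))

/-- The inclusion `X → C_X` of the base of the cone. -/
def coneIncl : X ⟶ topCone X :=
  TopCat.ofHom ⟨fun x => Quot.mk _ (x, 1), continuous_quot_mk.comp (by fun_prop)⟩

variable {X Y}

/-- The map `f ⋆ g` induced by `f × g × id`. -/
def joinMap (f : X ⟶ X) (g : Y ⟶ Y) : topJoin X Y ⟶ topJoin X Y :=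
  TopCat.ofHom ⟨Quot.map (fun w => (f w.1, g w.2.1, w.2.2))
    (by rintro _ _ (⟨x, x', y⟩ | ⟨x, y, y'⟩) <;> constructor),
    continuous_quot_lift _ (continuous_quot_mk.comp (by fun_prop))⟩

/-- The map of cones induced by `f × id`. -/
def coneMap (f : X ⟶ X) : topCone X ⟶ topCone X :=
  TopCat.ofHom ⟨Quot.map (fun w => (f w.1, w.2))
    (by rintro _ _ ⟨x, x'⟩; constructor),
    continuous_quot_lift _ (continuous_quot_mk.comp (by fun_prop))⟩

lemma coneIncl_coneMap (f : X ⟶ X) : coneIncl X ≫ coneMap f = f ≫ coneIncl X := rfl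

variable (X Y)

/-- The part `A` of the join where `t ≤ 3/4`. -/
def joinLower : Set (topJoin X Y) := Quot.mk _ '' {w : X × Y × I | (w.2.2 : ℝ) ≤ 3 / 4}

/-- The part `B` of the join where `1/4 ≤ t`. -/
def joinUpper : Set (topJoin X Y) := Quot.mk _ '' {w : X × Y × I | 1 / 4 ≤ (w.2.2 : ℝ)}

/-- The inclusion `X × Y → A ∩ B`, `(x, y) ↦ [x, y, 1/2]`. -/
def joinMid : TopCat.of (X × Y) ⟶ TopCat.of ↥(joinLower X Y ∩ joinUpper X Y) :=
  TopCat.ofHom ⟨fun w => ⟨Quot.mk _ (w.1, w.2, ⟨1 / 2, by norm_num, by norm_num⟩),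
    ⟨_, by norm_num, rfl⟩, ⟨_, by norm_num, rfl⟩⟩,
    (continuous_quot_mk.comp (by fun_prop)).subtype_mk _⟩

end Join

section MayerVietoris

variable (R : Type u) [CommRing R] {Z : TopCat.{u}}

/-- The inclusion of a subspace. -/
abbrev subIncl (A : Set Z) : TopCat.of A ⟶ Z := TopCat.ofHom ⟨Subtype.val, continuous_subtype_val⟩

/-- The inclusion of a subspace in a larger subspace. -/
abbrev inclOfSubset {A B : Set Z} (h : A ⊆ B) : TopCat.of A ⟶ TopCat.of B :=
  TopCat.ofHom (ContinuousMap.inclusion h)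

/-- `w ∈ H_n(A ∩ B)` is the image of `z ∈ H_{n+1}(Z)` under the Mayer-Vietoris boundary: `z` is the
class of a cycle `a - b` with `a` a chain of `A` and `b` a chain of `B`, and `w` is the class of the
cycle `c` of `A ∩ B` with `d a = c = d b`. (Connecting map of the short exact sequence
`0 → C(A ∩ B) → C(A) ⊕ C(B) → C(A) + C(B) → 0` with maps `c ↦ (c, c)` and `(a, b) ↦ a - b`.) -/
def IsMayerVietorisBoundary (A B : Set Z) (n : ℕ) (z : singH R (n + 1) Z)
    (w : singH R n (TopCat.of ↥(A ∩ B))) : Prop :=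
  ∃ (a : (singChains R (TopCat.of A)).X (n + 1)) (b : (singChains R (TopCat.of B)).X (n + 1))
    (s : (singChains R Z).cycles (n + 1)) (c : (singChains R (TopCat.of ↥(A ∩ B))).cycles n),
    cycleClass R (n + 1) Z s = z ∧ cycleClass R n _ c = w ∧
    cycleChain R (n + 1) Z s = ((singChainsMap R (subIncl A)).f (n + 1)).hom a -
      ((singChainsMap R (subIncl B)).f (n + 1)).hom b ∧
    ((singChains R (TopCat.of A)).d (n + 1) n).hom a =
      ((singChainsMap R (inclOfSubset (Set.inter_subset_left (s := A) (t := B)))).f n).hom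
        (cycleChain R n _ c) ∧
    ((singChains R (TopCat.of B)).d (n + 1) n).hom b =
      ((singChainsMap R (inclOfSubset (Set.inter_subset_right (s := A) (t := B)))).f n).hom
        (cycleChain R n _ c)

end MayerVietoris

section Ker

open scoped TensorProduct DirectSum

variable (R : Type u) [CommRing R] (X Y : TopCat.{u})

/-- The degree `p` part of `Ker i_X`. -/
def kerCone (p : ℕ) : Submodule R (singH R p X) := LinearMap.ker (singHMap R p (coneIncl X))

variable {X} in
/-- `f_*` preserves `Ker i_X`. -/
lemma singHMap_mem_kerCone (p : ℕ) (f : X ⟶ X) (x : singH R p X) (hx : x ∈ kerCone R X p) :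
    singHMap R p f x ∈ kerCone R X p := by
  have h : singHMap R p (coneIncl X) ∘ₗ singHMap R p f =
      singHMap R p (coneMap f) ∘ₗ singHMap R p (coneIncl X) := by
    rw [← ModuleCat.hom_comp, ← ModuleCat.hom_comp, ← Functor.map_comp, ← Functor.map_comp,
      coneIncl_coneMap]
  have h := LinearMap.congr_fun h x
  have hx : singHMap R p (coneIncl X) x = 0 := hx
  simp only [LinearMap.comp_apply, hx, map_zero] at h
  exact h

variable {X} in
/-- The restriction of `f_*` to the degree `p` part of `Ker i_X`. -/
def kerConeMap (p : ℕ) (f : X ⟶ X) : kerCone R X p →ₗ[R] kerCone R X p :=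
  (singHMap R p f).restrict (singHMap_mem_kerCone R p f)

/-- The degree `n` part of `Ker i_X ⊗ Ker i_Y`. -/
abbrev kerTensor (n : ℕ) : Type u :=
  ⨁ i : Finset.HasAntidiagonal.antidiagonal n, (kerCone R X i.1.1 ⊗[R] kerCone R Y i.1.2)

/-- The map `(Ker i_X ⊗ Ker i_Y)_n → (H_*(X) ⊗ H_*(Y))_n` given by the inclusions. -/
def kerTensorIncl (n : ℕ) : kerTensor R X Y n →ₗ[R] homologyTensor R X Y n :=
  DirectSum.lmap fun i =>
    TensorProduct.map (kerCone R X i.1.1).subtype (kerCone R Y i.1.2).subtype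

variable {X Y} in
/-- The map `f_* ⊗ g_*` on the degree `n` part of `Ker i_X ⊗ Ker i_Y`. -/
def kerTensorMap (n : ℕ) (f : X ⟶ X) (g : Y ⟶ Y) : kerTensor R X Y n →ₗ[R] kerTensor R X Y n :=
  DirectSum.lmap fun i => TensorProduct.map (kerConeMap R i.1.1 f) (kerConeMap R i.1.2 g)

end Ker

/-- The ring of integers, as a type in the universe `u` of the spaces. -/
def IntRing : Type u := ULift.{u} ℤ

instance : CommRing IntRing.{u} := inferInstanceAs (CommRing (ULift.{u} ℤ))

end

/-! In the part `A` of the join the parameter `t` can be pushed down to `0`, which forgets `x`; in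
`B` it can be pushed up to `1`, which forgets `y`. Up to homotopy the inclusions of `A ∩ B` in `A`
and `B` are thus the two projections of `X × Y`. Moreover both inclusions of `A` and `B` in the join
are null-homotopic: once at `[x₀, y, 0]`, slide along `t` to `[x₀, y, 1] = [x₀, y₀, 1]`. So `A` and
`B` contribute nothing in positive degrees, and the Mayer-Vietoris boundary identifies the homology
of the join in degree `n + 1` with the classes of `X × Y` in degree `n` whose projections to `X` and
`Y` both vanish (`joinBoundary_injective`, `range_joinBoundary`).

Under the Tor hypothesis the Künneth map is bijective (`kunnethMap_injective`,
`kunnethMap_surjective`). The kernel of `H(X) → H(C_X)` is the kernel of the endomorphism `c_*`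
induced by a constant map, that is, reduced homology (`mem_kerCone_iff`), and `1 - c_*` projects
onto it. Hence the classes with vanishing projections are exactly the Künneth images of the tensor
product of the kernels (`exists_kerTensorIncl_eq`). The isomorphism is the boundary followed by the
inverse of `s_* ∘ κ`; it is natural because both maps are natural and `s_* ∘ κ` is injective.

Two classical theorems are proved on the way. The Künneth theorem combines the Eilenberg-Zilber
theorem, obtained by acyclic models as exactness of the mapping cone of the cross product
(`exact_of_exact_topSimplex`, `CrossCone.exact`), with an ungraded algebraic argument
(`kunneth_surjective`, `kunneth_injective`); a complex is there a single module with a differential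
and a sign involution. The Mayer-Vietoris sequence comes from barycentric subdivision
(`exists_small_cycle`, `exists_small_boundary`) and from the fact that chains common to `A` and `B`
are chains of `A ∩ B` (`exists_inter_chain`). -/

noncomputable section

/-! ### Singular simplices as a basis of the singular chains. -/

section Chains

open scoped Simplicial DirectSum TensorProduct

variable (R : Type u) [CommRing R] {X Y Z : TopCat.{u}}

lemma singChainsMap_simplexChain {n : ℕ} (f : X ⟶ Y) (σ : (TopCat.toSSet.obj X) _⦋n⦌) (r : R) :
    ((singChainsMap R f).f n).hom (simplexChain R σ r) =
      simplexChain R ((TopCat.toSSet.map f).app _ σ) r :=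
  LinearMap.congr_fun (congrArg ModuleCat.Hom.hom
    (SSet.ι_chainComplexMap_f _ _ (TopCat.toSSet.map f) (ModuleCat.of R R) σ)) r

variable (X) in
/-- The coordinates of a singular chain. -/
def chainRepr (n : ℕ) : (singChains R X).X n →ₗ[R] ((TopCat.toSSet.obj X) _⦋n⦌ →₀ R) :=
  (show (singChains R X).X n ⟶ ModuleCat.of R ((TopCat.toSSet.obj X) _⦋n⦌ →₀ R) from
    Limits.Sigma.desc fun σ => ModuleCat.ofHom (Finsupp.lsingle σ)).hom

lemma chainRepr_simplexChain {n : ℕ} (σ : (TopCat.toSSet.obj X) _⦋n⦌) (r : R) :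
    chainRepr R X n (simplexChain R σ r) = Finsupp.single σ r := by
  have h := Limits.Sigma.ι_desc (fun σ : (TopCat.toSSet.obj X) _⦋n⦌ =>
    (ModuleCat.ofHom (Finsupp.lsingle (R := R) (M := R) σ) :
      ModuleCat.of R R ⟶ ModuleCat.of R ((TopCat.toSSet.obj X) _⦋n⦌ →₀ R))) σ
  exact LinearMap.congr_fun (congrArg ModuleCat.Hom.hom h) r

variable (X) in
/-- The singular simplices form a basis of the singular chains. -/
def simplexBasis (n : ℕ) : Module.Basis ((TopCat.toSSet.obj X) _⦋n⦌) R ((singChains R X).X n) :=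
  .ofRepr <| LinearEquiv.ofLinearMap (chainRepr R X n)
    (Finsupp.linearCombination R fun σ => simplexChain R σ 1)
    (by
      ext σ : 2
      simp only [LinearMap.comp_apply, Finsupp.lsingle_apply, LinearMap.id_apply,
        Finsupp.linearCombination_single, one_smul]
      exact chainRepr_simplexChain R σ 1)
    (by
      refine chain_ext R fun σ => ?_
      rw [LinearMap.comp_apply, chainRepr_simplexChain, Finsupp.linearCombination_single, one_smul]
      rfl)

@[simp]
lemma simplexBasis_apply {n : ℕ} (σ : (TopCat.toSSet.obj X) _⦋n⦌) :
    simplexBasis R X n σ = simplexChain R σ 1 := by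
  rw [Module.Basis.apply_eq_iff]
  exact chainRepr_simplexChain R σ 1

end Chains

/-! ### A chain complex as one module with a differential. -/

section Tot

open scoped DirectSum

variable {R : Type u} [CommRing R] (K L M : ChainComplex (ModuleCat.{u} R) ℕ)

/-- The direct sum of the terms of a chain complex. -/
abbrev Tot : Type u := ⨁ n, K.X n

namespace Tot

variable {K L M}

/-- The inclusion of the degree `n` term. -/
abbrev of (n : ℕ) : K.X n →ₗ[R] Tot K := DirectSum.lof R ℕ (fun n => K.X n) n

lemma ext' {N : Type*} [AddCommGroup N] [Module R N] {f g : Tot K →ₗ[R] N}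
    (h : ∀ n x, f (of n x) = g (of n x)) : f = g :=
  DirectSum.linearMap_ext R fun n => LinearMap.ext fun x => h n x

variable (K) in
/-- The differential on the direct sum of the terms of a chain complex. -/
def d : Tot K →ₗ[R] Tot K :=
  -- In degree `0` the truncated subtraction gives `K.d 0 0`, which is zero by the shape of the
  -- complex, so no case distinction is needed.
  DirectSum.toModule R ℕ _ fun n => of (n - 1) ∘ₗ (K.d n (n - 1)).hom

@[simp]
lemma d_of_succ (n : ℕ) (x : K.X (n + 1)) : d K (of (n + 1) x) = of n ((K.d (n + 1) n).hom x) := by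
  rw [d, DirectSum.toModule_lof]
  rfl

@[simp]
lemma d_of_zero (x : K.X 0) : d K (of 0 x) = 0 := by
  rw [d, DirectSum.toModule_lof, K.shape _ _ (by simp)]
  simp

lemma d_d (x : Tot K) : d K (d K x) = 0 := by
  have : d K ∘ₗ d K = 0 := by
    refine ext' fun n x => ?_
    rcases n with _ | _ | n
    · simp
    · simp
    · have := LinearMap.congr_fun (congrArg ModuleCat.Hom.hom (K.d_comp_d (n + 2) (n + 1) n)) x
      simp only [ModuleCat.hom_comp, LinearMap.comp_apply, ModuleCat.hom_zero,
        LinearMap.zero_apply] at this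
      simp [this]
  exact LinearMap.congr_fun this x

/-- The map induced by a chain map. -/
def map (f : K ⟶ L) : Tot K →ₗ[R] Tot L := DirectSum.lmap fun n => (f.f n).hom

@[simp]
lemma map_of (f : K ⟶ L) (n : ℕ) (x : K.X n) : map f (of n x) = of n ((f.f n).hom x) := by
  rw [map, DirectSum.lmap_lof]

lemma map_id (x : Tot K) : map (𝟙 K) x = x := by
  have : map (𝟙 K) = LinearMap.id := ext' fun n x => by simp
  exact LinearMap.congr_fun this x

lemma map_comp (f : K ⟶ L) (g : L ⟶ M) (x : Tot K) : map (f ≫ g) x = map g (map f x) := by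
  have : map (f ≫ g) = map g ∘ₗ map f := ext' fun n x => by simp
  exact LinearMap.congr_fun this x

lemma d_map (f : K ⟶ L) (x : Tot K) : d L (map f x) = map f (d K x) := by
  have : d L ∘ₗ map f = map f ∘ₗ d K := by
    refine ext' fun n x => ?_
    rcases n with _ | n
    · simp
    · have := LinearMap.congr_fun (congrArg ModuleCat.Hom.hom (f.comm (n + 1) n)) x
      simp only [ModuleCat.hom_comp, LinearMap.comp_apply] at this
      simp [this]
  exact LinearMap.congr_fun this x

/-- The map of degree one given by a chain homotopy. -/
def htpy {f g : K ⟶ L} (h : Homotopy f g) : Tot K →ₗ[R] Tot L :=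
  DirectSum.toModule R ℕ _ fun n => of (n + 1) ∘ₗ (h.hom n (n + 1)).hom

@[simp]
lemma htpy_of {f g : K ⟶ L} (h : Homotopy f g) (n : ℕ) (x : K.X n) :
    htpy h (of n x) = of (n + 1) ((h.hom n (n + 1)).hom x) := by
  rw [htpy, DirectSum.toModule_lof]
  rfl

lemma htpy_spec {f g : K ⟶ L} (h : Homotopy f g) (x : Tot K) :
    d L (htpy h x) + htpy h (d K x) = map f x - map g x := by
  have : d L ∘ₗ htpy h + htpy h ∘ₗ d K = map f - map g := by
    refine ext' fun n x => ?_
    have := LinearMap.congr_fun (congrArg ModuleCat.Hom.hom (h.comm n)) x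
    rcases n with _ | n
    · simp only [Homotopy.dNext_zero_chainComplex, Homotopy.prevD_chainComplex, zero_add,
        ModuleCat.hom_add, ModuleCat.hom_comp, LinearMap.add_apply, LinearMap.comp_apply] at this
      simp [this]
    · simp only [Homotopy.dNext_succ_chainComplex, Homotopy.prevD_chainComplex,
        ModuleCat.hom_add, ModuleCat.hom_comp, LinearMap.add_apply, LinearMap.comp_apply] at this
      simp [this]
      abel
  exact LinearMap.congr_fun this x

variable (K) in
/-- The sign involution `x ↦ (-1) ^ n • x` in degree `n`. -/
def sign : Tot K →ₗ[R] Tot K := DirectSum.lmap fun n => ((-1) ^ n : ℤ) • LinearMap.id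

@[simp]
lemma sign_of (n : ℕ) (x : K.X n) : sign K (of n x) = ((-1) ^ n : ℤ) • of n x := by
  rw [sign, DirectSum.lmap_lof, LinearMap.smul_apply, map_zsmul, LinearMap.id_apply]

lemma sign_sign (x : Tot K) : sign K (sign K x) = x := by
  have : sign K ∘ₗ sign K = LinearMap.id := by
    refine ext' fun n x => ?_
    simp [smul_smul, ← mul_pow]
  exact LinearMap.congr_fun this x

/-- This anticommutation takes the place of the degree-dependent sign of the Leibniz rule; later
arguments use it without mentioning degrees. -/
lemma d_sign (x : Tot K) : d K (sign K x) = - sign K (d K x) := by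
  have : d K ∘ₗ sign K = - (sign K ∘ₗ d K) := by
    refine ext' fun n x => ?_
    rcases n with _ | n
    · simp
    · simp [pow_succ]
  exact LinearMap.congr_fun this x

end Tot

end Tot


/-! ### Acyclic models on the topological simplices. -/

section Models

open scoped Simplicial

/-- The topological simplex, in the universe `u`. -/
abbrev topSimplex (q : ℕ) : TopCat.{u} := SimplexCategory.toTop.{u}.obj ⦋q⦌

/-- The identity of the topological simplex, as a singular simplex. -/
def idSimplex (q : ℕ) : (TopCat.toSSet.obj (topSimplex.{u} q)) _⦋q⦌ := ⟨𝟙 _⟩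

/-- The continuous map underlying a singular simplex. -/
def simplexMap {Y : TopCat.{u}} {q : ℕ} (τ : (TopCat.toSSet.obj Y) _⦋q⦌) : topSimplex.{u} q ⟶ Y :=
  τ.down

lemma map_idSimplex {Y : TopCat.{u}} {q : ℕ} (τ : (TopCat.toSSet.obj Y) _⦋q⦌) :
    (TopCat.toSSet.map (simplexMap τ)).app _ (idSimplex q) = τ := rfl

lemma simplexMap_map {Y Y' : TopCat.{u}} (f : Y ⟶ Y') {q : ℕ} (τ : (TopCat.toSSet.obj Y) _⦋q⦌) :
    simplexMap ((TopCat.toSSet.map f).app _ τ) = simplexMap τ ≫ f := rfl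

lemma toSSet_map_comp_app {X Y Z : TopCat.{u}} (f : X ⟶ Y) (g : Y ⟶ Z) {q : ℕ}
    (τ : (TopCat.toSSet.obj X) _⦋q⦌) :
    (TopCat.toSSet.map (f ≫ g)).app (.op ⦋q⦌) τ =
      (TopCat.toSSet.map g).app _ ((TopCat.toSSet.map f).app _ τ) := rfl

variable {R : Type u} [CommRing R] {I : Type*} (dim deg : I → ℕ)
  {K : TopCat.{u} → Type u} [∀ Y, AddCommGroup (K Y)] [∀ Y, Module R (K Y)]
  (b : ∀ Y, Module.Basis (Σ i, (TopCat.toSSet.obj Y) _⦋dim i⦌) R (K Y))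
  (F : ∀ {Y Y' : TopCat.{u}}, (Y ⟶ Y') → K Y →ₗ[R] K Y')

/-- The natural endomorphism with prescribed values on the universal elements. -/
def ofUniversal (s : ∀ i, K (topSimplex (dim i))) (Y : TopCat.{u}) : K Y →ₗ[R] K Y :=
  (b Y).constr R fun x => F (simplexMap x.2) (s x.1)

lemma ofUniversal_basis (s : ∀ i, K (topSimplex (dim i))) (Y : TopCat.{u}) (i) (τ) :
    ofUniversal dim b F s Y (b Y ⟨i, τ⟩) = F (simplexMap τ) (s i) := by
  rw [ofUniversal, Module.Basis.constr_basis]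

/-- Pushing `τ` forward along `f` composes its classifying map with `f`. Functoriality of `F` is not
a hypothesis: it is forced by the action of `F` on the basis. -/
lemma map_ofUniversal
    (hF : ∀ {Y Y' : TopCat.{u}} (f : Y ⟶ Y') i τ,
      F f (b Y ⟨i, τ⟩) = b Y' ⟨i, (TopCat.toSSet.map f).app _ τ⟩)
    (s : ∀ i, K (topSimplex (dim i))) {Y Y' : TopCat.{u}} (f : Y ⟶ Y') (x : K Y) :
    F f (ofUniversal dim b F s Y x) = ofUniversal dim b F s Y' (F f x) := by
  have comp : ∀ {Y₁ Y₂ Y₃ : TopCat.{u}} (f : Y₁ ⟶ Y₂) (g : Y₂ ⟶ Y₃) (x : K Y₁),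
      F (f ≫ g) x = F g (F f x) := by
    intro Y₁ Y₂ Y₃ f g x
    have : F (f ≫ g) = F g ∘ₗ F f := by
      refine (b Y₁).ext fun ⟨i, τ⟩ => ?_
      rw [LinearMap.comp_apply, hF, hF, hF, toSSet_map_comp_app]
    exact LinearMap.congr_fun this x
  have : F f ∘ₗ ofUniversal dim b F s Y = ofUniversal dim b F s Y' ∘ₗ F f := by
    refine (b Y).ext fun ⟨i, τ⟩ => ?_
    rw [LinearMap.comp_apply, LinearMap.comp_apply, hF, ofUniversal_basis, ofUniversal_basis,
      simplexMap_map, comp]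
  exact LinearMap.congr_fun this x

/-- Acyclic models: a natural differential module that is free on simplices is exact if it is
exact on simplices. -/
theorem exact_of_exact_topSimplex
    (hF : ∀ {Y Y' : TopCat.{u}} (f : Y ⟶ Y') i τ,
      F f (b Y ⟨i, τ⟩) = b Y' ⟨i, (TopCat.toSSet.map f).app _ τ⟩)
    (d : ∀ Y, K Y →ₗ[R] K Y) (hdd : ∀ Y x, d Y (d Y x) = 0)
    (hdF : ∀ {Y Y' : TopCat.{u}} (f : Y ⟶ Y') x, d Y' (F f x) = F f (d Y x))
    (hdeg : ∀ i, d _ (b _ ⟨i, idSimplex _⟩) ∈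
      Submodule.span R (b (topSimplex (dim i)) '' {x | deg x.1 < deg i}))
    (hex : ∀ q x, d (topSimplex q) x = 0 → ∃ y, d (topSimplex q) y = x)
    (Y : TopCat.{u}) (x : K Y) (hx : d Y x = 0) : ∃ y, d Y y = x := by
  have hF' : ∀ {Y : TopCat.{u}} i (τ : (TopCat.toSSet.obj Y) _⦋dim i⦌),
      b Y ⟨i, τ⟩ = F (simplexMap τ) (b _ ⟨i, idSimplex _⟩) := by
    intro Y i τ
    rw [hF, map_idSimplex]
  -- The homotopy equation has to be solved on universal elements only; naturality of `ofUniversal`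
  -- and `d` carries it to every basis element of degree less than `n`.
  have htpy : ∀ (n : ℕ) (s : ∀ i, K (topSimplex (dim i))), (∀ i, deg i < n →
      d _ (s i) = b _ ⟨i, idSimplex _⟩ -
        ofUniversal dim b F s _ (d _ (b _ ⟨i, idSimplex _⟩))) →
      ∀ Y (x : K Y), x ∈ Submodule.span R (b Y '' {x | deg x.1 < n}) →
        d Y (ofUniversal dim b F s Y x) = x - ofUniversal dim b F s Y (d Y x) := by
    intro n s hs Y x hx
    induction hx using Submodule.span_induction with
    | mem x hx =>
      obtain ⟨⟨i, τ⟩, hi, rfl⟩ := hx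
      rw [ofUniversal_basis, hdF, hs i hi, map_sub, map_ofUniversal dim b F hF, ← hdF, ← hF']
    | zero => simp
    | add x y _ _ hx hy => simp only [map_add, hx, hy]; abel
    | smul r x _ hx => simp only [map_smul, hx, smul_sub]
  have key : ∀ n : ℕ, ∃ s : ∀ i, K (topSimplex (dim i)), ∀ i, deg i < n →
      d _ (s i) = b _ ⟨i, idSimplex _⟩ -
        ofUniversal dim b F s _ (d _ (b _ ⟨i, idSimplex _⟩)) := by
    intro n
    induction n with
    | zero => exact ⟨fun _ => 0, fun i hi => absurd hi (Nat.not_lt_zero _)⟩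
    | succ n ih =>
      obtain ⟨s, hs⟩ := ih
      have hS := htpy n s hs
      classical
      have hch : ∀ i, deg i = n → ∃ w, d _ w = b _ ⟨i, idSimplex _⟩ -
          ofUniversal dim b F s _ (d _ (b (topSimplex (dim i)) ⟨i, idSimplex _⟩)) := by
        intro i hi
        -- The right-hand side is a cycle: the boundary of the universal element has lower degree,
        -- where the homotopy equation is already available, and `d ∘ d = 0`.
        refine hex _ _ ?_
        rw [map_sub, hS _ _ (by rw [← hi]; exact hdeg i), hdd, map_zero, sub_zero, sub_self]
      choose w hw using hch
      refine ⟨fun i => if h : deg i = n then w i h else s i, fun i hi => ?_⟩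
      -- The new values in degree `n` do not disturb the equations for `deg i ≤ n`, since the
      -- boundary of a universal element only involves degrees below `deg i`.
      have hsame : ofUniversal dim b F (fun i => if h : deg i = n then w i h else s i) _
          (d _ (b _ ⟨i, idSimplex _⟩)) = ofUniversal dim b F s _
          (d _ (b (topSimplex (dim i)) ⟨i, idSimplex _⟩)) := by
        refine LinearMap.eqOn_span ?_ (hdeg i)
        rintro _ ⟨⟨j, τ⟩, hj, rfl⟩
        have : deg j ≠ n := by
          have : deg j < deg i := hj
          omega
        rw [ofUniversal_basis, ofUniversal_basis, dif_neg this]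
      rw [hsame]
      by_cases h : deg i = n
      · simp only [dif_pos h, hw]
      · simp only [dif_neg h, hs i (show deg i < n by omega)]
  -- A given `x` has finite support, so a contraction below one bound `n` is enough; applied to the
  -- cycle `x` it produces a primitive.
  obtain ⟨n, hn⟩ : ∃ n, ∀ i ∈ ((b Y).repr x).support, deg i.1 < n :=
    ⟨((b Y).repr x).support.sup (fun i => deg i.1) + 1, fun i hi =>
      Nat.lt_succ_of_le (Finset.le_sup (f := fun i => deg i.1) hi)⟩
  obtain ⟨s, hs⟩ := key n
  have hxs : x ∈ Submodule.span R (b Y '' {x | deg x.1 < n}) :=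
    (Module.Basis.mem_span_image _).2 fun i hi => hn i hi
  exact ⟨_, (htpy n s hs Y x hxs).trans (by rw [hx, map_zero, sub_zero])⟩

end Models

/-! ### The cross product on total complexes. -/

section CrossTot

open scoped Simplicial DirectSum TensorProduct

variable (R : Type u) [CommRing R] {X X' Y Y' Z : TopCat.{u}}

/-- The product of two continuous maps. -/
abbrev topProdMap (f : X ⟶ X') (g : Y ⟶ Y') : TopCat.of (X × Y) ⟶ TopCat.of (X' × Y') :=
  TopCat.ofHom (f.hom.prodMap g.hom)

lemma singChainsMap_chainCross (f : X ⟶ X') (g : Y ⟶ Y') (p q n : ℕ) (a : (singChains R X).X p)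
    (b : (singChains R Y).X q) :
    ((singChainsMap R (topProdMap f g)).f n).hom (chainCross R p q n a b) =
      chainCross R p q n (((singChainsMap R f).f p).hom a) (((singChainsMap R g).f q).hom b) := by
  have : (chainCross R p q n).compr₂ ((singChainsMap R (topProdMap f g)).f n).hom =
      (chainCross R p q n).compl₁₂ ((singChainsMap R f).f p).hom
        ((singChainsMap R g).f q).hom := by
    refine chain_ext R fun σ => chain_ext R fun τ => ?_
    simp only [LinearMap.compr₂_apply, LinearMap.compl₁₂_apply]
    rw [singChainsMap_simplexChain, singChainsMap_simplexChain, chainCross_simplexChain,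
      chainCross_simplexChain, map_sum]
    refine Finset.sum_congr rfl fun φ _ => ?_
    rw [map_zsmul, gridChain, singChainsMap_simplexChain]
    rfl
  exact LinearMap.congr_fun (LinearMap.congr_fun this a) b

/-- The total cross product of chains. -/
def crossTot₂ : Tot (singChains R X) →ₗ[R] Tot (singChains R Y) →ₗ[R]
    Tot (singChains R (TopCat.of (X × Y))) :=
  DirectSum.toModule R ℕ _ fun p => (DirectSum.toModule R ℕ _ fun q =>
    ((chainCross R p q (p + q)).compr₂ (Tot.of (p + q))).flip).flip

lemma crossTot₂_of {p q n : ℕ} (h : p + q = n) (a : (singChains R X).X p)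
    (b : (singChains R Y).X q) :
    crossTot₂ R (Tot.of p a) (Tot.of q b) = Tot.of n (chainCross R p q n a b) := by
  subst h
  rw [crossTot₂, DirectSum.toModule_lof, LinearMap.flip_apply, DirectSum.toModule_lof]
  rfl

lemma tot_ext₂ {K L : ChainComplex (ModuleCat.{u} R) ℕ} {N : Type*} [AddCommGroup N] [Module R N]
    {f g : Tot K →ₗ[R] Tot L →ₗ[R] N}
    (h : ∀ p q a b, f (Tot.of p a) (Tot.of q b) = g (Tot.of p a) (Tot.of q b)) : f = g :=
  Tot.ext' fun p a => Tot.ext' fun q b => h p q a b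

lemma map_crossTot₂ (f : X ⟶ X') (g : Y ⟶ Y') (a : Tot (singChains R X))
    (b : Tot (singChains R Y)) :
    Tot.map (singChainsMap R (topProdMap f g)) (crossTot₂ R a b) =
      crossTot₂ R (Tot.map (singChainsMap R f) a) (Tot.map (singChainsMap R g) b) := by
  have : (crossTot₂ R).compr₂ (Tot.map (singChainsMap R (topProdMap f g))) =
      (crossTot₂ R).compl₁₂ (Tot.map (singChainsMap R f)) (Tot.map (singChainsMap R g)) := by
    refine tot_ext₂ R fun p q a b => ?_
    simp only [LinearMap.compr₂_apply, LinearMap.compl₁₂_apply, Tot.map_of]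
    rw [crossTot₂_of R rfl, crossTot₂_of R rfl, Tot.map_of, singChainsMap_chainCross]
  exact LinearMap.congr_fun (LinearMap.congr_fun this a) b

/-- The four cases by whether a degree is zero merge into one formula, because `Tot.sign` supplies
the sign and `Tot.d` vanishes in degree `0`. -/
lemma d_crossTot₂ (a : Tot (singChains R X)) (b : Tot (singChains R Y)) :
    Tot.d _ (crossTot₂ R a b) =
      crossTot₂ R (Tot.d _ a) b + crossTot₂ R (Tot.sign _ a) (Tot.d _ b) := by
  have : (crossTot₂ R).compr₂ (Tot.d (singChains R (TopCat.of (X × Y)))) =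
      (crossTot₂ R).comp (Tot.d (singChains R X)) +
      (crossTot₂ R).compl₁₂ (Tot.sign (singChains R X)) (Tot.d (singChains R Y)) := by
    refine tot_ext₂ R fun p q a b => ?_
    simp only [LinearMap.compr₂_apply, LinearMap.compl₁₂_apply, LinearMap.add_apply,
      LinearMap.comp_apply]
    rcases p with _ | p <;> rcases q with _ | q
    · rw [crossTot₂_of R rfl]
      simp
    · rw [crossTot₂_of R (show 0 + (q + 1) = q + 1 by omega)]
      simp only [Tot.d_of_succ, Tot.d_of_zero, Tot.sign_of, pow_zero, one_smul]
      rw [d_chainCross_zero_succ R rfl, crossTot₂_of R (zero_add q)]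
      simp
    · rw [crossTot₂_of R (show (p + 1) + 0 = p + 1 by omega)]
      simp only [Tot.d_of_succ, Tot.d_of_zero]
      rw [d_chainCross_succ_zero R rfl, crossTot₂_of R (add_zero p)]
      simp
    · rw [crossTot₂_of R (show (p + 1) + (q + 1) = (p + q + 1) + 1 by omega)]
      simp only [Tot.d_of_succ, Tot.sign_of]
      rw [d_chainCross_succ_succ R (show p + 1 + q = p + q + 1 by omega),
        crossTot₂_of R (show p + (q + 1) = p + q + 1 by omega), map_zsmul, LinearMap.smul_apply,
        crossTot₂_of R (show p + 1 + q = p + q + 1 by omega), map_add, map_zsmul]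
  exact LinearMap.congr_fun (LinearMap.congr_fun this a) b

end CrossTot


/-! ### Chains of a point and of contractible spaces. -/

section Point

open scoped Simplicial DirectSum TensorProduct

variable (R : Type u) [CommRing R] {X Y : TopCat.{u}}

/-- The constant singular simplex. -/
def constSimplex (y : Y) (n : ℕ) : (TopCat.toSSet.obj Y) _⦋n⦌ :=
  (TopCat.toSSetObjEquiv Y (.op ⦋n⦌)).symm (ContinuousMap.const _ y)

/-- The constant map. -/
abbrev constMap (X : TopCat.{u}) (y : Y) : X ⟶ Y := TopCat.ofHom (ContinuousMap.const _ y)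

lemma constMap_simplex (y : Y) {n : ℕ} (σ : (TopCat.toSSet.obj X) _⦋n⦌) :
    (TopCat.toSSet.map (constMap X y)).app _ σ = constSimplex y n := rfl

lemma map_constSimplex (y : Y) {m n : ℕ} (α : ⦋m⦌ ⟶ ⦋n⦌) :
    (TopCat.toSSet.obj Y).map α.op (constSimplex y n) = constSimplex y m := rfl

/-- The inclusion `x ↦ (x, y)`. -/
abbrev sliceMap (X : TopCat.{u}) (y : Y) : X ⟶ TopCat.of (X × Y) :=
  TopCat.ofHom ((ContinuousMap.id X).prodMk (ContinuousMap.const _ y))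

/-- The first projection. -/
abbrev topFst (X Y : TopCat.{u}) : TopCat.of (X × Y) ⟶ X := TopCat.ofHom ContinuousMap.fst

/-- The second projection. -/
abbrev topSnd (X Y : TopCat.{u}) : TopCat.of (X × Y) ⟶ Y := TopCat.ofHom ContinuousMap.snd

/-- In a grid of height zero there is only one path. Hence the cross product with a vertex is a
single term, namely the inclusion of a slice. -/
instance (p : ℕ) : Unique (Shuffle p 0 p) where
  default := ⟨OrderHom.id, ⟨fun _ => 0, fun _ _ _ => le_rfl⟩, fun k => by simp⟩
  uniq φ := by
    have h : ∀ k, φ.snd k = 0 := fun k => Subsingleton.elim (α := Fin 1) _ _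
    refine Shuffle.ext ?_ ?_
    · ext k
      have := φ.add_eq k
      rw [h] at this
      simpa using this
    · ext k
      rw [h]
      rfl

lemma Shuffle.fst_default (p : ℕ) : (default : Shuffle p 0 p).fst = OrderHom.id := rfl

lemma Shuffle.sign_default (p : ℕ) : (default : Shuffle p 0 p).sign = 1 := by
  have h : ∀ k, (default : Shuffle p 0 p).snd k = 0 := fun k => Subsingleton.elim (α := Fin 1) _ _
  simp [Shuffle.sign, h]

lemma chainCross_constSimplex (p : ℕ) (a : (singChains R X).X p) (y : Y) :
    chainCross R p 0 p a (simplexChain R (constSimplex y 0) 1) =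
      ((singChainsMap R (sliceMap X y)).f p).hom a := by
  have : (chainCross R p 0 p).flip (simplexChain R (constSimplex y 0) 1) =
      ((singChainsMap R (sliceMap X y)).f p).hom := by
    refine chain_ext R fun σ => ?_
    rw [LinearMap.flip_apply, chainCross_simplexChain, Fintype.sum_unique, Shuffle.sign_default,
      one_smul, singChainsMap_simplexChain, gridChain, Shuffle.fst_default]
    have : (TopCat.toSSet.obj X).map (SimplexCategory.mkHom OrderHom.id).op σ = σ :=
      ConcreteCategory.congr_hom ((TopCat.toSSet.obj X).map_id (.op ⦋p⦌)) σ
    rw [this]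
    rfl
  exact LinearMap.congr_fun this a

lemma crossTot₂_constSimplex (a : Tot (singChains R X)) (y : Y) :
    crossTot₂ R a (Tot.of 0 (simplexChain R (constSimplex y 0) 1)) =
      Tot.map (singChainsMap R (sliceMap X y)) a := by
  have : (crossTot₂ R).flip (Tot.of 0 (simplexChain R (constSimplex y 0) 1)) =
      Tot.map (singChainsMap R (sliceMap X y)) := by
    refine Tot.ext' fun p a => ?_
    rw [LinearMap.flip_apply, crossTot₂_of R (add_zero p), chainCross_constSimplex, Tot.map_of]
  exact LinearMap.congr_fun this a

/-- The sum of the coefficients of a chain. -/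
def chainSum (Y : TopCat.{u}) (q : ℕ) : (singChains R Y).X q →ₗ[R] R :=
  (simplexBasis R Y q).constr R fun _ => 1

@[simp]
lemma chainSum_simplexChain {q : ℕ} (τ : (TopCat.toSSet.obj Y) _⦋q⦌) :
    chainSum R Y q (simplexChain R τ 1) = 1 := by
  rw [← simplexBasis_apply, chainSum, Module.Basis.constr_basis]

/-- The augmentation: the sum of the coefficients in degree `0`. -/
def totAug (Y : TopCat.{u}) : Tot (singChains R Y) →ₗ[R] R :=
  DirectSum.toModule R ℕ _ fun q => match q with
    | 0 => chainSum R Y 0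
    | _ + 1 => 0

lemma totAug_of_zero (x : (singChains R Y).X 0) : totAug R Y (Tot.of 0 x) = chainSum R Y 0 x := by
  rw [totAug, DirectSum.toModule_lof]

lemma totAug_of_succ {q : ℕ} (x : (singChains R Y).X (q + 1)) :
    totAug R Y (Tot.of (q + 1) x) = 0 := by
  rw [totAug, DirectSum.toModule_lof]
  rfl

/-- The chain homotopy that contracts the chains of a point. -/
def constHtpy (y : Y) : Tot (singChains R Y) →ₗ[R] Tot (singChains R Y) :=
  DirectSum.toModule R ℕ _ fun q => if Even q then 0 else
    LinearMap.smulRight (chainSum R Y q) (Tot.of (q + 1) (simplexChain R (constSimplex y (q + 1)) 1))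

lemma constHtpy_even (y : Y) {q : ℕ} (h : Even q) (x : (singChains R Y).X q) :
    constHtpy R y (Tot.of q x) = 0 := by
  rw [constHtpy, DirectSum.toModule_lof, if_pos h, LinearMap.zero_apply]

lemma constHtpy_odd (y : Y) {q : ℕ} (h : ¬ Even q) (x : (singChains R Y).X q) :
    constHtpy R y (Tot.of q x) = chainSum R Y q x •
      Tot.of (q + 1) (simplexChain R (constSimplex y (q + 1)) 1) := by
  rw [constHtpy, DirectSum.toModule_lof, if_neg h, LinearMap.smulRight_apply]

lemma chainSum_d {q : ℕ} (τ : (TopCat.toSSet.obj Y) _⦋q + 1⦌) :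
    chainSum R Y q (((singChains R Y).d (q + 1) q).hom (simplexChain R τ 1)) =
      if Even q then 0 else 1 := by
  rw [d_simplexChain, map_sum]
  simp only [map_zsmul, chainSum_simplexChain]
  have := Fin.sum_neg_one_pow R (q + 2)
  simp only [zsmul_eq_mul, mul_one, Int.cast_pow, Int.cast_neg, Int.cast_one]
  rw [this]
  simp [Nat.even_add]

lemma d_constSimplex (y : Y) (q : ℕ) :
    ((singChains R Y).d (q + 1) q).hom (simplexChain R (constSimplex y (q + 1)) 1) =
      if Even q then 0 else simplexChain R (constSimplex y q) 1 := by
  rw [d_simplexChain]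
  simp only [map_constSimplex]
  rw [← Finset.sum_smul, Fin.sum_neg_one_pow]
  simp [Nat.even_add, ite_smul]

/-- In degree `q > 0` exactly one term on the left survives. For odd `q` it is the boundary of the
constant `(q + 1)`-simplex, which is the constant `q`-simplex; for even `q` it is the homotopy
applied to a boundary, whose coefficients sum to `1`. In degree `0` both sides vanish. -/
lemma constHtpy_spec (y : Y) (x : Tot (singChains R Y)) :
    Tot.d _ (constHtpy R y x) + constHtpy R y (Tot.d _ x) =
      Tot.map (singChainsMap R (constMap Y y)) x -
        totAug R Y x • Tot.of 0 (simplexChain R (constSimplex y 0) 1) := by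
  have : Tot.d _ ∘ₗ constHtpy R y + constHtpy R y ∘ₗ Tot.d _ =
      Tot.map (singChainsMap R (constMap Y y)) -
        (totAug R Y).smulRight (Tot.of 0 (simplexChain R (constSimplex y 0) 1)) := by
    refine DirectSum.linearMap_ext R fun q => chain_ext R fun τ => ?_
    simp only [LinearMap.comp_apply, LinearMap.add_apply, LinearMap.sub_apply,
      LinearMap.smulRight_apply, Tot.map_of]
    rw [singChainsMap_simplexChain, constMap_simplex]
    rcases q with _ | q
    · rw [constHtpy_even R y (by simp), Tot.d_of_zero, totAug_of_zero, chainSum_simplexChain]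
      simp
    · rw [totAug_of_succ, Tot.d_of_succ, zero_smul, sub_zero]
      by_cases hq : Even q
      · rw [constHtpy_odd R y (by simpa [Nat.even_add_one] using hq), constHtpy_even R y hq,
          chainSum_simplexChain, one_smul, Tot.d_of_succ, d_constSimplex,
          if_neg (by simpa [Nat.even_add_one] using hq), add_zero]
      · rw [constHtpy_odd R y hq, constHtpy_even R y (by simpa [Nat.even_add_one] using hq),
          chainSum_d, if_neg hq, map_zero, zero_add, one_smul]
  exact LinearMap.congr_fun this x

/-- Two homotopies are added: from the identity to a constant map, and from the constant map to the
augmentation. -/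
lemma exists_contraction [ContractibleSpace Y] : ∃ (y : Y)
    (h : Tot (singChains R Y) →ₗ[R] Tot (singChains R Y)), ∀ x, Tot.d _ (h x) + h (Tot.d _ x) =
      x - totAug R Y x • Tot.of 0 (simplexChain R (constSimplex y 0) 1) := by
  obtain ⟨y, ⟨H⟩⟩ := id_nullhomotopic Y
  let H' : TopCat.Homotopy (𝟙 Y) (constMap Y y) := H
  refine ⟨y, Tot.htpy (H'.singularChainComplexFunctorObjMap (ModuleCat.of R R)) + constHtpy R y,
    fun x => ?_⟩
  have h1 := Tot.htpy_spec (H'.singularChainComplexFunctorObjMap (ModuleCat.of R R)) x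
  have h2 := constHtpy_spec R y x
  have h3 : Tot.map (singChainsMap R (𝟙 Y)) x = x := by
    rw [singChainsMap, CategoryTheory.Functor.map_id, Tot.map_id]
  rw [h3] at h1
  simp only [LinearMap.add_apply, map_add]
  rw [add_add_add_comm, h1, h2]
  abel

lemma exists_slice_contraction (X : TopCat.{u}) [ContractibleSpace Y] (y : Y) :
    ∃ (h : Tot (singChains R (TopCat.of (X × Y))) →ₗ[R] Tot (singChains R (TopCat.of (X × Y)))),
      ∀ x, Tot.d _ (h x) + h (Tot.d _ x) =
        x - Tot.map (singChainsMap R (sliceMap X y)) (Tot.map (singChainsMap R (topFst X Y)) x) := by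
  obtain ⟨H⟩ : (ContinuousMap.id Y).Homotopic (ContinuousMap.const _ y) := by
    -- The end point `y'` of a contraction is not under control, whereas the slice must pass through
    -- the prescribed `y`; a path in `Y` joins the two.
    obtain ⟨y', h⟩ := id_nullhomotopic Y
    exact h.trans ⟨(PathConnectedSpace.joined y' y).somePath.toHomotopyConst⟩
  let H' : TopCat.Homotopy (𝟙 (TopCat.of (X × Y))) (topFst X Y ≫ sliceMap X y) :=
    show ContinuousMap.Homotopy ((ContinuousMap.id X).prodMap (ContinuousMap.id Y))
      ((ContinuousMap.id X).prodMap (ContinuousMap.const _ y)) from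
    (ContinuousMap.Homotopy.refl (ContinuousMap.id X)).prodMap H
  refine ⟨Tot.htpy (H'.singularChainComplexFunctorObjMap (ModuleCat.of R R)), fun x => ?_⟩
  have h1 := Tot.htpy_spec (H'.singularChainComplexFunctorObjMap (ModuleCat.of R R)) x
  rw [h1, CategoryTheory.Functor.map_id, Tot.map_id, CategoryTheory.Functor.map_comp, Tot.map_comp]

end Point


/-! ### The Eilenberg-Zilber theorem, as exactness of the mapping cone of the cross product. -/

section EilenbergZilber

open scoped Simplicial DirectSum TensorProduct

variable (R : Type u) [CommRing R] (X : TopCat.{u}) {Y Y' : TopCat.{u}}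

section Tensor

variable {R} (K L : ChainComplex (ModuleCat.{u} R) ℕ)

/-- The differential of the tensor product. -/
def tensorD : Tot K ⊗[R] Tot L →ₗ[R] Tot K ⊗[R] Tot L :=
  (Tot.d K).rTensor _ + TensorProduct.map (Tot.sign K) (Tot.d L)

variable {K L}

@[simp]
lemma tensorD_tmul (a : Tot K) (b : Tot L) :
    tensorD K L (a ⊗ₜ b) = Tot.d K a ⊗ₜ b + Tot.sign K a ⊗ₜ Tot.d L b := by
  simp [tensorD]

lemma tensorD_tensorD (t : Tot K ⊗[R] Tot L) : tensorD K L (tensorD K L t) = 0 := by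
  have : tensorD K L ∘ₗ tensorD K L = 0 := by
    refine TensorProduct.ext' fun a b => ?_
    simp [Tot.d_d, Tot.d_sign, TensorProduct.neg_tmul]
  exact LinearMap.congr_fun this t

end Tensor

variable {X} in
/-- The cross product as a map on the tensor product. -/
def crossTot : Tot (singChains R X) ⊗[R] Tot (singChains R Y) →ₗ[R]
    Tot (singChains R (TopCat.of (X × Y))) :=
  TensorProduct.lift (crossTot₂ R)

lemma d_crossTot (t : Tot (singChains R X) ⊗[R] Tot (singChains R Y)) :
    Tot.d _ (crossTot R t) = crossTot R (tensorD _ _ t) := by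
  have : Tot.d _ ∘ₗ crossTot R (X := X) (Y := Y) = crossTot R ∘ₗ tensorD _ _ := by
    refine TensorProduct.ext' fun a b => ?_
    simp [crossTot, d_crossTot₂]
  exact LinearMap.congr_fun this t

/-- The mapping cone of the cross product. -/
abbrev CrossCone (Y : TopCat.{u}) : Type u :=
  Tot (singChains R (TopCat.of (X × Y))) × (Tot (singChains R X) ⊗[R] Tot (singChains R Y))

namespace CrossCone

/-- The differential of the mapping cone. -/
def d (Y : TopCat.{u}) : CrossCone R X Y →ₗ[R] CrossCone R X Y :=
  ((Tot.d _).coprod (crossTot R)).prod (- (tensorD _ _ ∘ₗ LinearMap.snd R _ _))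

lemma d_apply (x : CrossCone R X Y) :
    d R X Y x = (Tot.d _ x.1 + crossTot R x.2, - tensorD _ _ x.2) := rfl

lemma d_d (x : CrossCone R X Y) : d R X Y (d R X Y x) = 0 := by
  simp only [d_apply, map_add, Tot.d_d, d_crossTot, map_neg, tensorD_tensorD, zero_add,
    add_neg_cancel, neg_zero]
  rfl

/-- The map induced by a continuous map of the second factor. -/
def map (f : Y ⟶ Y') : CrossCone R X Y →ₗ[R] CrossCone R X Y' :=
  (Tot.map (singChainsMap R (topProdMap (𝟙 X) f))).prodMap
    ((Tot.map (singChainsMap R f)).lTensor _)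

lemma d_map (f : Y ⟶ Y') (x : CrossCone R X Y) : d R X Y' (map R X f x) = map R X f (d R X Y x) := by
  have h1 : ∀ t : Tot (singChains R X) ⊗[R] Tot (singChains R Y),
      crossTot R ((Tot.map (singChainsMap R f)).lTensor _ t) =
        Tot.map (singChainsMap R (topProdMap (𝟙 X) f)) (crossTot R t) := by
    intro t
    have : crossTot R ∘ₗ (Tot.map (singChainsMap R f)).lTensor _ =
        Tot.map (singChainsMap R (topProdMap (𝟙 X) f)) ∘ₗ crossTot R := by
      refine TensorProduct.ext' fun a b => ?_
      simp only [LinearMap.comp_apply, LinearMap.lTensor_tmul, crossTot, TensorProduct.lift.tmul]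
      rw [map_crossTot₂, singChainsMap, singChainsMap, CategoryTheory.Functor.map_id, Tot.map_id]
    exact LinearMap.congr_fun this t
  have h2 : ∀ t : Tot (singChains R X) ⊗[R] Tot (singChains R Y),
      tensorD _ _ ((Tot.map (singChainsMap R f)).lTensor _ t) =
        (Tot.map (singChainsMap R f)).lTensor _ (tensorD _ _ t) := by
    intro t
    have : tensorD _ _ ∘ₗ (Tot.map (singChainsMap R f)).lTensor _ =
        (Tot.map (singChainsMap R f)).lTensor _ ∘ₗ
          tensorD (singChains R X) (singChains R Y) := by
      refine TensorProduct.ext' fun a b => ?_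
      simp [Tot.d_map]
    exact LinearMap.congr_fun this t
  simp only [map, d_apply, LinearMap.prodMap_apply, h1, h2, Tot.d_map, map_add, map_neg]

/-- The index set of the natural basis. -/
abbrev Idx : Type u :=
  (Σ n : ℕ, (TopCat.toSSet.obj X) _⦋n⦌) ⊕ ((Σ p : ℕ, (TopCat.toSSet.obj X) _⦋p⦌) × ℕ)

variable {X} in
/-- The dimension of the simplex of `Y` in a basis element. -/
def dim : Idx X → ℕ := Sum.elim (fun x => x.1) (fun x => x.2)

variable {X} in
/-- The degree of a basis element. -/
def deg : Idx X → ℕ := Sum.elim (fun x => x.1) (fun x => x.1.1 + x.2 + 1)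

/-- The singular simplices of a product are pairs of singular simplices. -/
def idxEquiv (Y : TopCat.{u}) : ((Σ n : ℕ, (TopCat.toSSet.obj (TopCat.of (X × Y))) _⦋n⦌) ⊕
      ((Σ p : ℕ, (TopCat.toSSet.obj X) _⦋p⦌) × (Σ q : ℕ, (TopCat.toSSet.obj Y) _⦋q⦌))) ≃
    (Σ i : Idx X, (TopCat.toSSet.obj Y) _⦋dim i⦌) where
  toFun
    | .inl ⟨n, ρ⟩ => ⟨.inl ⟨n, (TopCat.toSSet.map (topFst X Y)).app _ ρ⟩,
        (TopCat.toSSet.map (topSnd X Y)).app _ ρ⟩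
    | .inr ⟨x, ⟨q, τ⟩⟩ => ⟨.inr (x, q), τ⟩
  invFun
    | ⟨.inl ⟨n, σ⟩, τ⟩ => .inl ⟨n, pairSimplex σ τ⟩
    | ⟨.inr (x, q), τ⟩ => .inr ⟨x, ⟨q, τ⟩⟩
  left_inv := by rintro (⟨n, ρ⟩ | ⟨x, ⟨q, τ⟩⟩) <;> rfl
  right_inv := by rintro ⟨⟨n, σ⟩ | ⟨x, q⟩, τ⟩ <;> rfl

/-- The basis of the total complex given by the singular simplices. -/
def totBasis (Y : TopCat.{u}) :
    Module.Basis (Σ n : ℕ, (TopCat.toSSet.obj Y) _⦋n⦌) R (Tot (singChains R Y)) :=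
  DFinsupp.basis fun n => simplexBasis R Y n

lemma totBasis_apply (Y : TopCat.{u}) (n : ℕ) (τ : (TopCat.toSSet.obj Y) _⦋n⦌) :
    totBasis R Y ⟨n, τ⟩ = Tot.of n (simplexChain R τ 1) := by
  classical
  rw [Module.Basis.apply_eq_iff]
  ext ⟨m, τ'⟩
  change (simplexBasis R Y m).repr ((DFinsupp.single n (simplexChain R τ 1) : Π₀ n, (singChains R Y).X n) m) τ' = _
  by_cases h : n = m
  · subst h
    rw [DFinsupp.single_eq_same, ← simplexBasis_apply, Module.Basis.repr_self]
    simp [Finsupp.single_apply]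
  · rw [DFinsupp.single_eq_of_ne (Ne.symm h), map_zero, Finsupp.single_eq_of_ne]
    · rfl
    · simp only [ne_eq, Sigma.mk.injEq, not_and]
      intro h'
      exact absurd h'.symm h

/-- The natural basis. -/
def basis (Y : TopCat.{u}) :
    Module.Basis (Σ i : Idx X, (TopCat.toSSet.obj Y) _⦋dim i⦌) R (CrossCone R X Y) :=
  ((totBasis R _).prod ((totBasis R X).tensorProduct (totBasis R Y))).reindex (idxEquiv X Y)

lemma basis_inl (n : ℕ) (ρ : (TopCat.toSSet.obj (TopCat.of (X × Y))) _⦋n⦌) :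
    basis R X Y (idxEquiv X Y (.inl ⟨n, ρ⟩)) = (Tot.of n (simplexChain R ρ 1), 0) := by
  rw [basis, Module.Basis.reindex_apply, Equiv.symm_apply_apply]
  refine Prod.ext ?_ ?_
  · rw [Module.Basis.prod_apply_inl_fst, totBasis_apply]
  · rw [Module.Basis.prod_apply_inl_snd]

lemma basis_inr (p q : ℕ) (σ : (TopCat.toSSet.obj X) _⦋p⦌) (τ : (TopCat.toSSet.obj Y) _⦋q⦌) :
    basis R X Y (idxEquiv X Y (.inr (⟨p, σ⟩, ⟨q, τ⟩))) =
      (0, Tot.of p (simplexChain R σ 1) ⊗ₜ Tot.of q (simplexChain R τ 1)) := by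
  rw [basis, Module.Basis.reindex_apply, Equiv.symm_apply_apply]
  refine Prod.ext ?_ ?_
  · rw [Module.Basis.prod_apply_inr_fst]
  · rw [Module.Basis.prod_apply_inr_snd, Module.Basis.tensorProduct_apply, totBasis_apply,
      totBasis_apply]

lemma map_basis_inl (f : Y ⟶ Y') (n : ℕ) (ρ : (TopCat.toSSet.obj (TopCat.of (X × Y))) _⦋n⦌) :
    map R X f (basis R X Y (idxEquiv X Y (.inl ⟨n, ρ⟩))) = basis R X Y' (idxEquiv X Y'
      (.inl ⟨n, (TopCat.toSSet.map (topProdMap (𝟙 X) f)).app _ ρ⟩)) := by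
  rw [basis_inl, basis_inl, map, LinearMap.prodMap_apply, map_zero, Tot.map_of,
    singChainsMap_simplexChain]

lemma map_basis_inr (f : Y ⟶ Y') (p q : ℕ) (σ : (TopCat.toSSet.obj X) _⦋p⦌)
    (τ : (TopCat.toSSet.obj Y) _⦋q⦌) :
    map R X f (basis R X Y (idxEquiv X Y (.inr (⟨p, σ⟩, ⟨q, τ⟩)))) = basis R X Y' (idxEquiv X Y'
      (.inr (⟨p, σ⟩, ⟨q, (TopCat.toSSet.map f).app _ τ⟩))) := by
  rw [basis_inr, basis_inr, map, LinearMap.prodMap_apply, map_zero, LinearMap.lTensor_tmul,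
    Tot.map_of, singChainsMap_simplexChain]

lemma map_basis (f : Y ⟶ Y') (i : Idx X) (τ : (TopCat.toSSet.obj Y) _⦋dim i⦌) :
    map R X f (basis R X Y ⟨i, τ⟩) = basis R X Y' ⟨i, (TopCat.toSSet.map f).app _ τ⟩ :=
  match i, τ with
  | .inl ⟨n, σ⟩, τ => map_basis_inl R X f n (pairSimplex σ τ)
  | .inr (⟨p, σ⟩, q), τ => map_basis_inr R X f p q σ τ

lemma inl_mem_span {n N : ℕ} (h : n < N) (c : (singChains R (TopCat.of (X × Y))).X n) :
    ((Tot.of n c, 0) : CrossCone R X Y) ∈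
      Submodule.span R (basis R X Y '' {x | deg x.1 < N}) := by
  have : Submodule.comap (LinearMap.inl R _ _ ∘ₗ Tot.of n)
      (Submodule.span R (basis R X Y '' {x | deg x.1 < N})) = ⊤ := by
    rw [eq_top_iff, ← (simplexBasis R _ n).span_eq, Submodule.span_le]
    rintro _ ⟨ρ, rfl⟩
    rw [simplexBasis_apply]
    exact Submodule.subset_span ⟨_, h, basis_inl R X n ρ⟩
  exact (this.symm ▸ Submodule.mem_top : c ∈ Submodule.comap _ _)

lemma inr_mem_span {p q N : ℕ} (h : p + q + 1 < N) (a : (singChains R X).X p)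
    (b : (singChains R Y).X q) :
    ((0, Tot.of p a ⊗ₜ Tot.of q b) : CrossCone R X Y) ∈
      Submodule.span R (basis R X Y '' {x | deg x.1 < N}) := by
  have h1 : ∀ σ : (TopCat.toSSet.obj X) _⦋p⦌, Submodule.comap (LinearMap.inr R _ _ ∘ₗ
      TensorProduct.mk R _ _ (Tot.of p (simplexChain R σ 1)) ∘ₗ Tot.of q)
      (Submodule.span R (basis R X Y '' {x | deg x.1 < N})) = ⊤ := by
    intro σ
    rw [eq_top_iff, ← (simplexBasis R _ q).span_eq, Submodule.span_le]
    rintro _ ⟨τ, rfl⟩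
    rw [simplexBasis_apply]
    exact Submodule.subset_span ⟨_, h, basis_inr R X p q σ τ⟩
  have h2 : Submodule.comap (LinearMap.inr R _ _ ∘ₗ
      (TensorProduct.mk R _ _).flip (Tot.of q b) ∘ₗ Tot.of p)
      (Submodule.span R (basis R X Y '' {x | deg x.1 < N})) = ⊤ := by
    rw [eq_top_iff, ← (simplexBasis R _ p).span_eq, Submodule.span_le]
    rintro _ ⟨σ, rfl⟩
    rw [simplexBasis_apply]
    exact ((h1 σ).symm ▸ Submodule.mem_top : b ∈ Submodule.comap _ _)
  exact (h2.symm ▸ Submodule.mem_top : a ∈ Submodule.comap _ _)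

lemma d_basis_inl_mem (n : ℕ) (ρ : (TopCat.toSSet.obj (TopCat.of (X × Y))) _⦋n⦌) :
    d R X Y (basis R X Y (idxEquiv X Y (.inl ⟨n, ρ⟩))) ∈
      Submodule.span R (basis R X Y '' {x | deg x.1 < n}) := by
  rw [basis_inl, d_apply]
  simp only [map_zero, add_zero, neg_zero]
  rcases n with _ | n
  · rw [Tot.d_of_zero]
    exact Submodule.zero_mem _
  · rw [Tot.d_of_succ]
    exact inl_mem_span R X (Nat.lt_succ_self n) _

/-- The tensor `σ ⊗ τ` is counted in degree `p + q + 1`, the shift of a mapping cone. So its cross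
product, in degree `p + q`, is strictly lower, as acyclic models require. -/
lemma d_basis_inr_mem (p q : ℕ) (σ : (TopCat.toSSet.obj X) _⦋p⦌) (τ : (TopCat.toSSet.obj Y) _⦋q⦌) :
    d R X Y (basis R X Y (idxEquiv X Y (.inr (⟨p, σ⟩, ⟨q, τ⟩)))) ∈
      Submodule.span R (basis R X Y '' {x | deg x.1 < p + q + 1}) := by
  rw [basis_inr, d_apply]
  simp only [map_zero, zero_add, tensorD_tmul, neg_add]
  have h1 : ∀ (a b : Tot (singChains R X) ⊗[R] Tot (singChains R Y)) c,
      ((c, a + b) : CrossCone R X Y) = (c, 0) + ((0, a) + (0, b)) := by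
    intro a b c
    simp
  rw [h1, crossTot, TensorProduct.lift.tmul, crossTot₂_of R rfl]
  refine Submodule.add_mem _ (inl_mem_span R X (Nat.lt_succ_self _) _)
    (Submodule.add_mem _ ?_ ?_)
  · rcases p with _ | p
    · rw [Tot.d_of_zero, TensorProduct.zero_tmul, neg_zero]
      exact Submodule.zero_mem _
    · rw [Tot.d_of_succ, ← TensorProduct.neg_tmul, ← map_neg]
      exact inr_mem_span R X (by omega) _ _
  · rcases q with _ | q
    · rw [Tot.d_of_zero, TensorProduct.tmul_zero, neg_zero]
      exact Submodule.zero_mem _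
    · rw [Tot.d_of_succ, Tot.sign_of, ← map_zsmul, ← TensorProduct.neg_tmul, ← map_neg]
      exact inr_mem_span R X (by omega) _ _

lemma d_basis_mem (i : Idx X) : d R X _ (basis R X _ ⟨i, idSimplex _⟩) ∈
    Submodule.span R (basis R X (topSimplex (dim i)) '' {x | deg x.1 < deg i}) :=
  match i with
  | .inl ⟨n, σ⟩ => d_basis_inl_mem R X n (pairSimplex σ (idSimplex n))
  | .inr (⟨p, σ⟩, q) => d_basis_inr_mem R X p q σ (idSimplex q)

/-- For contractible `Y` the chains of `X × Y` and the tensor product both deform onto the chains of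
`X`, embedded by `j` and `J`, and the cross product identifies the two copies (`hEJ`). Correcting a
cycle of the cone by the two deformations gives an explicit primitive. -/
lemma exact_of_contractible [ContractibleSpace Y] (x : CrossCone R X Y) (hx : d R X Y x = 0) :
    ∃ y, d R X Y y = x := by
  obtain ⟨c, t⟩ := x
  obtain ⟨y, h, hh⟩ := exists_contraction R (Y := Y)
  obtain ⟨h₂, hh₂⟩ := exists_slice_contraction R X y
  set j := Tot.map (singChainsMap R (sliceMap X y)) with hj
  set π := Tot.map (singChainsMap R (topFst X Y)) with hπ
  have hπj : ∀ a, π (j a) = a := fun a => by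
    rw [hj, hπ, ← Tot.map_comp, ← Functor.map_comp]
    refine (congrArg (fun f => Tot.map (singChainsMap R f) a) (?_ : _ = 𝟙 X)).trans ?_
    · rfl
    · simp only [CategoryTheory.Functor.map_id, Tot.map_id]
  have hcd : Tot.d _ c + crossTot R t = 0 := congrArg Prod.fst hx
  have htd : tensorD _ _ t = 0 := neg_eq_zero.1 (congrArg Prod.snd hx)
  let J : Tot (singChains R X) →ₗ[R] Tot (singChains R X) ⊗[R] Tot (singChains R Y) :=
    (TensorProduct.mk R _ _).flip (Tot.of 0 (simplexChain R (constSimplex y 0) 1))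
  let A : Tot (singChains R X) ⊗[R] Tot (singChains R Y) →ₗ[R] Tot (singChains R X) :=
    (TensorProduct.rid R _).toLinearMap ∘ₗ (totAug R Y).lTensor _
  have hAJ : ∀ a, A (J a) = a := fun a => by simp [A, J, totAug_of_zero]
  have hJd : ∀ a, tensorD _ _ (J a) = J (Tot.d _ a) := fun a => by simp [J]
  have hEJ : ∀ a, crossTot R (J a) = j a := fun a => by
    simp [J, crossTot, crossTot₂_constSimplex, hj]
  -- The sign on the first factor makes the mixed terms `d a ⊗ h b` cancel, because sign and
  -- differential anticommute.
  let H := TensorProduct.map (Tot.sign (singChains R X)) h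
  have hH : ∀ t, tensorD _ _ (H t) + H (tensorD _ _ t) = t - J (A t) := by
    intro t
    have : tensorD _ _ ∘ₗ H + H ∘ₗ tensorD _ _ = LinearMap.id - J ∘ₗ A := by
      refine TensorProduct.ext' fun a b => ?_
      have e := eq_sub_of_add_eq (hh b)
      simp only [LinearMap.add_apply, LinearMap.comp_apply, tensorD_tmul, map_add,
        TensorProduct.map_tmul, LinearMap.sub_apply, LinearMap.id_apply, H, A, J,
        LinearMap.lTensor_tmul, Tot.sign_sign, Tot.d_sign, LinearMap.flip_apply,
        TensorProduct.mk_apply, LinearEquiv.coe_coe, TensorProduct.rid_tmul]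
      rw [e, TensorProduct.tmul_sub, TensorProduct.tmul_sub, TensorProduct.neg_tmul,
        TensorProduct.smul_tmul]
      abel
    exact LinearMap.congr_fun this t
  have e1 : t = J (A t) + tensorD _ _ (H t) := by
    have := hH t
    rw [htd, map_zero, add_zero] at this
    rw [this]; abel
  set a := A t with ha
  have hda : Tot.d _ a = 0 := by
    have h1 := congrArg (tensorD _ _) e1
    rw [htd, map_add, tensorD_tensorD, add_zero, hJd] at h1
    rw [← hAJ (Tot.d _ a), ← h1, map_zero]
  -- This is the first component after the boundary of `(0, H t)` is added to `(c, t)`; the second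
  -- component has become `J a`.
  set c₁ := c + crossTot R (H t) with hc₁
  have hc₁d : Tot.d _ c₁ = - j a := by
    rw [hc₁, map_add, d_crossTot, ← hEJ, eq_neg_iff_add_eq_zero, add_assoc, ← map_add,
      add_comm _ (J a), ← e1, hcd]
  -- Subtracting the boundary of `(0, J (π c₁))` kills the second component and leaves a cycle with
  -- zero projection to `X`, which the slice contraction `h₂` bounds.
  set c₂ := c₁ - j (π c₁) with hc₂
  have hc₂d : Tot.d _ c₂ = 0 := by
    rw [hc₂, map_sub, hj, Tot.d_map, hπ, Tot.d_map, ← hj, ← hπ, hc₁d, map_neg, hπj, map_neg]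
    abel
  have hc₂π : π c₂ = 0 := by rw [hc₂, map_sub, hπj, sub_self]
  have e2 := hh₂ c₂
  rw [hc₂d, map_zero, add_zero] at e2
  change _ = c₂ - j (π c₂) at e2
  rw [hc₂π, map_zero, sub_zero] at e2
  have hda' : Tot.d _ (π c₁) = - a := by
    rw [hπ, Tot.d_map, ← hπ, hc₁d, map_neg, hπj]
  refine ⟨(h₂ c₂, J (π c₁) - H t), ?_⟩
  rw [d_apply]
  refine Prod.ext ?_ ?_
  · change Tot.d _ (h₂ c₂) + crossTot R (J (π c₁) - H t) = c
    rw [e2, map_sub, hEJ, hc₂, hc₁]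
    abel
  · change - tensorD _ _ (J (π c₁) - H t) = t
    rw [map_sub, hJd, hda', map_neg]
    conv_rhs => rw [e1]
    abel

instance (q : ℕ) : ContractibleSpace (topSimplex.{u} q) := by
  have : ContractibleSpace (stdSimplex ℝ (Fin (q + 1))) :=
    (convex_stdSimplex ℝ (Fin (q + 1))).contractibleSpace ⟨_, single_mem_stdSimplex ℝ 0⟩
  exact (Homeomorph.ulift (X := stdSimplex ℝ (Fin (q + 1)))).contractibleSpace

/-- The mapping cone of the cross product is exact. -/
theorem exact (x : CrossCone R X Y) (hx : d R X Y x = 0) : ∃ y, d R X Y y = x :=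
  -- Only `Y` varies: the simplices of the fixed `X` are part of the index set, so models in one
  -- variable suffice and `X` need not be contractible.
  exact_of_exact_topSimplex (R := R) dim deg (basis R X) (map R X) (map_basis R X) (d R X)
    (fun _ x => d_d R X x) (d_map R X) (d_basis_mem R X)
    (fun _ x hx => exact_of_contractible R X x hx) Y x hx

end CrossCone

variable {X}

/-- The Eilenberg-Zilber theorem, surjectivity. -/
theorem exists_crossTot_add_d (c : Tot (singChains R (TopCat.of (X × Y)))) (hc : Tot.d _ c = 0) :
    ∃ t e, tensorD (singChains R X) (singChains R Y) t = 0 ∧ c = crossTot R t + Tot.d _ e := by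
  obtain ⟨⟨e, t⟩, h⟩ := CrossCone.exact R X (Y := Y) (c, 0) (by
    rw [CrossCone.d_apply]
    simp [hc])
  rw [CrossCone.d_apply, Prod.mk.injEq] at h
  exact ⟨t, e, neg_eq_zero.1 h.2, by rw [← h.1, add_comm]⟩

/-- The Eilenberg-Zilber theorem, injectivity. -/
theorem exists_tensorD_eq (t : Tot (singChains R X) ⊗[R] Tot (singChains R Y))
    (ht : tensorD _ _ t = 0) (e : Tot (singChains R (TopCat.of (X × Y))))
    (he : crossTot R t = Tot.d _ e) : ∃ t', tensorD _ _ t' = t := by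
  obtain ⟨⟨e', t'⟩, h⟩ := CrossCone.exact R X (Y := Y) (-e, t) (by
    rw [CrossCone.d_apply]
    simp [he, ht])
  rw [CrossCone.d_apply, Prod.mk.injEq] at h
  exact ⟨-t', by rw [map_neg, h.2]⟩

end EilenbergZilber


/-! ### Tor and presentations; the algebraic Künneth theorem. -/

section Algebra

open scoped TensorProduct

section Schanuel

variable {R : Type*} [CommRing R] {M P₂ P₁ P₀ H Z : Type*} [AddCommGroup M] [Module R M]
  [AddCommGroup P₂] [Module R P₂] [AddCommGroup P₁] [Module R P₁] [AddCommGroup P₀] [Module R P₀]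
  [AddCommGroup H] [Module R H] [AddCommGroup Z] [Module R Z]

/-- If the first terms of a projective resolution of `H` stay exact after tensoring with `M`, then
so does every presentation of `H` on the left. -/
lemma lTensor_ker_subtype_injective [Module.Projective R P₀] (d₂ : P₂ →ₗ[R] P₁) (d₁ : P₁ →ₗ[R] P₀)
    (p : P₀ →ₗ[R] H) (hd : d₁ ∘ₗ d₂ = 0) (hex : Function.Exact d₁ p) (hp : Function.Surjective p)
    (hM : Function.Exact (d₂.lTensor M) (d₁.lTensor M)) (π : Z →ₗ[R] H)
    (hπ : Function.Surjective π) :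
    Function.Injective ((LinearMap.ker π).subtype.lTensor M) := by
  obtain ⟨φ, hφ⟩ := Module.projective_lifting_property π p hπ
  have hφ' : ∀ x, π (φ x) = p x := LinearMap.congr_fun hφ
  let ψ : P₁ →ₗ[R] LinearMap.ker π := (φ ∘ₗ d₁).codRestrict _ fun x => by
    rw [LinearMap.mem_ker, LinearMap.comp_apply, hφ', hex.apply_apply_eq_zero]
  have hψ : ψ ∘ₗ d₂ = 0 := by
    ext x
    have := LinearMap.congr_fun hd x
    rw [LinearMap.comp_apply, LinearMap.zero_apply] at this
    simp [ψ, this]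
  -- As in Schanuel's lemma, `P₁ → P₀ × ker π → Z → 0` is exact. Right exactness of the tensor
  -- product keeps it so.
  let α : P₁ →ₗ[R] P₀ × LinearMap.ker π := d₁.prod (-ψ)
  let β : P₀ × LinearMap.ker π →ₗ[R] Z := φ.coprod (LinearMap.ker π).subtype
  have hαβ : Function.Exact α β := by
    rintro ⟨x, b⟩
    constructor
    · intro h
      have h : φ x + b = 0 := h
      have hx : p x = 0 := by
        rw [← hφ', eq_neg_of_add_eq_zero_left h, map_neg, b.2, neg_zero]
      obtain ⟨y, rfl⟩ := (hex x).1 hx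
      refine ⟨y, Prod.ext rfl (Subtype.ext ?_)⟩
      exact (eq_neg_of_add_eq_zero_right h).symm
    · rintro ⟨y, hy⟩
      rw [← hy]
      change φ (d₁ y) + ((-ψ y : LinearMap.ker π) : Z) = 0
      simp [ψ]
  have hβ : Function.Surjective β := by
    intro z
    obtain ⟨x, hx⟩ := hp (π z)
    refine ⟨(x, ⟨z - φ x, by rw [LinearMap.mem_ker, map_sub, hφ', hx, sub_self]⟩), ?_⟩
    simp [β]
  have hex' := lTensor_exact M hαβ hβ
  rw [injective_iff_map_eq_zero]
  intro x hx
  have h1 : β.lTensor M ((LinearMap.inr R P₀ _).lTensor M x) = 0 := by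
    rw [← LinearMap.comp_apply, ← LinearMap.lTensor_comp, ← hx]
    congr 2
    ext y
    simp [β]
  -- The element `(0, x)` is the image of `w`. Its first component shows that `d₁` kills `w`, so `w`
  -- comes from `P₂`; there `ψ` is zero, and the second component gives `x = 0`.
  obtain ⟨w, hw⟩ := (hex' _).1 h1
  have h2 : d₁.lTensor M w = 0 := by
    have := congrArg ((LinearMap.fst R P₀ _).lTensor M) hw
    rw [← LinearMap.comp_apply, ← LinearMap.comp_apply, ← LinearMap.lTensor_comp,
      ← LinearMap.lTensor_comp, LinearMap.fst_comp_inr, LinearMap.lTensor_zero] at this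
    exact this
  obtain ⟨v, rfl⟩ := (hM _).1 h2
  have := congrArg ((LinearMap.snd R P₀ _).lTensor M) hw
  rw [← LinearMap.comp_apply, ← LinearMap.comp_apply, ← LinearMap.comp_apply,
    ← LinearMap.lTensor_comp, ← LinearMap.lTensor_comp, ← LinearMap.lTensor_comp,
    LinearMap.snd_comp_inr, LinearMap.lTensor_id, LinearMap.id_apply] at this
  rw [← this]
  have h3 : LinearMap.snd R P₀ _ ∘ₗ α ∘ₗ d₂ = 0 := by
    change (-ψ) ∘ₗ d₂ = 0
    rw [LinearMap.neg_comp, hψ, neg_zero]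
  rw [← LinearMap.comp_assoc] at h3
  rw [h3, LinearMap.lTensor_zero, LinearMap.zero_apply]

end Schanuel

/-- Vanishing of Tor is exactness of `M ⊗ P` in degree `1` for a projective resolution `P` of `H`.
Nothing is required of `Z`, which will be the module of cycles in one degree. -/
lemma lTensor_ker_subtype_injective_of_isZero_Tor {R : Type u} [CommRing R] (M H : ModuleCat.{u} R)
    (h : Limits.IsZero (((Tor (ModuleCat.{u} R) 1).obj M).obj H)) {Z : Type u} [AddCommGroup Z]
    [Module R Z] (π : Z →ₗ[R] H) (hπ : Function.Surjective π) :
    Function.Injective ((LinearMap.ker π).subtype.lTensor M) := by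
  let P := projectiveResolution H
  let F := (MonoidalCategory.tensoringLeft (ModuleCat.{u} R)).obj M
  have h1 : Limits.IsZero (((F.mapHomologicalComplex _).obj P.complex).homology 1) :=
    h.of_iso (P.isoLeftDerivedObj F 1).symm
  rw [← HomologicalComplex.exactAt_iff_isZero_homology,
    HomologicalComplex.exactAt_iff' _ 2 1 0 (by simp) (by simp),
    ShortComplex.ShortExact.moduleCat_exact_iff_function_exact] at h1
  have hproj : Module.Projective R (P.complex.X 0) :=
    (IsProjective.iff_projective _).2 (P.projective 0)
  refine lTensor_ker_subtype_injective (P.complex.d 2 1).hom (P.complex.d 1 0).hom (P.π.f 0).hom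
    ?_ ?_ ?_ h1 π hπ
  · rw [← ModuleCat.hom_comp, P.complex.d_comp_d]
    rfl
  · exact (ShortComplex.ShortExact.moduleCat_exact_iff_function_exact _).1 P.exact₀
  · exact (ModuleCat.epi_iff_surjective _).1 inferInstance

section Kunneth

variable {R : Type*} [CommRing R] {C D H : Type*} [AddCommGroup C] [Module R C]
  [AddCommGroup D] [Module R D] [AddCommGroup H] [Module R H]
  (dC sC : C →ₗ[R] C) (dD : D →ₗ[R] D)

/-- The differential with values in the cycles. -/
def boundary (h : ∀ c, dC (dC c) = 0) : C →ₗ[R] LinearMap.ker dC := dC.codRestrict _ h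

lemma range_le_ker (h : ∀ c, dC (dC c) = 0) : LinearMap.range dC ≤ LinearMap.ker dC := by
  rintro _ ⟨c, rfl⟩
  exact h c

variable {dC sC dD}

lemma exact_rangeRestrict : Function.Exact (LinearMap.ker dD).subtype dD.rangeRestrict := by
  intro x
  rw [← Subtype.coe_inj]
  exact ⟨fun h => ⟨⟨x, h⟩, rfl⟩, by rintro ⟨y, rfl⟩; exact y.2⟩

lemma exact_ker_subtype : Function.Exact (LinearMap.ker dC).subtype dC :=
  fun x => ⟨fun h => ⟨⟨x, h⟩, rfl⟩, by rintro ⟨y, rfl⟩; exact y.2⟩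

/-- In a complex of flat modules, `A ⊗ Z → A ⊗ D` is injective for the module `Z` of cycles. -/
lemma lTensor_cycles_injective [Module.Flat R (LinearMap.range dD)] (A : Type*) [AddCommGroup A]
    [Module R A] : Function.Injective ((LinearMap.ker dD).subtype.lTensor A) :=
  LinearMap.lTensor_injective_of_exact_of_flat dD.rangeRestrict dD.surjective_rangeRestrict _
    (Submodule.subtype_injective _) exact_rangeRestrict A

lemma exists_of_rTensor_eq_zero {N : Type*} [AddCommGroup N] [Module R N] [Module.Flat R N]
    (v : C ⊗[R] N) (hv : dC.rTensor N v = 0) :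
    ∃ w, (LinearMap.ker dC).subtype.rTensor N w = v :=
  (Module.Flat.rTensor_exact N exact_ker_subtype v).1 hv

lemma tensor_hom_congr {M N P : Type*} [AddCommGroup M] [Module R M] [AddCommGroup N]
    [Module R N] [AddCommGroup P] [Module R P] {f g : M ⊗[R] N →ₗ[R] P}
    (h : ∀ m n, f (m ⊗ₜ n) = g (m ⊗ₜ n)) (x) : f x = g x :=
  LinearMap.congr_fun (TensorProduct.ext' h) x

/-- Let `Z` and `B` be the cycles and boundaries of `D`. The image of `t` in `C ⊗ B` has cycles as
first factors, and its class in `H ⊗ B` dies in `H ⊗ Z`, since there it is a boundary in the first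
factor. The hypothesis `hTor`, which is the vanishing of Tor for `H` and `Z / B`, makes the class
itself zero. A boundary then removes this image from `t`, and flatness leaves a tensor of cycles. -/
lemma kunneth_surjective [Module.Flat R C] [Module.Flat R D] [Module.Flat R (LinearMap.ker dD)]
    [Module.Flat R (LinearMap.range dD)] (hC : ∀ c, dC (dC c) = 0) (hD : ∀ c, dD (dD c) = 0)
    (hss : ∀ c, sC (sC c) = c) (hds : ∀ c, dC (sC c) = - sC (dC c))
    (π : LinearMap.ker dC →ₗ[R] H) (hπ : Function.Surjective π)
    (hπ' : Function.Exact (boundary dC hC) π)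
    (hTor : Function.Injective ((Submodule.inclusion (range_le_ker dD hD)).lTensor H))
    (t : C ⊗[R] D) (ht : dC.rTensor D t + TensorProduct.map sC dD t = 0) :
    ∃ (w : LinearMap.ker dC ⊗[R] LinearMap.ker dD) (u : C ⊗[R] D),
      t = TensorProduct.map (LinearMap.ker dC).subtype (LinearMap.ker dD).subtype w +
        (dC.rTensor D u + TensorProduct.map sC dD u) := by
  let B := LinearMap.range dD
  let δ : D →ₗ[R] B := dD.rangeRestrict
  let iB : B →ₗ[R] D := B.subtype
  let jB : B →ₗ[R] LinearMap.ker dD := Submodule.inclusion (range_le_ker dD hD)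
  let iZ := (LinearMap.ker dD).subtype
  let iC := (LinearMap.ker dC).subtype
  set v := δ.lTensor C t with hv
  have hv1 : dC.rTensor B v = 0 := by
    have hinj : Function.Injective (iB.lTensor C) :=
      Module.Flat.lTensor_preserves_injective_linearMap _ (Submodule.subtype_injective _)
    apply hinj
    rw [map_zero]
    have e1 : iB.lTensor C (dC.rTensor B v) = dD.lTensor C (dC.rTensor D t) :=
      tensor_hom_congr (f := iB.lTensor C ∘ₗ dC.rTensor B ∘ₗ δ.lTensor C) (g := dD.lTensor C ∘ₗ dC.rTensor D)
        (fun m n => rfl) t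
    have e2 : dD.lTensor C (TensorProduct.map sC dD t) = 0 :=
      tensor_hom_congr (f := dD.lTensor C ∘ₗ TensorProduct.map sC dD) (g := 0) (fun m n => by simp [hD]) t
    rw [e1, eq_neg_of_add_eq_zero_left ht, map_neg, e2, neg_zero]
  obtain ⟨v₀, hv₀⟩ := exists_of_rTensor_eq_zero v hv1
  have hv2 : π.rTensor B v₀ = 0 := by
    apply hTor
    apply lTensor_cycles_injective (dD := dD)
    rw [map_zero, map_zero]
    have hinj : Function.Injective (iC.rTensor D) :=
      Module.Flat.rTensor_preserves_injective_linearMap _ (Submodule.subtype_injective _)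
    -- This is the cycle equation of `t`, solved for the term with `dD` and freed from the sign by
    -- the involution.
    have e1 : iB.lTensor _ v₀ = (boundary dC hC).rTensor D (sC.rTensor D t) := by
      apply hinj
      have e2 : iC.rTensor D (iB.lTensor _ v₀) = iB.lTensor C (iC.rTensor B v₀) :=
        tensor_hom_congr (f := iC.rTensor D ∘ₗ iB.lTensor _) (g := iB.lTensor C ∘ₗ iC.rTensor B)
          (fun m n => rfl) v₀
      have e3 : iB.lTensor C v = sC.rTensor D (TensorProduct.map sC dD t) :=
        tensor_hom_congr (f := iB.lTensor C ∘ₗ δ.lTensor C) (g := sC.rTensor D ∘ₗ TensorProduct.map sC dD)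
          (fun m n => by simp [hss, iB, δ]) t
      have e4 : sC.rTensor D (dC.rTensor D t) =
          - iC.rTensor D ((boundary dC hC).rTensor D (sC.rTensor D t)) :=
        tensor_hom_congr (f := sC.rTensor D ∘ₗ dC.rTensor D)
          (g := - (iC.rTensor D ∘ₗ (boundary dC hC).rTensor D ∘ₗ sC.rTensor D))
          (fun m n => by
            change sC (dC m) ⊗ₜ n = - (dC (sC m) ⊗ₜ n)
            rw [hds, TensorProduct.neg_tmul, neg_neg]) t
      rw [e2]
      refine (congrArg _ hv₀).trans ?_
      rw [e3, eq_neg_of_add_eq_zero_right ht, map_neg, e4, neg_neg]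
    have e5 : iZ.lTensor H (jB.lTensor H (π.rTensor B v₀)) = π.rTensor D (iB.lTensor _ v₀) :=
      tensor_hom_congr (f := iZ.lTensor H ∘ₗ jB.lTensor H ∘ₗ π.rTensor B) (g := π.rTensor D ∘ₗ iB.lTensor _)
        (fun m n => rfl) v₀
    refine e5.trans ?_
    rw [e1, ← LinearMap.comp_apply, ← LinearMap.rTensor_comp, hπ'.linearMap_comp_eq_zero,
      LinearMap.rTensor_zero, LinearMap.zero_apply]
  obtain ⟨v', hv'⟩ := (rTensor_exact B hπ' hπ v₀).1 hv2
  -- Lifting `v'` to `C ⊗ D` gives an element whose boundary has the same image in `C ⊗ B` as `t`.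
  obtain ⟨u, rfl⟩ := LinearMap.lTensor_surjective C dD.surjective_rangeRestrict v'
  set t₁ := t - (dC.rTensor D u + TensorProduct.map sC dD u) with ht₁
  have h1 : δ.lTensor C t₁ = 0 := by
    have e1 : δ.lTensor C (dC.rTensor D u) =
        iC.rTensor B ((boundary dC hC).rTensor B (δ.lTensor C u)) :=
      tensor_hom_congr (f := δ.lTensor C ∘ₗ dC.rTensor D)
        (g := iC.rTensor B ∘ₗ (boundary dC hC).rTensor B ∘ₗ δ.lTensor C) (fun m n => rfl) u
    have e2 : δ.lTensor C (TensorProduct.map sC dD u) = 0 :=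
      tensor_hom_congr (f := δ.lTensor C ∘ₗ TensorProduct.map sC dD) (g := 0) (fun m n => by
        have : δ (dD n) = 0 := Subtype.ext (hD n)
        simp [this]) u
    rw [ht₁, map_sub, map_add, e1, e2, add_zero, ← hv, sub_eq_zero]
    refine hv₀.symm.trans ?_
    rw [← hv']
  have h2 : dC.rTensor D t₁ = 0 := by
    have e1 : dC.rTensor D t₁ + TensorProduct.map sC dD t₁ = 0 := by
      have e2 : dC.rTensor D (dC.rTensor D u) = 0 :=
        tensor_hom_congr (f := dC.rTensor D ∘ₗ dC.rTensor D) (g := 0) (fun m n => by simp [hC]) u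
      have e3 : TensorProduct.map sC dD (TensorProduct.map sC dD u) = 0 :=
        tensor_hom_congr (f := TensorProduct.map sC dD ∘ₗ TensorProduct.map sC dD) (g := 0)
          (fun m n => by simp [hD]) u
      have e4 : dC.rTensor D (TensorProduct.map sC dD u) =
          - TensorProduct.map sC dD (dC.rTensor D u) :=
        tensor_hom_congr (f := dC.rTensor D ∘ₗ TensorProduct.map sC dD)
          (g := - (TensorProduct.map sC dD ∘ₗ dC.rTensor D))
          (fun m n => by simp [hds, TensorProduct.neg_tmul]) u
      rw [ht₁, map_sub, map_sub, map_add, map_add, e2, e3, e4, sub_add_sub_comm, ht]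
      abel
    have e2 : TensorProduct.map sC dD t₁ = TensorProduct.map sC iB (δ.lTensor C t₁) :=
      tensor_hom_congr (f := TensorProduct.map sC dD) (g := TensorProduct.map sC iB ∘ₗ δ.lTensor C)
        (fun m n => rfl) t₁
    rwa [e2, h1, map_zero, add_zero] at e1
  obtain ⟨t₂, ht₂⟩ := (Module.Flat.lTensor_exact C (exact_rangeRestrict (dD := dD)) t₁).1 h1
  have h3 : dC.rTensor _ t₂ = 0 := by
    apply lTensor_cycles_injective (dD := dD) C
    rw [map_zero, ← h2, ← ht₂]
    exact tensor_hom_congr (f := iZ.lTensor C ∘ₗ dC.rTensor _) (g := dC.rTensor D ∘ₗ iZ.lTensor C)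
      (fun m n => rfl) t₂
  obtain ⟨w, rfl⟩ := exists_of_rTensor_eq_zero t₂ h3
  refine ⟨w, u, ?_⟩
  have e : TensorProduct.map iC iZ w = t₁ := by
    rw [← ht₂]
    exact tensor_hom_congr (f := TensorProduct.map iC iZ) (g := iZ.lTensor C ∘ₗ iC.rTensor _)
      (fun m n => rfl) w
  exact (sub_eq_iff_eq_add.1 e.symm)

/-- With `Z` and `B` the cycles and boundaries of `D`, the image of `u` in `C ⊗ B` has cycles as
first factors and yields, up to sign, the element `b`. What remains of `w` becomes a boundary in the
first factor over `D`, so its class in `H ⊗ D` is zero; by flatness of `D / Z ≅ B` the class in `H ⊗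
Z` is already zero. -/
lemma kunneth_injective [Module.Flat R D] [Module.Flat R (LinearMap.ker dD)] [Module.Flat R C]
    [Module.Flat R (LinearMap.range dD)] (hC : ∀ c, dC (dC c) = 0) (hD : ∀ c, dD (dD c) = 0)
    (hds : ∀ c, dC (sC c) = - sC (dC c))
    (π : LinearMap.ker dC →ₗ[R] H) (hπ : Function.Surjective π)
    (hπ' : Function.Exact (boundary dC hC) π)
    (w : LinearMap.ker dC ⊗[R] LinearMap.ker dD) (u : C ⊗[R] D)
    (h : TensorProduct.map (LinearMap.ker dC).subtype (LinearMap.ker dD).subtype w =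
        dC.rTensor D u + TensorProduct.map sC dD u) :
    ∃ (a : C ⊗[R] LinearMap.ker dD) (b : LinearMap.ker dC ⊗[R] LinearMap.range dD),
      w = (boundary dC hC).rTensor _ a +
        (Submodule.inclusion (range_le_ker dD hD)).lTensor _ b := by
  let B := LinearMap.range dD
  let δ : D →ₗ[R] B := dD.rangeRestrict
  let iB : B →ₗ[R] D := B.subtype
  let jB : B →ₗ[R] LinearMap.ker dD := Submodule.inclusion (range_le_ker dD hD)
  let iZ := (LinearMap.ker dD).subtype
  let iC := (LinearMap.ker dC).subtype
  let sZ : LinearMap.ker dC →ₗ[R] LinearMap.ker dC := sC.restrict fun x hx => by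
    rw [LinearMap.mem_ker] at *
    rw [hds, hx, map_zero, neg_zero]
  have hv1 : dC.rTensor B (δ.lTensor C u) = 0 := by
    have e1 : δ.lTensor C (TensorProduct.map iC iZ w) = 0 :=
      tensor_hom_congr (f := δ.lTensor C ∘ₗ TensorProduct.map iC iZ) (g := 0) (fun m n => by
        have : δ (iZ n) = 0 := Subtype.ext n.2
        simp [this]) w
    have e2 : δ.lTensor C (TensorProduct.map sC dD u) = 0 :=
      tensor_hom_congr (f := δ.lTensor C ∘ₗ TensorProduct.map sC dD) (g := 0) (fun m n => by
        have : δ (dD n) = 0 := Subtype.ext (hD n)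
        simp [this]) u
    have e3 : dC.rTensor B (δ.lTensor C u) = δ.lTensor C (dC.rTensor D u) :=
      tensor_hom_congr (f := dC.rTensor B ∘ₗ δ.lTensor C) (g := δ.lTensor C ∘ₗ dC.rTensor D)
        (fun m n => rfl) u
    have e4 := congrArg (δ.lTensor C) h
    rw [map_add, e2, add_zero] at e4
    exact e3.trans (e4.symm.trans e1)
  obtain ⟨v₀, hv₀⟩ := exists_of_rTensor_eq_zero _ hv1
  let b := sZ.rTensor B v₀
  have h1 : iZ.lTensor _ (w - jB.lTensor _ b) = (boundary dC hC).rTensor D u := by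
    have hinj : Function.Injective (iC.rTensor D) :=
      Module.Flat.rTensor_preserves_injective_linearMap _ (Submodule.subtype_injective _)
    apply hinj
    have e1 : iC.rTensor D (iZ.lTensor _ w) = TensorProduct.map iC iZ w :=
      tensor_hom_congr (f := iC.rTensor D ∘ₗ iZ.lTensor _) (g := TensorProduct.map iC iZ) (fun m n => rfl) w
    have e2 : iC.rTensor D (iZ.lTensor _ (jB.lTensor _ (sZ.rTensor B v₀))) =
        TensorProduct.map sC iB (iC.rTensor B v₀) :=
      tensor_hom_congr (f := iC.rTensor D ∘ₗ iZ.lTensor _ ∘ₗ jB.lTensor _ ∘ₗ sZ.rTensor B)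
        (g := TensorProduct.map sC iB ∘ₗ iC.rTensor B) (fun m n => rfl) v₀
    have e3 : TensorProduct.map sC iB (δ.lTensor C u) = TensorProduct.map sC dD u :=
      tensor_hom_congr (f := TensorProduct.map sC iB ∘ₗ δ.lTensor C) (g := TensorProduct.map sC dD)
        (fun m n => rfl) u
    have e4 : iC.rTensor D ((boundary dC hC).rTensor D u) = dC.rTensor D u :=
      tensor_hom_congr (f := iC.rTensor D ∘ₗ (boundary dC hC).rTensor D) (g := dC.rTensor D)
        (fun m n => rfl) u
    have e5 : TensorProduct.map sC iB (iC.rTensor B v₀) = TensorProduct.map sC dD u :=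
      (congrArg _ hv₀).trans e3
    rw [map_sub, map_sub, e1, e2, e5, e4]
    exact (congrArg (· - _) h).trans (add_sub_cancel_right _ _)
  have h2 : π.rTensor _ (w - jB.lTensor _ b) = 0 := by
    apply lTensor_cycles_injective (dD := dD)
    rw [map_zero]
    have e1 : iZ.lTensor H (π.rTensor _ (w - jB.lTensor _ b)) =
        π.rTensor D (iZ.lTensor _ (w - jB.lTensor _ b)) :=
      tensor_hom_congr (f := iZ.lTensor H ∘ₗ π.rTensor _) (g := π.rTensor D ∘ₗ iZ.lTensor _)
        (fun m n => rfl) _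
    refine e1.trans ?_
    rw [h1, ← LinearMap.comp_apply, ← LinearMap.rTensor_comp, hπ'.linearMap_comp_eq_zero,
      LinearMap.rTensor_zero, LinearMap.zero_apply]
  obtain ⟨a, ha⟩ := (rTensor_exact _ hπ' hπ _).1 h2
  exact ⟨a, b, sub_eq_iff_eq_add.1 ha.symm⟩

end Kunneth

end Algebra


/-! ### Tensors are detected by their components. -/

section JointInjectivity

open scoped TensorProduct

variable {R : Type*} [CommRing R] {M N : Type*} [AddCommGroup M] [Module R M] [AddCommGroup N]
  [Module R N] {M' N' : ℕ → Type*} [∀ i, AddCommGroup (M' i)] [∀ i, Module R (M' i)]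
  [∀ i, AddCommGroup (N' i)] [∀ i, Module R (N' i)]

/-- An element of a tensor product of locally finite direct sums is determined by its components. -/
lemma tensor_eq_zero_of_components (p : ∀ i, M →ₗ[R] M' i) (s : ∀ i, M' i →ₗ[R] M)
    (q : ∀ i, N →ₗ[R] N' i) (t : ∀ i, N' i →ₗ[R] N)
    (hs : ∀ m, ∃ k, ∀ n ≥ k, ∑ i ∈ Finset.range n, s i (p i m) = m)
    (ht : ∀ m, ∃ k, ∀ n ≥ k, ∑ i ∈ Finset.range n, t i (q i m) = m) (x : M ⊗[R] N)
    (hx : ∀ i j, TensorProduct.map (p i) (q j) x = 0) : x = 0 := by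
  have key : ∀ x : M ⊗[R] N, ∃ k, ∀ n ≥ k, ∑ i ∈ Finset.range n, ∑ j ∈ Finset.range n,
      TensorProduct.map (s i) (t j) (TensorProduct.map (p i) (q j) x) = x := by
    intro x
    induction x using TensorProduct.induction_on with
    | zero => exact ⟨0, fun n _ => by simp⟩
    | tmul a b =>
      obtain ⟨k, hk⟩ := hs a
      obtain ⟨l, hl⟩ := ht b
      refine ⟨max k l, fun n hn => ?_⟩
      simp only [TensorProduct.map_tmul]
      simp_rw [← TensorProduct.tmul_sum, ← TensorProduct.sum_tmul]
      rw [hk n (le_of_max_le_left hn), hl n (le_of_max_le_right hn)]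
    | add x y hx hy =>
      obtain ⟨k, hk⟩ := hx
      obtain ⟨l, hl⟩ := hy
      refine ⟨max k l, fun n hn => ?_⟩
      simp only [map_add, Finset.sum_add_distrib]
      rw [hk n (le_of_max_le_left hn), hl n (le_of_max_le_right hn)]
  obtain ⟨k, hk⟩ := key x
  rw [← hk k le_rfl]
  simp [hx]

end JointInjectivity

/-! ### From total homology to the homology in each degree. -/

section Components

open scoped DirectSum TensorProduct

variable {R : Type u} [CommRing R]

namespace Tot

variable {K : ChainComplex (ModuleCat.{u} R) ℕ}

/-- The component of degree `n`. -/
abbrev proj (n : ℕ) : Tot K →ₗ[R] K.X n := DirectSum.component R ℕ (fun n => K.X n) n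

lemma proj_of (n : ℕ) (x : K.X n) : proj n (of n x) = x :=
  DirectSum.component.lof_self R _ _

lemma proj_of_ne {m n : ℕ} (h : m ≠ n) (x : K.X m) : proj n (of m x) = 0 := by
  rw [proj, DirectSum.component.of, dif_neg h]

lemma proj_d (n : ℕ) (x : Tot K) : proj n (d K x) = (K.d (n + 1) n).hom (proj (n + 1) x) := by
  have : proj n ∘ₗ d K = (K.d (n + 1) n).hom ∘ₗ proj (n + 1) := by
    refine ext' fun m x => ?_
    rw [LinearMap.comp_apply, LinearMap.comp_apply]
    rcases m with _ | m
    · rw [d_of_zero, proj_of_ne (by omega), map_zero, map_zero]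
    · rw [d_of_succ]
      by_cases h : m = n
      · subst h
        rw [proj_of, proj_of]
      · rw [proj_of_ne h, proj_of_ne (by omega), map_zero]
  exact LinearMap.congr_fun this x

/-- Stating this for all large `n` allows a common bound for several elements, in particular for the
two factors of a tensor. -/
lemma sum_of_proj (x : Tot K) : ∃ k, ∀ n ≥ k, ∑ i ∈ Finset.range n, of i (proj i x) = x := by
  induction x using DirectSum.induction_on with
  | zero => exact ⟨0, fun n _ => by simp⟩
  | of m a =>
    refine ⟨m + 1, fun n hn => ?_⟩
    change ∑ i ∈ Finset.range n, of i (proj i (of m a)) = of m a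
    rw [Finset.sum_eq_single m, proj_of]
    · intro i _ hi
      rw [proj_of_ne hi.symm, map_zero]
    · intro h
      exact absurd (Finset.mem_range.2 hn) h
  | add x y hx hy =>
    obtain ⟨k, hk⟩ := hx
    obtain ⟨l, hl⟩ := hy
    refine ⟨max k l, fun n hn => ?_⟩
    simp only [map_add, Finset.sum_add_distrib]
    rw [hk n (le_of_max_le_left hn), hl n (le_of_max_le_right hn)]

end Tot

variable (R) (X : TopCat.{u}) {Y : TopCat.{u}}

lemma d_proj_of_mem_ker (x : LinearMap.ker (Tot.d (singChains R X))) (n m : ℕ) :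
    ((singChains R X).d n m).hom (Tot.proj n x.1) = 0 := by
  by_cases h : m + 1 = n
  · subst h
    rw [← Tot.proj_d, x.2, map_zero]
  · rw [(singChains R X).shape n m (by simpa using h)]
    rfl

/-- The component of degree `n` of a cycle. -/
def cycleProj (n : ℕ) : LinearMap.ker (Tot.d (singChains R X)) →ₗ[R] (singChains R X).cycles n where
  toFun x := cycleOf R n X (Tot.proj n x.1) (d_proj_of_mem_ker R X x n)
  map_add' x y := cycleChain_injective R n X (by simp [cycleChain_cycleOf])
  map_smul' r x := cycleChain_injective R n X (by simp [cycleChain_cycleOf])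

lemma cycleChain_cycleProj (n : ℕ) (x : LinearMap.ker (Tot.d (singChains R X))) :
    cycleChain R n X (cycleProj R X n x) = Tot.proj n x.1 :=
  cycleChain_cycleOf R n X _ (d_proj_of_mem_ker R X x n)

/-- A cycle of degree `n` as a cycle of the total complex. -/
def cycleIncl (n : ℕ) : (singChains R X).cycles n →ₗ[R] LinearMap.ker (Tot.d (singChains R X)) :=
  (Tot.of n ∘ₗ cycleChain R n X).codRestrict _ fun z => by
    rw [LinearMap.mem_ker, LinearMap.comp_apply]
    rcases n with _ | n
    · rw [Tot.d_of_zero]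
    · rw [Tot.d_of_succ, d_cycleChain, map_zero]

lemma coe_cycleIncl (n : ℕ) (z : (singChains R X).cycles n) :
    (cycleIncl R X n z : Tot (singChains R X)) = Tot.of n (cycleChain R n X z) := rfl

lemma cycleProj_cycleIncl (n : ℕ) (z : (singChains R X).cycles n) :
    cycleProj R X n (cycleIncl R X n z) = z :=
  cycleChain_injective R n X (by rw [cycleChain_cycleProj, coe_cycleIncl, Tot.proj_of])

lemma cycleProj_cycleIncl_ne {m n : ℕ} (h : m ≠ n) (z : (singChains R X).cycles m) :
    cycleProj R X n (cycleIncl R X m z) = 0 :=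
  cycleChain_injective R n X (by
    rw [cycleChain_cycleProj, coe_cycleIncl, Tot.proj_of_ne h, map_zero])

lemma sum_cycleIncl (x : LinearMap.ker (Tot.d (singChains R X))) :
    ∃ k, ∀ n ≥ k, ∑ i ∈ Finset.range n, cycleIncl R X i (cycleProj R X i x) = x := by
  obtain ⟨k, hk⟩ := Tot.sum_of_proj x.1
  refine ⟨k, fun n hn => Subtype.ext ?_⟩
  rw [AddSubmonoidClass.coe_finsetSum]
  simp only [coe_cycleIncl, cycleChain_cycleProj]
  exact hk n hn

/-- The homology class in degree `n` of a cycle. -/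
def classProj (n : ℕ) : LinearMap.ker (Tot.d (singChains R X)) →ₗ[R] singH R n X :=
  cycleClass R n X ∘ₗ cycleProj R X n

lemma classProj_of_mem_range (n : ℕ) (x : LinearMap.ker (Tot.d (singChains R X)))
    (hx : (x : Tot (singChains R X)) ∈ LinearMap.range (Tot.d (singChains R X))) :
    classProj R X n x = 0 := by
  obtain ⟨y, hy⟩ := hx
  refine cycleClass_eq_zero R n X _ (Tot.proj (n + 1) y) ?_
  rw [cycleChain_cycleProj, ← hy, Tot.proj_d]

lemma cycleIncl_mem_range (n : ℕ) (z : (singChains R X).cycles n) (hz : cycleClass R n X z = 0) :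
    (cycleIncl R X n z : Tot (singChains R X)) ∈ LinearMap.range (Tot.d (singChains R X)) := by
  obtain ⟨a, ha⟩ := exists_of_cycleClass_eq_zero R n X z hz
  exact ⟨Tot.of (n + 1) a, by rw [Tot.d_of_succ, ha, coe_cycleIncl]⟩

/-- The total homology. -/
abbrev TotH : Type u := LinearMap.ker (Tot.d (singChains R X)) ⧸
  LinearMap.range (boundary (Tot.d (singChains R X)) Tot.d_d)

variable {X} in
lemma mem_range_boundary {x : LinearMap.ker (Tot.d (singChains R X))} :
    x ∈ LinearMap.range (boundary (Tot.d (singChains R X)) Tot.d_d) ↔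
      (x : Tot (singChains R X)) ∈ LinearMap.range (Tot.d (singChains R X)) :=
  ⟨by rintro ⟨y, rfl⟩; exact ⟨y, rfl⟩, by rintro ⟨y, hy⟩; exact ⟨y, Subtype.ext hy⟩⟩

/-- The component of degree `n` of a total homology class. -/
def homologyProj (n : ℕ) : TotH R X →ₗ[R] singH R n X :=
  Submodule.liftQ _ (classProj R X n) fun x hx =>
    classProj_of_mem_range R X n x ((mem_range_boundary R).1 hx)

/-- A homology class as a total homology class. -/
def homologyIncl (n : ℕ) : singH R n X →ₗ[R] TotH R X :=
  descSurj R (cycleClass R n X) (cycleClass_surjective R n X)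
    (Submodule.mkQ _ ∘ₗ cycleIncl R X n) fun z hz => by
      rw [LinearMap.comp_apply, Submodule.mkQ_apply, Submodule.Quotient.mk_eq_zero,
        mem_range_boundary]
      exact cycleIncl_mem_range R X n z hz

lemma sum_homologyIncl (x : TotH R X) :
    ∃ k, ∀ n ≥ k, ∑ i ∈ Finset.range n, homologyIncl R X i (homologyProj R X i x) = x := by
  obtain ⟨x, rfl⟩ := Submodule.mkQ_surjective _ x
  obtain ⟨k, hk⟩ := sum_cycleIncl R X x
  refine ⟨k, fun n hn => ?_⟩
  conv_rhs => rw [← hk n hn, map_sum]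
  refine Finset.sum_congr rfl fun i _ => ?_
  change homologyIncl R X i (cycleClass R i X (cycleProj R X i x)) = _
  rw [homologyIncl, descSurj_apply]
  rfl

/-- The component of degree `n` of a boundary. -/
def boundaryProj (n : ℕ) :
    LinearMap.range (Tot.d (singChains R X)) →ₗ[R] LinearMap.ker (cycleClass R n X) :=
  (cycleProj R X n ∘ₗ Submodule.inclusion (range_le_ker _ Tot.d_d)).codRestrict _ fun x =>
    classProj_of_mem_range R X n _ x.2

/-- A boundary of degree `n` as a boundary of the total complex. -/
def boundaryIncl (n : ℕ) :
    LinearMap.ker (cycleClass R n X) →ₗ[R] LinearMap.range (Tot.d (singChains R X)) :=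
  (Submodule.subtype _ ∘ₗ cycleIncl R X n ∘ₗ Submodule.subtype _).codRestrict _ fun z =>
    cycleIncl_mem_range R X n z.1 z.2

lemma sum_boundaryIncl (x : LinearMap.range (Tot.d (singChains R X))) :
    ∃ k, ∀ n ≥ k, ∑ i ∈ Finset.range n, boundaryIncl R X i (boundaryProj R X i x) = x := by
  obtain ⟨k, hk⟩ := sum_cycleIncl R X (Submodule.inclusion (range_le_ker _ Tot.d_d) x)
  refine ⟨k, fun n hn => Subtype.ext ?_⟩
  have := congrArg (Submodule.subtype _) (hk n hn)
  rw [map_sum] at this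
  rw [AddSubmonoidClass.coe_finsetSum]
  exact this

variable (Y)

/-- An element of the kernel is zero once its components in all bidegrees are. In bidegree `(i, j)`
the claim is the Tor hypothesis, read off from the presentation of `H_j(Y)` by cycles. -/
lemma lTensor_totH_injective
    (hTor : ∀ i j : ℕ, Limits.IsZero (((Tor (ModuleCat.{u} R) 1).obj
      (singH R i X)).obj (singH R j Y))) :
    Function.Injective ((Submodule.inclusion (range_le_ker (Tot.d (singChains R Y))
      Tot.d_d)).lTensor (TotH R X)) := by
  rw [injective_iff_map_eq_zero]
  intro x hx
  refine tensor_eq_zero_of_components (homologyProj R X) (homologyIncl R X) (boundaryProj R Y)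
    (boundaryIncl R Y) (sum_homologyIncl R X) (sum_boundaryIncl R Y) x fun i j => ?_
  apply lTensor_ker_subtype_injective_of_isZero_Tor _ _ (hTor i j) (cycleClass R j Y)
    (cycleClass_surjective R j Y)
  rw [map_zero]
  have e : (LinearMap.ker (cycleClass R j Y)).subtype.lTensor (singH R i X)
      (TensorProduct.map (homologyProj R X i) (boundaryProj R Y j) x) =
      TensorProduct.map (homologyProj R X i) (cycleProj R Y j)
        ((Submodule.inclusion (range_le_ker (Tot.d (singChains R Y)) Tot.d_d)).lTensor _ x) :=
    tensor_hom_congr (f := (LinearMap.ker (cycleClass R j Y)).subtype.lTensor (singH R i X) ∘ₗ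
      TensorProduct.map (homologyProj R X i) (boundaryProj R Y j))
      (g := TensorProduct.map (homologyProj R X i) (cycleProj R Y j) ∘ₗ
        (Submodule.inclusion (range_le_ker (Tot.d (singChains R Y)) Tot.d_d)).lTensor _)
      (fun m n => rfl) x
  exact e.trans (by rw [hx, map_zero])

end Components

/-! ### The Künneth theorem for singular homology. -/

section Kunneth

open scoped DirectSum TensorProduct

variable (R : Type u) [CommRing R] (X Y : TopCat.{u})

/-- The cross product on tensor products of cycles. -/
def cycleCrossTot : LinearMap.ker (Tot.d (singChains R X)) ⊗[R]
    LinearMap.ker (Tot.d (singChains R Y)) →ₗ[R]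
      LinearMap.ker (Tot.d (singChains R (TopCat.of (X × Y)))) :=
  (crossTot R ∘ₗ TensorProduct.map (Submodule.subtype _) (Submodule.subtype _)).codRestrict _
    fun w => by
      have : tensorD _ _ ∘ₗ TensorProduct.map
          (LinearMap.ker (Tot.d (singChains R X))).subtype
          (LinearMap.ker (Tot.d (singChains R Y))).subtype = 0 := by
        refine TensorProduct.ext' fun a b => ?_
        simp
      have := LinearMap.congr_fun this w
      rw [LinearMap.mem_ker, LinearMap.comp_apply, d_crossTot]
      rw [LinearMap.comp_apply, LinearMap.zero_apply] at this
      rw [this, map_zero]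

lemma coe_cycleCrossTot (w) : (cycleCrossTot R X Y w : Tot (singChains R (TopCat.of (X × Y)))) =
    crossTot R (TensorProduct.map (Submodule.subtype _) (Submodule.subtype _) w) := rfl

/-- The class in `(H_*(X) ⊗ H_*(Y))_n` of a tensor product of cycles. -/
def tensorClass (n : ℕ) : LinearMap.ker (Tot.d (singChains R X)) ⊗[R]
    LinearMap.ker (Tot.d (singChains R Y)) →ₗ[R] homologyTensor R X Y n :=
  ∑ i : Finset.HasAntidiagonal.antidiagonal n,
    DirectSum.lof R (Finset.HasAntidiagonal.antidiagonal n)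
      (fun i => singH R i.1.1 X ⊗[R] singH R i.1.2 Y) i ∘ₗ
      TensorProduct.map (classProj R X i.1.1) (classProj R Y i.1.2)

lemma proj_crossTot₂ (n : ℕ) (a : Tot (singChains R X)) (b : Tot (singChains R Y)) :
    Tot.proj n (crossTot₂ R a b) = ∑ i ∈ Finset.HasAntidiagonal.antidiagonal n,
      chainCross R i.1 i.2 n (Tot.proj i.1 a) (Tot.proj i.2 b) := by
  have : (crossTot₂ R).compr₂ (Tot.proj n) = ∑ i ∈ Finset.HasAntidiagonal.antidiagonal n,
      (chainCross R (X := X) (Y := Y) i.1 i.2 n).compl₁₂ (Tot.proj i.1) (Tot.proj i.2) := by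
    refine tot_ext₂ R fun p q a b => ?_
    rw [LinearMap.sum_apply, LinearMap.sum_apply]
    simp only [LinearMap.compr₂_apply, LinearMap.compl₁₂_apply]
    rw [crossTot₂_of R rfl]
    by_cases h : p + q = n
    · subst h
      rw [Tot.proj_of, Finset.sum_eq_single (p, q)]
      · dsimp only
        rw [Tot.proj_of, Tot.proj_of]
      · rintro ⟨p', q'⟩ _ h
        by_cases hp : p = p'
        · have hq : q ≠ q' := by rintro rfl; exact h (by rw [hp])
          dsimp only
          rw [Tot.proj_of_ne hq, map_zero]
        · dsimp only
          rw [Tot.proj_of_ne hp, map_zero, LinearMap.zero_apply]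
      · intro h
        exact (h (Finset.HasAntidiagonal.mem_antidiagonal.2 rfl)).elim
    · rw [Tot.proj_of_ne h, Finset.sum_eq_zero]
      rintro ⟨p', q'⟩ h'
      rw [Finset.HasAntidiagonal.mem_antidiagonal] at h'
      dsimp only at *
      by_cases hp : p = p'
      · have hq : q ≠ q' := by rintro rfl; exact h (by rw [hp]; exact h')
        rw [Tot.proj_of_ne hq, map_zero]
      · rw [Tot.proj_of_ne hp, map_zero, LinearMap.zero_apply]
  have := LinearMap.congr_fun (LinearMap.congr_fun this a) b
  rwa [LinearMap.sum_apply, LinearMap.sum_apply] at this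

/-- This translates questions about the Künneth map into the ungraded algebra of total cycles. -/
lemma kunnethMap_tensorClass (n : ℕ) (w) :
    kunnethMap R X Y n (tensorClass R X Y n w) = classProj R _ n (cycleCrossTot R X Y w) := by
  refine tensor_hom_congr (f := kunnethMap R X Y n ∘ₗ tensorClass R X Y n)
    (g := classProj R _ n ∘ₗ cycleCrossTot R X Y) (fun a b => ?_) w
  have h : cycleProj R _ n (cycleCrossTot R X Y (a ⊗ₜ b)) =
      ∑ i : Finset.HasAntidiagonal.antidiagonal n,
        cycleCross R (Finset.HasAntidiagonal.mem_antidiagonal.1 i.2) (cycleProj R X i.1.1 a)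
          (cycleProj R Y i.1.2 b) := by
    apply cycleChain_injective
    rw [cycleChain_cycleProj, coe_cycleCrossTot, map_sum, TensorProduct.map_tmul, crossTot,
      TensorProduct.lift.tmul, proj_crossTot₂, ← Finset.sum_coe_sort]
    refine Finset.sum_congr rfl fun i _ => ?_
    rw [cycleChain_cycleCross, cycleChain_cycleProj, cycleChain_cycleProj]
    rfl
  rw [LinearMap.comp_apply, LinearMap.comp_apply, classProj, LinearMap.comp_apply, h, tensorClass,
    LinearMap.sum_apply, map_sum, map_sum]
  refine Finset.sum_congr rfl fun i _ => ?_
  rw [LinearMap.comp_apply, TensorProduct.map_tmul, kunnethMap, DirectSum.toModule_lof,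
    TensorProduct.lift.tmul]
  exact homologyCross_apply R _ _ _

/-- Homogeneity of the cross product serves injectivity: if its class in degree `n` vanishes, the
whole total cycle is a boundary, and not only its component in that degree. -/
lemma exists_tensorClass_eq (n : ℕ) (x : homologyTensor R X Y n) :
    ∃ w, tensorClass R X Y n w = x ∧
      ∃ c, (cycleCrossTot R X Y w : Tot (singChains R (TopCat.of (X × Y)))) = Tot.of n c := by
  induction x using DirectSum.induction_on with
  | zero => exact ⟨0, map_zero _, 0, by simp⟩
  | of i x =>
    induction x using TensorProduct.induction_on with
    | zero => exact ⟨0, by simp, 0, by simp⟩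
    | tmul a b =>
      obtain ⟨⟨p, q⟩, hpq⟩ := i
      have h : p + q = n := Finset.HasAntidiagonal.mem_antidiagonal.1 hpq
      obtain ⟨z, rfl⟩ := cycleClass_surjective R p X a
      obtain ⟨w, rfl⟩ := cycleClass_surjective R q Y b
      refine ⟨cycleIncl R X p z ⊗ₜ cycleIncl R Y q w, ?_,
        chainCross R p q n (cycleChain R p X z) (cycleChain R q Y w), ?_⟩
      · rw [tensorClass, LinearMap.sum_apply, Finset.sum_eq_single ⟨(p, q), hpq⟩]
        · rw [LinearMap.comp_apply, TensorProduct.map_tmul, classProj, classProj,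
            LinearMap.comp_apply, LinearMap.comp_apply, cycleProj_cycleIncl, cycleProj_cycleIncl]
          rfl
        · rintro ⟨⟨p', q'⟩, h'⟩ _ hne
          have h'' : p' + q' = n := Finset.HasAntidiagonal.mem_antidiagonal.1 h'
          have hp : p ≠ p' := by
            rintro rfl
            obtain rfl : q' = q := by omega
            exact hne rfl
          rw [LinearMap.comp_apply, TensorProduct.map_tmul, classProj, LinearMap.comp_apply,
            cycleProj_cycleIncl_ne R X hp, map_zero, TensorProduct.zero_tmul, map_zero]
        · intro h
          exact absurd (Finset.mem_univ _) h
      · rw [coe_cycleCrossTot, TensorProduct.map_tmul, crossTot, TensorProduct.lift.tmul]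
        exact crossTot₂_of R h _ _
    | add x y hx hy =>
      obtain ⟨w, hw, c, hc⟩ := hx
      obtain ⟨w', hw', c', hc'⟩ := hy
      exact ⟨w + w', by rw [map_add, hw, hw', map_add], c + c', by
        rw [map_add, Submodule.coe_add, hc, hc', map_add]⟩
  | add x y hx hy =>
    obtain ⟨w, hw, c, hc⟩ := hx
    obtain ⟨w', hw', c', hc'⟩ := hy
    exact ⟨w + w', by rw [map_add, hw, hw'], c + c', by
      rw [map_add, Submodule.coe_add, hc, hc', map_add]⟩

lemma exact_boundary_mkQ : Function.Exact (boundary (Tot.d (singChains R X)) Tot.d_d)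
    (Submodule.mkQ (LinearMap.range (boundary (Tot.d (singChains R X)) Tot.d_d))) :=
  LinearMap.exact_map_mkQ_range _

instance : Module.Free R (Tot (singChains R X)) := .of_basis (CrossCone.totBasis R X)

instance : Module.Flat R (Tot (singChains R X)) := .of_free

variable [IsDomain R] [IsPrincipalIdealRing R]

/-- A submodule of a free module over a domain is torsion-free, and over a principal ideal domain
this implies flatness. It supplies the flatness of cycles and boundaries. -/
lemma flat_submodule_tot (N : Submodule R (Tot (singChains R X))) : Module.Flat R N := by
  have : Module.IsTorsionFree R (Tot (singChains R X)) := inferInstance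
  have : Module.IsTorsionFree R N := inferInstance
  infer_instance

instance : Module.Flat R (LinearMap.ker (Tot.d (singChains R X))) := flat_submodule_tot R X _

instance : Module.Flat R (LinearMap.range (Tot.d (singChains R X))) := flat_submodule_tot R X _

lemma kunnethMap_injective (n : ℕ) : Function.Injective (kunnethMap R X Y n) := by
  rw [injective_iff_map_eq_zero]
  intro x hx
  obtain ⟨w, rfl, c, hc⟩ := exists_tensorClass_eq R X Y n x
  rw [kunnethMap_tensorClass] at hx
  obtain ⟨e, he⟩ := exists_of_cycleClass_eq_zero R n _ _ hx
  rw [cycleChain_cycleProj, hc, Tot.proj_of] at he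
  -- By Eilenberg-Zilber a tensor cycle whose cross product bounds is itself a boundary.
  obtain ⟨u, hu⟩ := exists_tensorD_eq R (TensorProduct.map (Submodule.subtype _)
    (Submodule.subtype _) w) (tensor_hom_congr (f := tensorD _ _ ∘ₗ TensorProduct.map
      (LinearMap.ker (Tot.d (singChains R X))).subtype
      (LinearMap.ker (Tot.d (singChains R Y))).subtype) (g := 0) (fun a b => by simp) w)
    (Tot.of (n + 1) e) (by rw [← coe_cycleCrossTot, hc, Tot.d_of_succ, he])
  obtain ⟨a, b, rfl⟩ := kunneth_injective (sC := Tot.sign (singChains R X))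
    (dD := Tot.d (singChains R Y)) Tot.d_d Tot.d_d
    Tot.d_sign _ (Submodule.mkQ_surjective _) (exact_boundary_mkQ R X) w u hu.symm
  rw [map_add, tensorClass, LinearMap.sum_apply, LinearMap.sum_apply, ← Finset.sum_add_distrib]
  -- In `a` the first factor is a boundary and in `b` the second one, so neither has a class.
  refine Finset.sum_eq_zero fun i _ => ?_
  have h1 : TensorProduct.map (classProj R X i.1.1) (classProj R Y i.1.2)
      ((boundary (Tot.d (singChains R X)) Tot.d_d).rTensor _ a) = 0 :=
    tensor_hom_congr (f := TensorProduct.map (classProj R X i.1.1) (classProj R Y i.1.2) ∘ₗ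
      (boundary (Tot.d (singChains R X)) Tot.d_d).rTensor _) (g := 0) (fun a b => by
        rw [LinearMap.comp_apply, LinearMap.rTensor_tmul, TensorProduct.map_tmul,
          classProj_of_mem_range R X _ _ ⟨a, rfl⟩, TensorProduct.zero_tmul]
        rfl) a
  have h2 : TensorProduct.map (classProj R X i.1.1) (classProj R Y i.1.2)
      ((Submodule.inclusion (range_le_ker _ Tot.d_d)).lTensor _ b) = 0 :=
    tensor_hom_congr (f := TensorProduct.map (classProj R X i.1.1) (classProj R Y i.1.2) ∘ₗ
      (Submodule.inclusion (range_le_ker _ Tot.d_d)).lTensor _) (g := 0) (fun a b => by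
        rw [LinearMap.comp_apply, LinearMap.lTensor_tmul, TensorProduct.map_tmul,
          classProj_of_mem_range R Y _ _ b.2, TensorProduct.tmul_zero]
        rfl) b
  rw [LinearMap.comp_apply, LinearMap.comp_apply, h1, h2, map_zero, add_zero]

lemma kunnethMap_surjective
    (hTor : ∀ i j : ℕ, Limits.IsZero (((Tor (ModuleCat.{u} R) 1).obj
      (singH R i X)).obj (singH R j Y))) (n : ℕ) : Function.Surjective (kunnethMap R X Y n) := by
  intro x
  obtain ⟨z, rfl⟩ := cycleClass_surjective R n _ x
  -- Eilenberg-Zilber replaces the cycle `z` by the cross product of a tensor cycle `t`, and the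
  -- algebraic theorem replaces `t` by a tensor of cycles, each time up to a boundary.
  obtain ⟨t, e, ht, hz⟩ := exists_crossTot_add_d R (X := X) (Y := Y) _ (cycleIncl R _ n z).2
  obtain ⟨w, u, rfl⟩ := kunneth_surjective (sC := Tot.sign (singChains R X))
    (dD := Tot.d (singChains R Y)) Tot.d_d Tot.d_d Tot.sign_sign
    Tot.d_sign _ (Submodule.mkQ_surjective _) (exact_boundary_mkQ R X)
    (lTensor_totH_injective R X Y hTor) t ht
  refine ⟨tensorClass R X Y n w, ?_⟩
  rw [kunnethMap_tensorClass]
  rw [← cycleProj_cycleIncl R _ n z]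
  change _ = classProj R _ n _
  rw [← sub_eq_zero, ← map_sub]
  refine classProj_of_mem_range R _ n _ ⟨- (crossTot R u + e), ?_⟩
  rw [AddSubgroupClass.coe_sub, hz, coe_cycleCrossTot, map_add]
  have : Tot.d _ (crossTot R u) = crossTot R ((Tot.d (singChains R X)).rTensor _ u +
    TensorProduct.map (Tot.sign _) (Tot.d (singChains R Y)) u) := d_crossTot R X u
  rw [← this, map_neg, map_add]
  abel

end Kunneth

instance : IsDomain IntRing.{u} := MulEquiv.isDomain ℤ (ULift.ringEquiv : ULift.{u} ℤ ≃+* ℤ).toMulEquiv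

instance : IsPrincipalIdealRing IntRing.{u} :=
  IsPrincipalIdealRing.of_surjective (ULift.ringEquiv.symm : ℤ ≃+* ULift.{u} ℤ)
    (ULift.ringEquiv.symm : ℤ ≃+* ULift.{u} ℤ).surjective


/-! ### Formal subdivision of tuples of points. -/

section TupleChains

variable (R : Type*) [CommRing R] {P Q : Type*}

/-- Formal linear combinations of `n`-tuples of points. -/
abbrev TupleChain (P : Type*) (n : ℕ) : Type _ := (Fin n → P) →₀ R

namespace TupleChain

variable {R} in
/-- A tuple as a formal linear combination. -/
abbrev of {n : ℕ} (v : Fin n → P) : TupleChain R P n := Finsupp.single v 1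

variable {R} in
lemma ext {n : ℕ} {M : Type*} [AddCommGroup M] [Module R M] {f g : TupleChain R P n →ₗ[R] M}
    (h : ∀ v, f (of v) = g (of v)) : f = g :=
  Finsupp.lhom_ext' fun v => LinearMap.ext_ring (h v)

/-- The map induced by a map of points. -/
def map (f : P → Q) (n : ℕ) : TupleChain R P n →ₗ[R] TupleChain R Q n :=
  Finsupp.lmapDomain R R fun v => f ∘ v

lemma map_of (f : P → Q) {n : ℕ} (v : Fin n → P) : map R f n (of v) = of (f ∘ v) :=
  Finsupp.mapDomain_single

/-- Adjunction of a first point. -/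
def cone (a : P) (n : ℕ) : TupleChain R P n →ₗ[R] TupleChain R P (n + 1) :=
  Finsupp.lmapDomain R R fun v => Fin.cons a v

lemma cone_of (a : P) {n : ℕ} (v : Fin n → P) :
    cone R a n (of v) = of (Fin.cons a v : Fin (n + 1) → P) := Finsupp.mapDomain_single

/-- The alternating sum of the faces. -/
def d (P : Type*) (n : ℕ) : TupleChain R P (n + 1) →ₗ[R] TupleChain R P n :=
  Finsupp.linearCombination R fun v => ∑ i : Fin (n + 1), ((-1) ^ (i : ℕ) : ℤ) • of (v ∘ i.succAbove)

lemma d_of {n : ℕ} (v : Fin (n + 1) → P) :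
    d R P n (of v) = ∑ i : Fin (n + 1), ((-1) ^ (i : ℕ) : ℤ) • of (v ∘ i.succAbove) := by
  rw [d, Finsupp.linearCombination_single, one_smul]

/-- Tuples of length `n` are simplices of dimension `n - 1`. The empty tuple provides an
augmentation, so that coning is a contraction down to the bottom. -/
lemma d_cone_zero (a : P) (x : TupleChain R P 0) : d R P 0 (cone R a 0 x) = x := by
  have : d R P 0 ∘ₗ cone R a 0 = LinearMap.id := by
    refine ext fun v => ?_
    rw [LinearMap.comp_apply, cone_of, d_of]
    simp [Subsingleton.elim _ v]
  exact LinearMap.congr_fun this x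

lemma d_cone (a : P) {n : ℕ} (x : TupleChain R P (n + 1)) :
    d R P (n + 1) (cone R a (n + 1) x) = x - cone R a n (d R P n x) := by
  have : d R P (n + 1) ∘ₗ cone R a (n + 1) = LinearMap.id - cone R a n ∘ₗ d R P n := by
    refine ext fun v => ?_
    rw [LinearMap.comp_apply, cone_of, d_of, LinearMap.sub_apply, LinearMap.comp_apply, d_of,
      Fin.sum_univ_succ, map_sum, sub_eq_add_neg, ← Finset.sum_neg_distrib]
    congr 1
    · simp only [Fin.val_zero, pow_zero, one_smul, LinearMap.id_apply]
      congr 1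
    · refine Finset.sum_congr rfl fun i _ => ?_
      have h : (Fin.cons a v : Fin (n + 2) → P) ∘ i.succ.succAbove =
          Fin.cons a (v ∘ i.succAbove) := by
        funext j
        refine Fin.cases ?_ (fun j => ?_) j <;> simp
      rw [map_zsmul, cone_of, Fin.val_succ, pow_succ, mul_neg_one, neg_smul, h]
  exact LinearMap.congr_fun this x

lemma exists_cone {n : ℕ} (v : Fin (n + 1) → P) : of v = cone R (v 0) n (of (Fin.tail v)) := by
  rw [cone_of, Fin.cons_self_tail]

/-- Every tuple is the cone from its first point over its tail, and the cone formula reduces the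
claim to shorter tuples; no cancellation of double faces is needed. -/
lemma d_d {n : ℕ} (x : TupleChain R P (n + 2)) : d R P n (d R P (n + 1) x) = 0 := by
  induction n with
  | zero =>
    have : d R P 0 ∘ₗ d R P 1 = 0 := by
      refine ext fun v => ?_
      rw [LinearMap.comp_apply, exists_cone, d_cone, map_sub, d_cone_zero, sub_self]
      rfl
    exact LinearMap.congr_fun this x
  | succ n ih =>
    have : d R P (n + 1) ∘ₗ d R P (n + 2) = 0 := by
      refine ext fun v => ?_
      rw [LinearMap.comp_apply, exists_cone, d_cone, map_sub, d_cone, ih, map_zero, sub_zero,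
        sub_self]
      rfl
    exact LinearMap.congr_fun this x

lemma map_cone (f : P → Q) (a : P) {n : ℕ} (x : TupleChain R P n) :
    map R f (n + 1) (cone R a n x) = cone R (f a) n (map R f n x) := by
  have : map R f (n + 1) ∘ₗ cone R a n = cone R (f a) n ∘ₗ map R f n := by
    refine ext fun v => ?_
    rw [LinearMap.comp_apply, LinearMap.comp_apply, cone_of, map_of, map_of, cone_of]
    congr 1
    funext j
    refine Fin.cases ?_ (fun j => ?_) j <;> simp
  exact LinearMap.congr_fun this x

lemma map_d (f : P → Q) {n : ℕ} (x : TupleChain R P (n + 1)) :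
    map R f n (d R P n x) = d R Q n (map R f (n + 1) x) := by
  have : map R f n ∘ₗ d R P n = d R Q n ∘ₗ map R f (n + 1) := by
    refine ext fun v => ?_
    rw [LinearMap.comp_apply, LinearMap.comp_apply, map_of, d_of, d_of, map_sum]
    refine Finset.sum_congr rfl fun i _ => ?_
    rw [map_zsmul, map_of]
    rfl
  exact LinearMap.congr_fun this x

variable (b : ∀ n, (Fin (n + 1) → P) → P) (c : ∀ n, (Fin (n + 1) → Q) → Q)

/-- Subdivision with respect to a choice of center for every tuple. -/
def subdiv : ∀ n, TupleChain R P n →ₗ[R] TupleChain R P n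
  | 0 => LinearMap.id
  | n + 1 => Finsupp.linearCombination R fun v => cone R (b n v) n (subdiv n (d R P n (of v)))

lemma subdiv_of {n : ℕ} (v : Fin (n + 1) → P) :
    subdiv R b (n + 1) (of v) = cone R (b n v) n (subdiv R b n (d R P n (of v))) := by
  rw [subdiv, Finsupp.linearCombination_single, one_smul]

/-- A homotopy from the subdivision to the identity. -/
def subdivHtpy : ∀ n, TupleChain R P n →ₗ[R] TupleChain R P (n + 1)
  | 0 => 0
  | n + 1 => Finsupp.linearCombination R fun v =>
    cone R (b n v) (n + 1) (of v - subdivHtpy n (d R P n (of v)))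

lemma subdivHtpy_of {n : ℕ} (v : Fin (n + 1) → P) :
    subdivHtpy R b (n + 1) (of v) =
      cone R (b n v) (n + 1) (of v - subdivHtpy R b n (d R P n (of v))) := by
  rw [subdivHtpy, Finsupp.linearCombination_single, one_smul]

/-- The subdivision of `v` is the cone on the subdivision of its boundary. The cone formula returns
that subdivided boundary minus a cone on its differential, which vanishes by induction and `d ∘ d =
0`. -/
lemma d_subdiv {n : ℕ} (x : TupleChain R P (n + 1)) :
    d R P n (subdiv R b (n + 1) x) = subdiv R b n (d R P n x) := by
  induction n with
  | zero =>
    have : d R P 0 ∘ₗ subdiv R b 1 = subdiv R b 0 ∘ₗ d R P 0 := by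
      refine ext fun v => ?_
      rw [LinearMap.comp_apply, LinearMap.comp_apply, subdiv_of, d_cone_zero]
    exact LinearMap.congr_fun this x
  | succ n ih =>
    have : d R P (n + 1) ∘ₗ subdiv R b (n + 2) = subdiv R b (n + 1) ∘ₗ d R P (n + 1) := by
      refine ext fun v => ?_
      rw [LinearMap.comp_apply, LinearMap.comp_apply, subdiv_of, d_cone, ih, d_d, map_zero,
        map_zero, sub_zero]
    exact LinearMap.congr_fun this x

/-- Let `T` be the homotopy. By induction the chain `v - T (d v)`, on which the cone is taken, has
as its differential the subdivision of `d v`; the cone on the latter is the subdivision of `v`. -/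
lemma d_subdivHtpy {n : ℕ} (x : TupleChain R P (n + 1)) :
    d R P (n + 1) (subdivHtpy R b (n + 1) x) =
      x - subdiv R b (n + 1) x - subdivHtpy R b n (d R P n x) := by
  induction n with
  | zero =>
    have : d R P 1 ∘ₗ subdivHtpy R b 1 =
        LinearMap.id - subdiv R b 1 - subdivHtpy R b 0 ∘ₗ d R P 0 := by
      refine ext fun v => ?_
      simp only [LinearMap.comp_apply, LinearMap.sub_apply, LinearMap.id_apply]
      rw [subdivHtpy_of, d_cone, subdiv_of, subdivHtpy]
      simp only [LinearMap.zero_apply, sub_zero, subdiv, LinearMap.id_apply]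
    exact LinearMap.congr_fun this x
  | succ n ih =>
    have : d R P (n + 2) ∘ₗ subdivHtpy R b (n + 2) =
        LinearMap.id - subdiv R b (n + 2) - subdivHtpy R b (n + 1) ∘ₗ d R P (n + 1) := by
      refine ext fun v => ?_
      simp only [LinearMap.comp_apply, LinearMap.sub_apply, LinearMap.id_apply]
      rw [subdivHtpy_of, d_cone, subdiv_of, map_sub (d R P (n + 1)), ih, d_d, map_zero, sub_zero,
        sub_sub_cancel]
      abel
    exact LinearMap.congr_fun this x

variable {b c}

/-- The centers are the only choice in the construction, so compatibility with centers implies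
naturality. -/
lemma map_subdiv {f : P → Q} (hf : ∀ n v, f (b n v) = c n (f ∘ v)) {n : ℕ}
    (x : TupleChain R P n) : map R f n (subdiv R b n x) = subdiv R c n (map R f n x) := by
  induction n with
  | zero => rfl
  | succ n ih =>
    have : map R f (n + 1) ∘ₗ subdiv R b (n + 1) = subdiv R c (n + 1) ∘ₗ map R f (n + 1) := by
      refine ext fun v => ?_
      rw [LinearMap.comp_apply, LinearMap.comp_apply, subdiv_of, map_cone, ih, map_d, map_of,
        subdiv_of, hf]
    exact LinearMap.congr_fun this x

lemma map_subdivHtpy {f : P → Q} (hf : ∀ n v, f (b n v) = c n (f ∘ v)) {n : ℕ}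
    (x : TupleChain R P n) :
    map R f (n + 1) (subdivHtpy R b n x) = subdivHtpy R c n (map R f n x) := by
  induction n with
  | zero => simp [subdivHtpy]
  | succ n ih =>
    have : map R f (n + 2) ∘ₗ subdivHtpy R b (n + 1) =
        subdivHtpy R c (n + 1) ∘ₗ map R f (n + 1) := by
      refine ext fun v => ?_
      rw [LinearMap.comp_apply, LinearMap.comp_apply, subdivHtpy_of, map_cone, map_sub, ih, map_d,
        map_of, subdivHtpy_of, hf]
    exact LinearMap.congr_fun this x

section Mesh

variable [PseudoMetricSpace P]

/-- The points that lie in every closed ball containing all points of the tuple. -/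
def ballHull {n : ℕ} (v : Fin n → P) : Set P :=
  {x | ∀ p ρ, (∀ j, dist (v j) p ≤ ρ) → dist x p ≤ ρ}

/-- Subdivision shrinks tuples by the factor `r` if centers do. -/
lemma subdiv_mem_supported {N : ℕ} {r δ : ℝ} (hr : 0 ≤ r * δ)
    (hb : ∀ n ≤ N, ∀ v : Fin (n + 1) → P, b n v ∈ ballHull v ∧
      ((∀ i j, dist (v i) (v j) ≤ δ) → ∀ j, dist (v j) (b n v) ≤ r * δ))
    {n : ℕ} (hn : n ≤ N + 1) (v : Fin n → P) (hv : ∀ i j, dist (v i) (v j) ≤ δ) :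
    subdiv R b n (of v) ∈ Finsupp.supported R R
      {w : Fin n → P | (∀ i j, dist (w i) (w j) ≤ r * δ) ∧ ∀ i, w i ∈ ballHull v} := by
  induction n with
  | zero => exact Finsupp.single_mem_supported R _ ⟨fun i => i.elim0, fun i => i.elim0⟩
  | succ n ih =>
    rw [subdiv_of, d_of, map_sum, map_sum]
    refine Submodule.sum_mem _ fun k _ => ?_
    rw [map_zsmul, map_zsmul]
    refine zsmul_mem ?_ _
    have h := Submodule.mem_map_of_mem (f := cone R (b n v) n)
      (ih (by omega) (v ∘ k.succAbove) fun i j => hv _ _)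
    rw [cone, Finsupp.lmapDomain_supported] at h
    refine Finsupp.supported_mono ?_ h
    rintro _ ⟨w, ⟨hw, hw'⟩, rfl⟩
    obtain ⟨h1, h2⟩ := hb n (by omega) v
    -- The closed ball of radius `r * δ` about the center contains all `v j`, hence the whole hull.
    -- This bounds the edges that end at the new vertex.
    have h3 : ∀ i, dist (w i) (b n v) ≤ r * δ := fun i => hw' i _ _ fun j => h2 hv _
    refine ⟨fun i j => ?_, fun i => ?_⟩
    · refine Fin.cases ?_ (fun i => ?_) i <;> refine Fin.cases ?_ (fun j => ?_) j
      · simpa using hr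
      · simpa [dist_comm] using h3 j
      · simpa using h3 i
      · simpa using hw i j
    · refine Fin.cases ?_ (fun i => ?_) i
      · simpa using h1
      · intro p ρ hp
        simpa using hw' i p ρ fun j => hp _

/-- Iterated subdivision. -/
lemma subdiv_iterate_mem_supported {N : ℕ} {r : ℝ} (hr : 0 ≤ r)
    (hb : ∀ n ≤ N, ∀ v : Fin (n + 1) → P, b n v ∈ ballHull v ∧
      ∀ δ, (∀ i j, dist (v i) (v j) ≤ δ) → ∀ j, dist (v j) (b n v) ≤ r * δ)
    {n : ℕ} (hn : n ≤ N + 1) {δ : ℝ} (hδ : 0 ≤ δ) (v : Fin n → P)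
    (hv : ∀ i j, dist (v i) (v j) ≤ δ) (k : ℕ) :
    (subdiv R b n)^[k] (of v) ∈ Finsupp.supported R R
      {w : Fin n → P | ∀ i j, dist (w i) (w j) ≤ r ^ k * δ} := by
  induction k with
  | zero => exact Finsupp.single_mem_supported R _ (by simpa using hv)
  | succ k ih =>
    rw [Function.iterate_succ_apply']
    rw [Finsupp.supported_eq_span_single] at ih
    have h := Submodule.mem_map_of_mem (f := subdiv R b n) ih
    rw [Submodule.map_span] at h
    refine Submodule.span_le.2 ?_ h
    rintro _ ⟨_, ⟨w, hw, rfl⟩, rfl⟩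
    have := subdiv_mem_supported R (b := b) (δ := r ^ k * δ) (r := r) (by positivity)
      (fun n hn v => ⟨(hb n hn v).1, (hb n hn v).2 _⟩) hn w hw
    refine Finsupp.supported_mono ?_ this
    intro w' hw'
    rw [Set.mem_ofPred_eq, pow_succ', mul_assoc]
    exact hw'.1

end Mesh

end TupleChain

end TupleChains


/-! ### Affine singular simplices. -/

section AffineSimplices

open scoped Simplicial

/-- The affine combination of the points `w` with weights `t`. -/
def affineComb {n q : ℕ} (w : Fin (n + 1) → stdSimplex ℝ (Fin (q + 1)))
    (t : stdSimplex ℝ (Fin (n + 1))) : stdSimplex ℝ (Fin (q + 1)) :=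
  ⟨∑ i, t i • (w i).1, (convex_stdSimplex ℝ _).sum_mem (fun i _ => t.2.1 i) t.2.2
    fun i _ => (w i).2⟩

lemma coe_affineComb {n q : ℕ} (w : Fin (n + 1) → stdSimplex ℝ (Fin (q + 1)))
    (t : stdSimplex ℝ (Fin (n + 1))) : (affineComb w t).1 = ∑ i, t.1 i • (w i).1 := rfl

lemma continuous_affineComb {n q : ℕ} (w : Fin (n + 1) → stdSimplex ℝ (Fin (q + 1))) :
    Continuous (affineComb w) := by
  refine Continuous.subtype_mk (continuous_finsetSum _ fun i _ => ?_) _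
  exact ((continuous_apply i).comp continuous_subtype_val).smul continuous_const

lemma affineComb_vertex {q : ℕ} (t : stdSimplex ℝ (Fin (q + 1))) :
    affineComb stdSimplex.vertex t = t := by
  refine Subtype.ext ?_
  rw [coe_affineComb]
  funext j
  simp [Finset.sum_apply, Pi.single_apply]

lemma affineComb_affineComb {m n q : ℕ} (v : Fin (m + 1) → stdSimplex ℝ (Fin (n + 1)))
    (w : Fin (n + 1) → stdSimplex ℝ (Fin (q + 1))) (t : stdSimplex ℝ (Fin (m + 1))) :
    affineComb w (affineComb v t) = affineComb (affineComb w ∘ v) t := by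
  refine Subtype.ext ?_
  simp only [coe_affineComb, Function.comp_apply, Finset.sum_apply, Pi.smul_apply, Finset.sum_smul,
    Finset.smul_sum, smul_smul, smul_eq_mul]
  rw [Finset.sum_comm]

lemma affineComb_map {m n q : ℕ} (f : Fin (m + 1) → Fin (n + 1))
    (w : Fin (n + 1) → stdSimplex ℝ (Fin (q + 1))) (t : stdSimplex ℝ (Fin (m + 1))) :
    affineComb w (stdSimplex.map f t) = affineComb (w ∘ f) t := by
  refine Subtype.ext ?_
  simp only [coe_affineComb]
  have : ∀ j, (stdSimplex.map f t).1 j = ∑ i with f i = j, t.1 i :=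
    fun j => FunOnFinite.linearMap_apply_apply ℝ ℝ f t.1 j
  simp only [this, Finset.sum_smul]
  rw [← Finset.sum_fiberwise Finset.univ f fun i => t.1 i • ((w ∘ f) i).1]
  refine Finset.sum_congr rfl fun j _ => Finset.sum_congr rfl fun i hi => ?_
  rw [Function.comp_apply, (Finset.mem_filter.1 hi).2]

lemma affineComb_single {n q : ℕ} (w : Fin (n + 1) → stdSimplex ℝ (Fin (q + 1))) (i) :
    affineComb w (stdSimplex.vertex i) = w i := by
  refine Subtype.ext ?_
  rw [coe_affineComb]
  simp [Pi.single_apply]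

/-- The affine map of topological simplices with prescribed vertices. -/
def affineMap {n q : ℕ} (w : Fin (n + 1) → stdSimplex ℝ (Fin (q + 1))) :
    topSimplex.{u} n ⟶ topSimplex.{u} q :=
  TopCat.ofHom ⟨fun t => ULift.up (affineComb w t.down),
    continuous_uliftUp.comp ((continuous_affineComb w).comp continuous_uliftDown)⟩

lemma affineMap_comp {m n q : ℕ} (v : Fin (m + 1) → stdSimplex ℝ (Fin (n + 1)))
    (w : Fin (n + 1) → stdSimplex ℝ (Fin (q + 1))) :
    affineMap.{u} v ≫ affineMap w = affineMap (affineComb w ∘ v) := by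
  ext t
  exact congrArg ULift.up (affineComb_affineComb v w t.down)

lemma affineMap_vertex (q : ℕ) : affineMap.{u} (stdSimplex.vertex (X := Fin (q + 1))) = 𝟙 _ := by
  ext t
  exact congrArg ULift.up (affineComb_vertex t.down)

/-- The affine singular simplex with prescribed vertices. -/
def affineSimplex {n q : ℕ} (w : Fin (n + 1) → stdSimplex ℝ (Fin (q + 1))) :
    (TopCat.toSSet.obj (topSimplex.{u} q)) _⦋n⦌ := ⟨affineMap w⟩

lemma simplexMap_affineSimplex {n q : ℕ} (w : Fin (n + 1) → stdSimplex ℝ (Fin (q + 1))) :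
    simplexMap (affineSimplex.{u} w) = affineMap w := rfl

lemma affineSimplex_vertex (q : ℕ) :
    affineSimplex.{u} (stdSimplex.vertex (X := Fin (q + 1))) = idSimplex q :=
  congrArg ULift.up (affineMap_vertex q)

lemma map_affineSimplex {m n q : ℕ} (v : Fin (m + 1) → stdSimplex ℝ (Fin (n + 1)))
    (w : Fin (n + 1) → stdSimplex ℝ (Fin (q + 1))) :
    (TopCat.toSSet.map (affineMap.{u} w)).app _ (affineSimplex v) =
      affineSimplex (affineComb w ∘ v) :=
  congrArg ULift.up (affineMap_comp v w)

lemma δ_affineSimplex {n q : ℕ} (i : Fin (n + 2))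
    (w : Fin (n + 2) → stdSimplex ℝ (Fin (q + 1))) :
    (TopCat.toSSet.obj (topSimplex.{u} q)).map (SimplexCategory.δ i).op (affineSimplex w) =
      affineSimplex (w ∘ i.succAbove) := by
  have : SimplexCategory.toTop.{u}.map (SimplexCategory.δ i) ≫ affineMap w =
      affineMap (w ∘ i.succAbove) := by
    ext t
    exact congrArg ULift.up (affineComb_map i.succAbove w t.down)
  exact congrArg ULift.up this

end AffineSimplices

/-! ### Barycentric subdivision of singular chains. -/

section Subdivision

open scoped Simplicial

variable (R : Type u) [CommRing R]

/-- The singular chain of a formal combination of tuples of points of a simplex. -/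
def affineChain (n q : ℕ) : TupleChain R (stdSimplex ℝ (Fin (q + 1))) (n + 1) →ₗ[R]
    (singChains R (topSimplex.{u} q)).X n :=
  Finsupp.linearCombination R fun w => simplexChain R (affineSimplex w) 1

lemma affineChain_of {n q : ℕ} (w : Fin (n + 1) → stdSimplex ℝ (Fin (q + 1))) :
    affineChain R n q (TupleChain.of w) = simplexChain R (affineSimplex w) 1 := by
  rw [affineChain, Finsupp.linearCombination_single, one_smul]

lemma d_affineChain {n q : ℕ} (x) :
    ((singChains R (topSimplex.{u} q)).d (n + 1) n).hom (affineChain R (n + 1) q x) =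
      affineChain R n q (TupleChain.d R _ _ x) := by
  have : ((singChains R (topSimplex.{u} q)).d (n + 1) n).hom ∘ₗ affineChain R (n + 1) q =
      affineChain R n q ∘ₗ TupleChain.d R _ _ := by
    refine TupleChain.ext fun w => ?_
    rw [LinearMap.comp_apply, LinearMap.comp_apply, affineChain_of, d_simplexChain,
      TupleChain.d_of, map_sum]
    refine Finset.sum_congr rfl fun i _ => ?_
    rw [map_zsmul, affineChain_of, δ_affineSimplex]
  exact LinearMap.congr_fun this x

lemma map_affineChain {m n q : ℕ} (w : Fin (n + 1) → stdSimplex ℝ (Fin (q + 1))) (x) :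
    ((singChainsMap R (affineMap w)).f m).hom (affineChain R m n x) =
      affineChain R m q (TupleChain.map R (affineComb w) _ x) := by
  have : ((singChainsMap R (affineMap w)).f m).hom ∘ₗ affineChain R m n =
      affineChain R m q ∘ₗ TupleChain.map R (affineComb w) _ := by
    refine TupleChain.ext fun v => ?_
    rw [LinearMap.comp_apply, LinearMap.comp_apply, affineChain_of, singChainsMap_simplexChain,
      TupleChain.map_of, affineChain_of, map_affineSimplex]
  exact LinearMap.congr_fun this x

/-- The barycenter of a tuple of points. -/
def tupleBarycenter (q n : ℕ) (v : Fin (n + 1) → stdSimplex ℝ (Fin (q + 1))) :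
    stdSimplex ℝ (Fin (q + 1)) := affineComb v stdSimplex.barycenter

lemma affineComb_tupleBarycenter {n q : ℕ} (w : Fin (n + 1) → stdSimplex ℝ (Fin (q + 1)))
    (m : ℕ) (v : Fin (m + 1) → stdSimplex ℝ (Fin (n + 1))) :
    affineComb w (tupleBarycenter n m v) = tupleBarycenter q m (affineComb w ∘ v) :=
  affineComb_affineComb _ _ _

/-- The singular chains obtained by applying a singular simplex to affine chains. -/
def pushAffine {X : TopCat.{u}} {q : ℕ} (σ : (TopCat.toSSet.obj X) _⦋q⦌) (n : ℕ) :
    TupleChain R (stdSimplex ℝ (Fin (q + 1))) (n + 1) →ₗ[R] (singChains R X).X n :=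
  ((singChainsMap R (simplexMap σ)).f n).hom ∘ₗ affineChain R n q

lemma map_pushAffine {X Y : TopCat.{u}} (f : X ⟶ Y) {q : ℕ} (σ : (TopCat.toSSet.obj X) _⦋q⦌)
    (n : ℕ) (x) : ((singChainsMap R f).f n).hom (pushAffine R σ n x) =
      pushAffine R ((TopCat.toSSet.map f).app _ σ) n x := by
  have : singChainsMap R (simplexMap σ ≫ f) = singChainsMap R (simplexMap σ) ≫ singChainsMap R f :=
    Functor.map_comp _ _ _
  rw [pushAffine, pushAffine, simplexMap_map, this]
  rfl

lemma d_pushAffine {X : TopCat.{u}} {q : ℕ} (σ : (TopCat.toSSet.obj X) _⦋q⦌) (n : ℕ) (x) :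
    ((singChains R X).d (n + 1) n).hom (pushAffine R σ (n + 1) x) =
      pushAffine R σ n (TupleChain.d R _ _ x) := by
  rw [pushAffine, pushAffine, LinearMap.comp_apply, LinearMap.comp_apply, ← d_affineChain]
  exact LinearMap.congr_fun (congrArg ModuleCat.Hom.hom
    ((singChainsMap R (simplexMap σ)).comm (n + 1) n)) _

lemma pushAffine_of {X : TopCat.{u}} {q : ℕ} (σ : (TopCat.toSSet.obj X) _⦋q⦌) (n : ℕ) (w) :
    pushAffine R σ n (TupleChain.of w) =
      simplexChain R ((TopCat.toSSet.map (simplexMap σ)).app _ (affineSimplex w)) 1 := by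
  rw [pushAffine, LinearMap.comp_apply, affineChain_of, singChainsMap_simplexChain]

lemma pushAffine_vertex {X : TopCat.{u}} {q : ℕ} (σ : (TopCat.toSSet.obj X) _⦋q⦌) :
    pushAffine R σ q (TupleChain.of stdSimplex.vertex) = simplexChain R σ 1 := by
  rw [pushAffine_of, affineSimplex_vertex]
  rfl

lemma pushAffine_push {X : TopCat.{u}} {m q : ℕ} (σ : (TopCat.toSSet.obj X) _⦋q⦌)
    (w : Fin (m + 1) → stdSimplex ℝ (Fin (q + 1))) (n : ℕ) (x) :
    pushAffine R ((TopCat.toSSet.map (simplexMap σ)).app (.op ⦋m⦌) (affineSimplex w)) n x =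
      pushAffine R σ n (TupleChain.map R (affineComb w) _ x) := by
  rw [← map_pushAffine, pushAffine, pushAffine, LinearMap.comp_apply, LinearMap.comp_apply,
    simplexMap_affineSimplex, map_affineChain]

variable (X : TopCat.{u})

/-- Barycentric subdivision of singular chains. -/
def barySubdiv (n : ℕ) : (singChains R X).X n →ₗ[R] (singChains R X).X n :=
  (simplexBasis R X n).constr R fun σ => pushAffine R σ n
    (TupleChain.subdiv R (tupleBarycenter n) _ (TupleChain.of stdSimplex.vertex))

/-- The homotopy between barycentric subdivision and the identity. -/
def baryHtpy (n : ℕ) : (singChains R X).X n →ₗ[R] (singChains R X).X (n + 1) :=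
  (simplexBasis R X n).constr R fun σ => pushAffine R σ (n + 1)
    (TupleChain.subdivHtpy R (tupleBarycenter n) _ (TupleChain.of stdSimplex.vertex))

variable {X}

lemma barySubdiv_simplexChain {n : ℕ} (σ : (TopCat.toSSet.obj X) _⦋n⦌) :
    barySubdiv R X n (simplexChain R σ 1) = pushAffine R σ n
      (TupleChain.subdiv R (tupleBarycenter n) _ (TupleChain.of stdSimplex.vertex)) := by
  rw [← simplexBasis_apply, barySubdiv, Module.Basis.constr_basis]

lemma baryHtpy_simplexChain {n : ℕ} (σ : (TopCat.toSSet.obj X) _⦋n⦌) :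
    baryHtpy R X n (simplexChain R σ 1) = pushAffine R σ (n + 1)
      (TupleChain.subdivHtpy R (tupleBarycenter n) _ (TupleChain.of stdSimplex.vertex)) := by
  rw [← simplexBasis_apply, baryHtpy, Module.Basis.constr_basis]

lemma map_barySubdiv {Y : TopCat.{u}} (f : X ⟶ Y) {n : ℕ} (x : (singChains R X).X n) :
    ((singChainsMap R f).f n).hom (barySubdiv R X n x) =
      barySubdiv R Y n (((singChainsMap R f).f n).hom x) := by
  have : ((singChainsMap R f).f n).hom ∘ₗ barySubdiv R X n =
      barySubdiv R Y n ∘ₗ ((singChainsMap R f).f n).hom := by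
    refine chain_ext R fun σ => ?_
    rw [LinearMap.comp_apply, LinearMap.comp_apply, barySubdiv_simplexChain,
      singChainsMap_simplexChain, barySubdiv_simplexChain, map_pushAffine]
  exact LinearMap.congr_fun this x

lemma map_baryHtpy {Y : TopCat.{u}} (f : X ⟶ Y) {n : ℕ} (x : (singChains R X).X n) :
    ((singChainsMap R f).f (n + 1)).hom (baryHtpy R X n x) =
      baryHtpy R Y n (((singChainsMap R f).f n).hom x) := by
  have : ((singChainsMap R f).f (n + 1)).hom ∘ₗ baryHtpy R X n =
      baryHtpy R Y n ∘ₗ ((singChainsMap R f).f n).hom := by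
    refine chain_ext R fun σ => ?_
    rw [LinearMap.comp_apply, LinearMap.comp_apply, baryHtpy_simplexChain,
      singChainsMap_simplexChain, baryHtpy_simplexChain, map_pushAffine]
  exact LinearMap.congr_fun this x

lemma map_affineComb_vertex {m q : ℕ} (w : Fin (m + 1) → stdSimplex ℝ (Fin (q + 1))) :
    TupleChain.map R (affineComb w) _ (TupleChain.of stdSimplex.vertex) = TupleChain.of w := by
  rw [TupleChain.map_of]
  congr 1
  funext i
  exact affineComb_single w i

/-- Affine maps preserve barycenters, so subdividing an affine simplex as a singular simplex agrees
with subdividing its tuple of vertices. The formal identities, and iteration, pass to singular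
chains in this way. -/
lemma barySubdiv_pushAffine {q : ℕ} (σ : (TopCat.toSSet.obj X) _⦋q⦌) (n : ℕ) (x) :
    barySubdiv R X n (pushAffine R σ n x) =
      pushAffine R σ n (TupleChain.subdiv R (tupleBarycenter q) _ x) := by
  have : barySubdiv R X n ∘ₗ pushAffine R σ n =
      pushAffine R σ n ∘ₗ TupleChain.subdiv R (tupleBarycenter q) _ := by
    refine TupleChain.ext fun w => ?_
    rw [LinearMap.comp_apply, LinearMap.comp_apply, pushAffine_of, barySubdiv_simplexChain,
      pushAffine_push, TupleChain.map_subdiv R (affineComb_tupleBarycenter w),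
      map_affineComb_vertex]
  exact LinearMap.congr_fun this x

lemma baryHtpy_pushAffine {q : ℕ} (σ : (TopCat.toSSet.obj X) _⦋q⦌) (n : ℕ) (x) :
    baryHtpy R X n (pushAffine R σ n x) =
      pushAffine R σ (n + 1) (TupleChain.subdivHtpy R (tupleBarycenter q) _ x) := by
  have : baryHtpy R X n ∘ₗ pushAffine R σ n =
      pushAffine R σ (n + 1) ∘ₗ TupleChain.subdivHtpy R (tupleBarycenter q) _ := by
    refine TupleChain.ext fun w => ?_
    rw [LinearMap.comp_apply, LinearMap.comp_apply, pushAffine_of, baryHtpy_simplexChain,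
      pushAffine_push, TupleChain.map_subdivHtpy R (affineComb_tupleBarycenter w),
      map_affineComb_vertex]
  exact LinearMap.congr_fun this x

lemma d_barySubdiv {n : ℕ} (x : (singChains R X).X (n + 1)) :
    ((singChains R X).d (n + 1) n).hom (barySubdiv R X (n + 1) x) =
      barySubdiv R X n (((singChains R X).d (n + 1) n).hom x) := by
  have : ((singChains R X).d (n + 1) n).hom ∘ₗ barySubdiv R X (n + 1) =
      barySubdiv R X n ∘ₗ ((singChains R X).d (n + 1) n).hom := by
    refine chain_ext R fun σ => ?_
    rw [LinearMap.comp_apply, LinearMap.comp_apply, barySubdiv_simplexChain, d_pushAffine,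
      TupleChain.d_subdiv, ← barySubdiv_pushAffine, ← d_pushAffine, pushAffine_vertex]
  exact LinearMap.congr_fun this x

lemma d_baryHtpy_succ {n : ℕ} (x : (singChains R X).X (n + 1)) :
    ((singChains R X).d (n + 2) (n + 1)).hom (baryHtpy R X (n + 1) x) =
      x - barySubdiv R X (n + 1) x -
        baryHtpy R X n (((singChains R X).d (n + 1) n).hom x) := by
  have : ((singChains R X).d (n + 2) (n + 1)).hom ∘ₗ baryHtpy R X (n + 1) =
      LinearMap.id - barySubdiv R X (n + 1) -
        baryHtpy R X n ∘ₗ ((singChains R X).d (n + 1) n).hom := by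
    refine chain_ext R fun σ => ?_
    simp only [LinearMap.comp_apply, LinearMap.sub_apply, LinearMap.id_apply]
    rw [← pushAffine_vertex, d_pushAffine, baryHtpy_pushAffine, baryHtpy_pushAffine, d_pushAffine,
      barySubdiv_pushAffine, TupleChain.d_subdivHtpy, map_sub, map_sub]
  exact LinearMap.congr_fun this x

lemma d_baryHtpy_zero (x : (singChains R X).X 0) :
    ((singChains R X).d 1 0).hom (baryHtpy R X 0 x) = x - barySubdiv R X 0 x := by
  have : ((singChains R X).d 1 0).hom ∘ₗ baryHtpy R X 0 = LinearMap.id - barySubdiv R X 0 := by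
    refine chain_ext R fun σ => ?_
    simp only [LinearMap.comp_apply, LinearMap.sub_apply, LinearMap.id_apply]
    rw [← pushAffine_vertex, baryHtpy_pushAffine, d_pushAffine, barySubdiv_pushAffine,
      TupleChain.d_subdivHtpy, map_sub, map_sub]
    -- The remaining term is the formal homotopy on empty tuples, which is zero by definition.
    simp [TupleChain.subdivHtpy]
  exact LinearMap.congr_fun this x

lemma d_baryHtpy {n : ℕ} (x : (singChains R X).X n)
    (hx : ∀ m, ((singChains R X).d n m).hom x = 0) :
    ((singChains R X).d (n + 1) n).hom (baryHtpy R X n x) = x - barySubdiv R X n x := by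
  rcases n with _ | n
  · exact d_baryHtpy_zero R x
  · rw [d_baryHtpy_succ, hx, map_zero, sub_zero]

lemma d_barySubdiv_eq_zero {n : ℕ} (x : (singChains R X).X n)
    (hx : ∀ m, ((singChains R X).d n m).hom x = 0) (m : ℕ) :
    ((singChains R X).d n m).hom (barySubdiv R X n x) = 0 := by
  by_cases h : m + 1 = n
  · subst h
    rw [d_barySubdiv, hx, map_zero]
  · rw [(singChains R X).shape n m (by simpa using h)]
    rfl

end Subdivision


/-! ### Subdivision shrinks simplices. -/

section Mesh

/-- Closed balls of the ambient normed space are convex. -/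
lemma affineComb_mem_ballHull {n q : ℕ} (w : Fin (n + 1) → stdSimplex ℝ (Fin (q + 1)))
    (t : stdSimplex ℝ (Fin (n + 1))) : affineComb w t ∈ TupleChain.ballHull w := by
  intro p ρ h
  have := (convex_closedBall p.1 ρ).sum_mem (t := Finset.univ) (w := t.1) (z := fun i => (w i).1)
    (fun i _ => t.2.1 i) t.2.2 (fun i _ => Metric.mem_closedBall.2 (h i))
  exact Metric.mem_closedBall.1 this

/-- The barycenter minus `v j` is the average of the `n + 1` differences `v i - v j`, one of which
is zero; this gives the factor `n / (n + 1)`. Passing to `N` makes the factor the same for all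
faces. -/
lemma dist_tupleBarycenter_le {N n q : ℕ} (hn : n ≤ N)
    (v : Fin (n + 1) → stdSimplex ℝ (Fin (q + 1))) {δ : ℝ} (h : ∀ i j, dist (v i) (v j) ≤ δ) (j) :
    dist (v j) (tupleBarycenter q n v) ≤ N / (N + 1) * δ := by
  have hδ : 0 ≤ δ := dist_nonneg.trans (h j j)
  have h1 : (tupleBarycenter q n v).1 - (v j).1 =
      ∑ i, ((n : ℝ) + 1)⁻¹ • ((v i).1 - (v j).1) := by
    rw [tupleBarycenter, coe_affineComb, ← Finset.smul_sum, Finset.sum_sub_distrib, smul_sub,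
      Finset.smul_sum]
    congr 1
    · refine Finset.sum_congr rfl fun i _ => ?_
      congr 1
      rw [stdSimplex.barycenter_apply, Fintype.card_fin]
      push_cast
      rfl
    · rw [Finset.sum_const, Finset.card_univ, Fintype.card_fin, ← Nat.cast_smul_eq_nsmul ℝ, smul_smul]
      push_cast
      rw [inv_mul_cancel₀ (by positivity), one_smul]
  rw [dist_comm, Subtype.dist_eq, dist_eq_norm, h1]
  refine (norm_sum_le _ _).trans ?_
  rw [Fin.sum_univ_succAbove _ j, sub_self, smul_zero, norm_zero, zero_add]
  have h2 : ∀ i, ‖((n : ℝ) + 1)⁻¹ • ((v (j.succAbove i)).1 - (v j).1)‖ ≤ ((n : ℝ) + 1)⁻¹ * δ := by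
    intro i
    rw [norm_smul, Real.norm_of_nonneg (by positivity), ← dist_eq_norm]
    exact mul_le_mul_of_nonneg_left (h _ _) (by positivity)
  refine (Finset.sum_le_sum fun i _ => h2 i).trans ?_
  rw [Finset.sum_const, Finset.card_univ, Fintype.card_fin, nsmul_eq_mul, ← mul_assoc]
  refine mul_le_mul_of_nonneg_right ?_ hδ
  have hn' : (n : ℝ) ≤ N := by exact_mod_cast hn
  rw [← div_eq_mul_inv, div_le_div_iff₀ (by positivity) (by positivity)]
  nlinarith

lemma dist_stdSimplex_le_one {n : ℕ} (x y : stdSimplex ℝ (Fin (n + 1))) : dist x y ≤ 1 := by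
  rw [Subtype.dist_eq, dist_pi_le_iff zero_le_one]
  intro i
  rw [Real.dist_eq, abs_le]
  have := x.2.1 i
  have := y.2.1 i
  have := stdSimplex.le_one x i
  have := stdSimplex.le_one y i
  constructor
  · change -1 ≤ x i - y i
    have : 0 ≤ x i := x.2.1 i
    linarith
  · change x i - y i ≤ 1
    have : 0 ≤ y i := y.2.1 i
    linarith

end Mesh

/-! ### Small chains compute homology. -/

section SmallChains

open scoped Simplicial

variable (R : Type u) [CommRing R] {X : TopCat.{u}} (A B : Set X)

/-- The chains of `X` supported in the subspace `A`. -/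
def subChains (n : ℕ) : Submodule R ((singChains R X).X n) :=
  LinearMap.range ((singChainsMap R (subIncl A)).f n).hom

/-- The sums of chains in `A` and chains in `B`. -/
def smallChains (n : ℕ) : Submodule R ((singChains R X).X n) := subChains R A n ⊔ subChains R B n

variable {A B}

lemma exists_subIncl_simplex {n : ℕ} (σ : (TopCat.toSSet.obj X) _⦋n⦌)
    (hσ : ∀ t, simplexMap σ t ∈ A) :
    ∃ τ : (TopCat.toSSet.obj (TopCat.of A)) _⦋n⦌, (TopCat.toSSet.map (subIncl A)).app _ τ = σ :=
  ⟨⟨TopCat.ofHom ⟨fun t => ⟨simplexMap σ t, hσ t⟩,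
    (simplexMap σ).hom.continuous.subtype_mk _⟩⟩, rfl⟩

lemma simplexChain_mem_subChains {n : ℕ} (σ : (TopCat.toSSet.obj X) _⦋n⦌)
    (hσ : ∀ t, simplexMap σ t ∈ A) : simplexChain R σ 1 ∈ subChains R A n := by
  obtain ⟨τ, rfl⟩ := exists_subIncl_simplex σ hσ
  exact ⟨simplexChain R τ 1, singChainsMap_simplexChain R _ _ _⟩

lemma smallChains_induction {n : ℕ} {p : (singChains R X).X n → Prop} {x : (singChains R X).X n}
    (hx : x ∈ smallChains R A B n)
    (hA : ∀ a, p (((singChainsMap R (subIncl A)).f n).hom a))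
    (hB : ∀ b, p (((singChainsMap R (subIncl B)).f n).hom b))
    (hadd : ∀ x y, p x → p y → p (x + y)) : p x := by
  obtain ⟨_, ⟨a, rfl⟩, _, ⟨b, rfl⟩, rfl⟩ := Submodule.mem_sup.1 hx
  exact hadd _ _ (hA a) (hB b)

lemma barySubdiv_mem_smallChains {n : ℕ} {x : (singChains R X).X n}
    (hx : x ∈ smallChains R A B n) : barySubdiv R X n x ∈ smallChains R A B n := by
  refine smallChains_induction R (p := fun x => barySubdiv R X n x ∈ smallChains R A B n) hx
    (fun a => ?_) (fun b => ?_) fun x y hx hy => ?_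
  · rw [← map_barySubdiv]
    exact Submodule.mem_sup_left ⟨_, rfl⟩
  · rw [← map_barySubdiv]
    exact Submodule.mem_sup_right ⟨_, rfl⟩
  · rw [map_add]
    exact add_mem hx hy

lemma baryHtpy_mem_smallChains {n : ℕ} {x : (singChains R X).X n}
    (hx : x ∈ smallChains R A B n) : baryHtpy R X n x ∈ smallChains R A B (n + 1) := by
  refine smallChains_induction R
    (p := fun x => baryHtpy R X n x ∈ smallChains R A B (n + 1)) hx (fun a => ?_) (fun b => ?_) fun x y hx hy => ?_
  · rw [← map_baryHtpy]
    exact Submodule.mem_sup_left ⟨_, rfl⟩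
  · rw [← map_baryHtpy]
    exact Submodule.mem_sup_right ⟨_, rfl⟩
  · rw [map_add]
    exact add_mem hx hy

lemma iterate_barySubdiv_mem_smallChains {n : ℕ} {x : (singChains R X).X n} {k l : ℕ}
    (hx : (barySubdiv R X n)^[k] x ∈ smallChains R A B n) (hl : k ≤ l) :
    (barySubdiv R X n)^[l] x ∈ smallChains R A B n := by
  induction l, hl using Nat.le_induction with
  | base => exact hx
  | succ l _ ih =>
    rw [Function.iterate_succ_apply']
    exact barySubdiv_mem_smallChains R ih

lemma iterate_barySubdiv_pushAffine {q : ℕ} (σ : (TopCat.toSSet.obj X) _⦋q⦌) (n k : ℕ) (x) :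
    (barySubdiv R X n)^[k] (pushAffine R σ n x) =
      pushAffine R σ n ((TupleChain.subdiv R (tupleBarycenter q) _)^[k] x) := by
  induction k with
  | zero => rfl
  | succ k ih =>
    rw [Function.iterate_succ_apply', Function.iterate_succ_apply', ih, barySubdiv_pushAffine]

/-- The open cover pulls back to the compact simplex and has a Lebesgue number there. After enough
subdivisions each affine piece lies in a ball of that radius around its first vertex. -/
lemma exists_iterate_simplexChain_mem (h : interior A ∪ interior B = Set.univ) {n : ℕ}
    (σ : (TopCat.toSSet.obj X) _⦋n⦌) :
    ∃ k, (barySubdiv R X n)^[k] (simplexChain R σ 1) ∈ smallChains R A B n := by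
  let f : stdSimplex ℝ (Fin (n + 1)) → X := fun t => simplexMap σ (ULift.up t)
  have hf : Continuous f := (simplexMap σ).hom.continuous.comp continuous_uliftUp
  obtain ⟨δ, hδ, hball⟩ := lebesgue_number_lemma_of_metric (s := Set.univ)
    (c := fun i : Bool => f ⁻¹' (if i then interior A else interior B)) isCompact_univ
    (fun i => by
      cases i
      · exact isOpen_interior.preimage hf
      · exact isOpen_interior.preimage hf)
    (fun t _ => by
      have : f t ∈ interior A ∪ interior B := by rw [h]; trivial
      rw [Set.mem_iUnion]
      rcases this with h | h
      · exact ⟨true, h⟩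
      · exact ⟨false, h⟩)
  have hr : (n : ℝ) / (n + 1) < 1 := by
    rw [div_lt_one (by positivity)]
    linarith
  obtain ⟨k, hk⟩ := exists_pow_lt_of_lt_one hδ hr
  refine ⟨k, ?_⟩
  rw [← pushAffine_vertex, iterate_barySubdiv_pushAffine]
  have hs := TupleChain.subdiv_iterate_mem_supported R (b := tupleBarycenter n) (N := n)
    (r := n / (n + 1)) (by positivity)
    (fun m hm v => ⟨affineComb_mem_ballHull _ _, fun δ hδ j => dist_tupleBarycenter_le hm v hδ j⟩)
    -- The initial diameter is at most `1` in the sup metric; the `n + 1` vertices match the bound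
    -- `N + 1` for `N = n`.
    le_rfl zero_le_one stdSimplex.vertex (fun i j => dist_stdSimplex_le_one _ _) k
  rw [Finsupp.supported_eq_span_single] at hs
  have hs' := Submodule.mem_map_of_mem (f := pushAffine R σ n) hs
  rw [Submodule.map_span] at hs'
  refine Submodule.span_le.2 ?_ hs'
  rintro _ ⟨_, ⟨w, hw, rfl⟩, rfl⟩
  change pushAffine R σ n (TupleChain.of w) ∈ smallChains R A B n
  rw [pushAffine_of]
  obtain ⟨i, hi⟩ := hball (w 0) trivial
  have hmem : ∀ t, simplexMap ((TopCat.toSSet.map (simplexMap σ)).app _ (affineSimplex w)) t ∈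
      (if i then interior A else interior B) := by
    intro t
    refine hi (Metric.mem_ball.2 (lt_of_le_of_lt
      (affineComb_mem_ballHull w t.down (w 0) _ fun j => hw j 0) ?_))
    rwa [mul_one]
  cases i
  · exact Submodule.mem_sup_right (simplexChain_mem_subChains R _
      fun t => interior_subset (hmem t))
  · exact Submodule.mem_sup_left (simplexChain_mem_subChains R _
      fun t => interior_subset (hmem t))

lemma iterate_linearMap_add {M : Type*} [AddCommGroup M] [Module R M] (f : M →ₗ[R] M) (k : ℕ) (x y : M) :
    f^[k] (x + y) = f^[k] x + f^[k] y := by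
  rw [← Module.End.pow_apply, map_add, Module.End.pow_apply, Module.End.pow_apply]

lemma exists_iterate_mem_smallChains (h : interior A ∪ interior B = Set.univ) {n : ℕ}
    (x : (singChains R X).X n) : ∃ k, (barySubdiv R X n)^[k] x ∈ smallChains R A B n := by
  induction (simplexBasis R X n).mem_span x using Submodule.span_induction with
  | mem x hx =>
    obtain ⟨σ, rfl⟩ := hx
    rw [simplexBasis_apply]
    exact exists_iterate_simplexChain_mem R h σ
  | zero => exact ⟨0, zero_mem _⟩
  | add x y _ _ hx hy =>
    obtain ⟨k, hk⟩ := hx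
    obtain ⟨l, hl⟩ := hy
    refine ⟨max k l, ?_⟩
    rw [iterate_linearMap_add]
    exact add_mem (iterate_barySubdiv_mem_smallChains R hk (le_max_left _ _))
      (iterate_barySubdiv_mem_smallChains R hl (le_max_right _ _))
  | smul r x _ hx =>
    obtain ⟨k, hk⟩ := hx
    refine ⟨k, ?_⟩
    rw [← Module.End.pow_apply, map_smul, Module.End.pow_apply]
    exact Submodule.smul_mem _ _ hk

/-- The homotopies of the successive subdivisions add up. By naturality they preserve chains of `A`
and of `B`, which gives the last clause. -/
lemma exists_d_eq_sub_iterate {n : ℕ} (x : (singChains R X).X n)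
    (hx : ∀ m, ((singChains R X).d n m).hom x = 0) (k : ℕ) :
    (∀ m, ((singChains R X).d n m).hom ((barySubdiv R X n)^[k] x) = 0) ∧
    ∃ e, ((singChains R X).d (n + 1) n).hom e = x - (barySubdiv R X n)^[k] x ∧
      (x ∈ smallChains R A B n → e ∈ smallChains R A B (n + 1)) := by
  induction k with
  | zero => exact ⟨hx, 0, by simp, fun _ => zero_mem _⟩
  | succ k ih =>
    obtain ⟨h, e, he, he'⟩ := ih
    rw [Function.iterate_succ_apply']
    refine ⟨d_barySubdiv_eq_zero R _ h, e + baryHtpy R X n ((barySubdiv R X n)^[k] x), ?_, ?_⟩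
    · rw [map_add, he, d_baryHtpy R _ h]
      abel
    · intro hs
      exact add_mem (he' hs) (baryHtpy_mem_smallChains R
        (iterate_barySubdiv_mem_smallChains R (k := 0) hs (Nat.zero_le _)))

lemma d_iterate_barySubdiv {n : ℕ} (x : (singChains R X).X (n + 1)) (k : ℕ) :
    ((singChains R X).d (n + 1) n).hom ((barySubdiv R X (n + 1))^[k] x) =
      (barySubdiv R X n)^[k] (((singChains R X).d (n + 1) n).hom x) := by
  induction k with
  | zero => rfl
  | succ k ih => rw [Function.iterate_succ_apply', Function.iterate_succ_apply', d_barySubdiv, ih]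

/-- Every cycle is homologous to a small cycle. -/
lemma exists_small_cycle (h : interior A ∪ interior B = Set.univ) {n : ℕ}
    (x : (singChains R X).X n) (hx : ∀ m, ((singChains R X).d n m).hom x = 0) :
    ∃ y ∈ smallChains R A B n, (∀ m, ((singChains R X).d n m).hom y = 0) ∧
      ∃ e, ((singChains R X).d (n + 1) n).hom e = x - y := by
  obtain ⟨k, hk⟩ := exists_iterate_mem_smallChains R h x
  obtain ⟨hd, e, he, -⟩ := exists_d_eq_sub_iterate R (A := A) (B := B) x hx k
  exact ⟨_, hk, hd, e, he⟩

/-- A small boundary is the boundary of a small chain. -/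
lemma exists_small_boundary (h : interior A ∪ interior B = Set.univ) {n : ℕ}
    (e : (singChains R X).X (n + 1))
    (he : ((singChains R X).d (n + 1) n).hom e ∈ smallChains R A B n) :
    ∃ e' ∈ smallChains R A B (n + 1),
      ((singChains R X).d (n + 1) n).hom e' = ((singChains R X).d (n + 1) n).hom e := by
  obtain ⟨k, hk⟩ := exists_iterate_mem_smallChains R h e
  obtain ⟨-, e', he', hs⟩ := exists_d_eq_sub_iterate R (A := A) (B := B)
    (((singChains R X).d (n + 1) n).hom e) (fun m => LinearMap.congr_fun (congrArg ModuleCat.Hom.hom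
      ((singChains R X).d_comp_d (n + 1) n m)) e) k
  -- The subdivided `e` is small but has the subdivided boundary; `e'` makes up for the difference
  -- and is small because the boundary of `e` is.
  refine ⟨e' + (barySubdiv R X (n + 1))^[k] e, add_mem (hs he) hk, ?_⟩
  rw [map_add, he', d_iterate_barySubdiv]
  abel

end SmallChains


/-! ### Homology classes in terms of chains. -/

section ChainClass

variable (R : Type u) [CommRing R]

/-- The map of singular chains induced by a continuous map. -/
abbrev chainMap {X Y : TopCat.{u}} (f : X ⟶ Y) (n : ℕ) :
    (singChains R X).X n →ₗ[R] (singChains R Y).X n := ((singChainsMap R f).f n).hom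

/-- The differential of singular chains. -/
abbrev bd (X : TopCat.{u}) (n m : ℕ) : (singChains R X).X n →ₗ[R] (singChains R X).X m :=
  ((singChains R X).d n m).hom

/-- The condition that a chain is a cycle. -/
abbrev IsCycle {X : TopCat.{u}} {n : ℕ} (x : (singChains R X).X n) : Prop := ∀ m, bd R X n m x = 0

variable {R} {X Y Z : TopCat.{u}} {n : ℕ}

lemma bd_chainMap (f : X ⟶ Y) (n m : ℕ) (x : (singChains R X).X n) :
    bd R Y n m (chainMap R f n x) = chainMap R f m (bd R X n m x) :=
  LinearMap.congr_fun (congrArg ModuleCat.Hom.hom ((singChainsMap R f).comm n m)) x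

lemma bd_bd (l m n : ℕ) (x : (singChains R X).X l) : bd R X m n (bd R X l m x) = 0 :=
  LinearMap.congr_fun (congrArg ModuleCat.Hom.hom ((singChains R X).d_comp_d l m n)) x

lemma chainMap_comp (f : X ⟶ Y) (g : Y ⟶ Z) (x : (singChains R X).X n) :
    chainMap R (f ≫ g) n x = chainMap R g n (chainMap R f n x) := by
  have : singChainsMap R (f ≫ g) = singChainsMap R f ≫ singChainsMap R g :=
    Functor.map_comp _ _ _
  rw [chainMap, this]
  rfl

lemma chainMap_congr {Y' : TopCat.{u}} {f : X ⟶ Y} {g : Y ⟶ Z} {f' : X ⟶ Y'} {g' : Y' ⟶ Z}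
    (h : f ≫ g = f' ≫ g') (x : (singChains R X).X n) :
    chainMap R g n (chainMap R f n x) = chainMap R g' n (chainMap R f' n x) := by
  rw [← chainMap_comp, ← chainMap_comp, h]

namespace IsCycle

lemma of_bd_eq_zero {x : (singChains R X).X (n + 1)} (h : bd R X (n + 1) n x = 0) :
    IsCycle R x := by
  intro m
  by_cases hm : m + 1 = n + 1
  · obtain rfl : m = n := by omega
    exact h
  · rw [bd, (singChains R X).shape _ m (by simpa using hm)]
    rfl

lemma sub {x y : (singChains R X).X n} (hx : IsCycle R x) (hy : IsCycle R y) :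
    IsCycle R (x - y) := fun m => by rw [map_sub, hx, hy, sub_zero]

lemma map (f : X ⟶ Y) {x : (singChains R X).X n} (hx : IsCycle R x) :
    IsCycle R (chainMap R f n x) := fun m => by rw [bd_chainMap, hx, map_zero]

end IsCycle

/-- The homology class of a chain that is a cycle. -/
def chainClass (x : (singChains R X).X n) (hx : IsCycle R x) : singH R n X :=
  cycleClass R n X (cycleOf R n X x hx)

lemma cycleClass_eq_chainClass (z : (singChains R X).cycles n) :
    cycleClass R n X z = chainClass (cycleChain R n X z) (fun m => d_cycleChain R n m X z) := by
  rw [chainClass]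
  congr 1
  exact cycleChain_injective R n X (cycleChain_cycleOf R n X _ _).symm

lemma exists_chainClass (z : singH R n X) : ∃ x hx, chainClass (R := R) x hx = z := by
  obtain ⟨c, rfl⟩ := cycleClass_surjective R n X z
  exact ⟨_, _, (cycleClass_eq_chainClass c).symm⟩

lemma chainClass_eq_zero_iff {x : (singChains R X).X n} {hx : IsCycle R x} :
    chainClass x hx = 0 ↔ ∃ e, bd R X (n + 1) n e = x := by
  constructor
  · intro h
    obtain ⟨a, ha⟩ := exists_of_cycleClass_eq_zero R n X _ h
    exact ⟨a, ha.trans (cycleChain_cycleOf R n X _ _)⟩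
  · rintro ⟨e, he⟩
    exact cycleClass_eq_zero R n X _ e (he.trans (cycleChain_cycleOf R n X _ _).symm)

lemma chainClass_sub {x y : (singChains R X).X n} (hx : IsCycle R x) (hy : IsCycle R y) :
    chainClass (x - y) (hx.sub hy) = chainClass x hx - chainClass y hy := by
  rw [chainClass, chainClass, chainClass, ← map_sub]
  congr 1
  apply cycleChain_injective
  rw [map_sub, cycleChain_cycleOf, cycleChain_cycleOf, cycleChain_cycleOf]

lemma chainClass_congr {x y : (singChains R X).X n} {hx : IsCycle R x} (h : x = y) :
    chainClass x hx = chainClass y (h ▸ hx) := by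
  subst h
  rfl

lemma chainClass_eq_iff {x y : (singChains R X).X n} {hx : IsCycle R x} {hy : IsCycle R y} :
    chainClass x hx = chainClass y hy ↔ ∃ e, bd R X (n + 1) n e = x - y := by
  rw [← sub_eq_zero, ← chainClass_sub, chainClass_eq_zero_iff]

lemma singHMap_cycleClass (f : X ⟶ Y) (z : (singChains R X).cycles n) :
    singHMap R n f (cycleClass R n X z) =
      cycleClass R n Y ((HomologicalComplex.cyclesMap (singChainsMap R f) n).hom z) :=
  LinearMap.congr_fun (congrArg ModuleCat.Hom.hom
    (HomologicalComplex.homologyπ_naturality (singChainsMap R f) n)) z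

lemma cycleChain_cyclesMap (f : X ⟶ Y) (z : (singChains R X).cycles n) :
    cycleChain R n Y ((HomologicalComplex.cyclesMap (singChainsMap R f) n).hom z) =
      chainMap R f n (cycleChain R n X z) :=
  LinearMap.congr_fun (congrArg ModuleCat.Hom.hom
    (HomologicalComplex.cyclesMap_i (singChainsMap R f) n)) z

lemma map_chainClass (f : X ⟶ Y) {x : (singChains R X).X n} (hx : IsCycle R x) :
    singHMap R n f (chainClass x hx) = chainClass (chainMap R f n x) (hx.map f) := by
  rw [chainClass, singHMap_cycleClass, cycleClass_eq_chainClass]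
  refine chainClass_congr ?_
  rw [cycleChain_cyclesMap, cycleChain_cycleOf]

lemma singHMap_comp (f : X ⟶ Y) (g : Y ⟶ Z) (x : singH R n X) :
    singHMap R n (f ≫ g) x = singHMap R n g (singHMap R n f x) := by
  obtain ⟨x, hx, rfl⟩ := exists_chainClass x
  rw [map_chainClass, map_chainClass, map_chainClass]
  exact chainClass_congr (chainMap_comp f g x)

lemma singHMap_id (x : singH R n X) : singHMap R n (𝟙 X) x = x := by
  have : ((singularHomologyFunctor (ModuleCat.{u} R) n).obj (ModuleCat.of R R)).map (𝟙 X) = 𝟙 _ :=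
    CategoryTheory.Functor.map_id _ _
  rw [singHMap, this]
  rfl

end ChainClass

/-! ### Chains of subspaces and of their intersection. -/

section SubChains

open scoped Simplicial

variable {R : Type u} [CommRing R] {X Y : TopCat.{u}} {A B : Set X} {n : ℕ}

/-- Composition with an injective map is injective on singular simplices, hence sends one basis
injectively into the other. -/
lemma chainMap_injective (f : X ⟶ Y) (hf : Function.Injective f) :
    Function.Injective (chainMap R f n) := by
  have hinj : Function.Injective (fun σ : (TopCat.toSSet.obj X) _⦋n⦌ =>
      (TopCat.toSSet.map f).app (.op ⦋n⦌) σ) := by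
    intro σ τ h
    have h' : simplexMap σ ≫ f = simplexMap τ ≫ f := congrArg simplexMap h
    refine congrArg ULift.up (show simplexMap σ = simplexMap τ from ?_)
    ext t
    exact hf (congrArg (fun g : topSimplex n ⟶ Y => g t) h')
  have : (simplexBasis R Y n).repr.toLinearMap ∘ₗ chainMap R f n =
      Finsupp.lmapDomain R R (fun σ => (TopCat.toSSet.map f).app (.op ⦋n⦌) σ) ∘ₗ
        (simplexBasis R X n).repr.toLinearMap := by
    refine (simplexBasis R X n).ext fun σ => ?_
    simp only [LinearMap.comp_apply, LinearEquiv.coe_coe, Module.Basis.repr_self]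
    rw [simplexBasis_apply, singChainsMap_simplexChain, ← simplexBasis_apply,
      Module.Basis.repr_self]
    exact Finsupp.mapDomain_single.symm
  intro x y h
  apply (simplexBasis R X n).repr.injective
  apply Finsupp.mapDomain_injective hinj
  exact (LinearMap.congr_fun this x).symm.trans ((congrArg _ h).trans (LinearMap.congr_fun this y))

lemma subIncl_injective : Function.Injective (chainMap R (subIncl A) n) :=
  chainMap_injective _ Subtype.val_injective

lemma inclOfSubset_injective (h : A ⊆ B) : Function.Injective (chainMap R (inclOfSubset h) n) :=
  chainMap_injective _ (Set.inclusion_injective h)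

/-- Membership depends on the support alone, so chains lying in both `A` and `B` lie in `A ∩ B`, for
arbitrary subsets. -/
lemma mem_subChains_iff {x : (singChains R X).X n} : x ∈ subChains R A n ↔
    ↑((simplexBasis R X n).repr x).support ⊆
      {σ : (TopCat.toSSet.obj X) _⦋n⦌ | ∀ t, simplexMap σ t ∈ A} := by
  rw [← Module.Basis.mem_span_image]
  constructor
  · rintro ⟨a, rfl⟩
    induction (simplexBasis R _ n).mem_span a using Submodule.span_induction with
    | mem a ha =>
      obtain ⟨σ, rfl⟩ := ha
      rw [simplexBasis_apply, singChainsMap_simplexChain, ← simplexBasis_apply]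
      exact Submodule.subset_span
        ⟨(TopCat.toSSet.map (subIncl A)).app _ σ, fun t => (simplexMap σ t).2, rfl⟩
    | zero => rw [map_zero]; exact zero_mem _
    | add x y _ _ hx hy => rw [map_add]; exact add_mem hx hy
    | smul r x _ hx => rw [map_smul]; exact Submodule.smul_mem _ _ hx
  · intro h
    refine Submodule.span_le.2 ?_ h
    rintro _ ⟨σ, hσ, rfl⟩
    rw [simplexBasis_apply]
    exact simplexChain_mem_subChains R σ hσ

/-- Chains of `A` and `B` that agree come from chains of `A ∩ B`. -/
lemma exists_inter_chain (a : (singChains R (TopCat.of A)).X n)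
    (b : (singChains R (TopCat.of B)).X n)
    (h : chainMap R (subIncl A) n a = chainMap R (subIncl B) n b) :
    ∃ c, chainMap R (inclOfSubset (Set.inter_subset_left (s := A) (t := B))) n c = a ∧
      chainMap R (inclOfSubset (Set.inter_subset_right (s := A) (t := B))) n c = b := by
  have hA : chainMap R (subIncl A) n a ∈ subChains R A n := ⟨a, rfl⟩
  have hB : chainMap R (subIncl A) n a ∈ subChains R B n := ⟨b, h.symm⟩
  rw [mem_subChains_iff] at hA hB
  obtain ⟨c, hc⟩ : chainMap R (subIncl A) n a ∈ subChains R (A ∩ B) n :=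
    mem_subChains_iff.2 fun σ hσ t => ⟨hA hσ t, hB hσ t⟩
  refine ⟨c, subIncl_injective ?_, subIncl_injective ?_⟩
  · rw [← chainMap_comp]
    exact hc
  · rw [← chainMap_comp, ← h]
    exact hc

end SubChains

/-! ### The Mayer-Vietoris boundary, its exactness and naturality. -/

section MayerVietoris

variable {R : Type u} [CommRing R] {Z : TopCat.{u}} {A B : Set Z} {n : ℕ}

/-- The inclusion of the intersection in the first set. -/
abbrev interLeft (A B : Set Z) : TopCat.of ↥(A ∩ B) ⟶ TopCat.of A :=
  inclOfSubset Set.inter_subset_left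

/-- The inclusion of the intersection in the second set. -/
abbrev interRight (A B : Set Z) : TopCat.of ↥(A ∩ B) ⟶ TopCat.of B :=
  inclOfSubset Set.inter_subset_right

lemma isCycle_of_bd_eq {a : (singChains R (TopCat.of A)).X (n + 1)}
    {b : (singChains R (TopCat.of B)).X (n + 1)}
    {c : (singChains R (TopCat.of ↥(A ∩ B))).X n}
    (ha : bd R _ (n + 1) n a = chainMap R (interLeft A B) n c)
    (hb : bd R _ (n + 1) n b = chainMap R (interRight A B) n c) :
    IsCycle R (chainMap R (subIncl A) (n + 1) a - chainMap R (subIncl B) (n + 1) b) := by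
  refine .of_bd_eq_zero ?_
  rw [map_sub, bd_chainMap, bd_chainMap, ha, hb, sub_eq_zero]
  exact chainMap_congr (by rfl) c

lemma isMayerVietorisBoundary_iff {z : singH R (n + 1) Z} {w : singH R n (TopCat.of ↥(A ∩ B))} :
    IsMayerVietorisBoundary R A B n z w ↔
      ∃ a b c, ∃ (ha : bd R _ (n + 1) n a = chainMap R (interLeft A B) n c)
        (hb : bd R _ (n + 1) n b = chainMap R (interRight A B) n c) (hc : IsCycle R c),
        chainClass _ (isCycle_of_bd_eq ha hb) = z ∧ chainClass c hc = w := by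
  constructor
  · rintro ⟨a, b, s, c, rfl, rfl, hs, ha, hb⟩
    refine ⟨a, b, _, ha, hb, fun m => d_cycleChain R n m _ c, ?_, (cycleClass_eq_chainClass c).symm⟩
    rw [cycleClass_eq_chainClass s]
    exact (chainClass_congr hs).symm
  · rintro ⟨a, b, c, ha, hb, hc, rfl, rfl⟩
    exact ⟨a, b, _, _, rfl, rfl, cycleChain_cycleOf _ _ _ _ _,
      by rw [cycleChain_cycleOf]; exact ha, by rw [cycleChain_cycleOf]; exact hb⟩

lemma IsMayerVietorisBoundary.add {z z' : singH R (n + 1) Z}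
    {w w' : singH R n (TopCat.of ↥(A ∩ B))} (h : IsMayerVietorisBoundary R A B n z w)
    (h' : IsMayerVietorisBoundary R A B n z' w') :
    IsMayerVietorisBoundary R A B n (z + z') (w + w') := by
  obtain ⟨a, b, s, c, rfl, rfl, hs, ha, hb⟩ := h
  obtain ⟨a', b', s', c', rfl, rfl, hs', ha', hb'⟩ := h'
  refine ⟨a + a', b + b', s + s', c + c', map_add _ _ _, map_add _ _ _, ?_, ?_, ?_⟩
  · rw [map_add, hs, hs', map_add, map_add]
    abel
  · simp only [map_add, ha, ha']
  · simp only [map_add, hb, hb']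

lemma IsMayerVietorisBoundary.smul (r : R) {z : singH R (n + 1) Z}
    {w : singH R n (TopCat.of ↥(A ∩ B))} (h : IsMayerVietorisBoundary R A B n z w) :
    IsMayerVietorisBoundary R A B n (r • z) (r • w) := by
  obtain ⟨a, b, s, c, rfl, rfl, hs, ha, hb⟩ := h
  refine ⟨r • a, r • b, r • s, r • c, map_smul _ _ _, map_smul _ _ _, ?_, ?_, ?_⟩
  · rw [map_smul, hs, map_smul, map_smul, smul_sub]
  · simp only [map_smul, ha]
  · simp only [map_smul, hb]

lemma exists_isMayerVietorisBoundary (h : interior A ∪ interior B = Set.univ)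
    (z : singH R (n + 1) Z) : ∃ w, IsMayerVietorisBoundary R A B n z w := by
  obtain ⟨x, hx, rfl⟩ := exists_chainClass z
  obtain ⟨y, hy, hy', e, he⟩ := exists_small_cycle R h x hx
  obtain ⟨_, ⟨a, rfl⟩, _, ⟨b, rfl⟩, rfl⟩ := Submodule.mem_sup.1 hy
  -- A small cycle is a sum `a + b`, while the boundary is defined by differences; hence the sign at
  -- `b`.
  have h0 : chainMap R (subIncl A) n (bd R _ (n + 1) n a) =
      chainMap R (subIncl B) n (bd R _ (n + 1) n (-b)) := by
    have := hy' n
    rw [map_add] at this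
    rw [← bd_chainMap, ← bd_chainMap, map_neg, map_neg]
    exact eq_neg_of_add_eq_zero_left this
  obtain ⟨c, ha, hb⟩ := exists_inter_chain _ _ h0
  have hc : IsCycle R c := fun m => inclOfSubset_injective (R := R) (n := m)
    (Set.inter_subset_left (s := A) (t := B)) (by rw [← bd_chainMap, ha, bd_bd, map_zero])
  refine ⟨chainClass c hc, isMayerVietorisBoundary_iff.2 ⟨a, -b, c, ha.symm, hb.symm, hc, ?_, rfl⟩⟩
  refine (chainClass_eq_iff.2 ⟨e, he.trans ?_⟩).symm
  rw [map_neg, sub_neg_eq_add]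

/-- By linearity this makes the relation single-valued. A small chain bounding `a - b` allows `a`
and `b` to be changed by boundaries until they agree; the common chain then lives in `A ∩ B` and
bounds `c`. -/
lemma IsMayerVietorisBoundary.eq_zero (h : interior A ∪ interior B = Set.univ)
    {w : singH R n (TopCat.of ↥(A ∩ B))} (hw : IsMayerVietorisBoundary R A B n 0 w) : w = 0 := by
  obtain ⟨a, b, c, ha, hb, hc, h0, rfl⟩ := isMayerVietorisBoundary_iff.1 hw
  obtain ⟨e, he⟩ := chainClass_eq_zero_iff.1 h0
  obtain ⟨e', hs, he'⟩ := exists_small_boundary R (A := A) (B := B) h e (by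
    rw [show ((singChains R Z).d (n + 1 + 1) (n + 1)).hom e = _ from he]
    exact sub_mem (Submodule.mem_sup_left ⟨a, rfl⟩) (Submodule.mem_sup_right ⟨b, rfl⟩))
  obtain ⟨_, ⟨α, rfl⟩, _, ⟨β, rfl⟩, rfl⟩ := Submodule.mem_sup.1 hs
  have he'' : chainMap R (subIncl A) (n + 1) (bd R _ (n + 2) (n + 1) α) +
      chainMap R (subIncl B) (n + 1) (bd R _ (n + 2) (n + 1) β) =
        chainMap R (subIncl A) (n + 1) a - chainMap R (subIncl B) (n + 1) b := by
    rw [← bd_chainMap, ← bd_chainMap, ← map_add]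
    exact he'.trans he
  have h1 : chainMap R (subIncl A) (n + 1) (a - bd R _ (n + 2) (n + 1) α) =
      chainMap R (subIncl B) (n + 1) (b + bd R _ (n + 2) (n + 1) β) := by
    rw [map_sub, map_add, sub_eq_iff_eq_add.1 he''.symm]
    abel
  obtain ⟨c', hc', -⟩ := exists_inter_chain _ _ h1
  refine chainClass_eq_zero_iff.2 ⟨c', inclOfSubset_injective (R := R) (n := n)
    (Set.inter_subset_left (s := A) (t := B)) ?_⟩
  rw [← bd_chainMap, hc', map_sub, bd_bd, sub_zero, ha]

/-- The Mayer-Vietoris boundary. -/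
def mvBoundary (h : interior A ∪ interior B = Set.univ) (n : ℕ) :
    singH R (n + 1) Z →ₗ[R] singH R n (TopCat.of ↥(A ∩ B)) :=
  have key : ∀ {z : singH R (n + 1) Z} {w w' : singH R n (TopCat.of ↥(A ∩ B))},
      IsMayerVietorisBoundary R A B n z w → IsMayerVietorisBoundary R A B n z w' → w = w' :=
    fun hw hw' => by
      have := hw.add (hw'.smul (-1))
      rw [neg_one_smul, neg_one_smul, add_neg_cancel, ← sub_eq_add_neg] at this
      exact sub_eq_zero.1 (this.eq_zero h)
  { toFun z := (exists_isMayerVietorisBoundary h z).choose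
    map_add' z z' := key (exists_isMayerVietorisBoundary h _).choose_spec
      ((exists_isMayerVietorisBoundary h z).choose_spec.add
        (exists_isMayerVietorisBoundary h z').choose_spec)
    map_smul' r z := key (exists_isMayerVietorisBoundary h _).choose_spec
      ((exists_isMayerVietorisBoundary h z).choose_spec.smul r) }

lemma isMayerVietorisBoundary_mvBoundary (h : interior A ∪ interior B = Set.univ)
    (z : singH R (n + 1) Z) : IsMayerVietorisBoundary R A B n z (mvBoundary h n z) :=
  (exists_isMayerVietorisBoundary h z).choose_spec

lemma isMayerVietorisBoundary_iff_eq (h : interior A ∪ interior B = Set.univ)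
    {z : singH R (n + 1) Z} {w : singH R n (TopCat.of ↥(A ∩ B))} :
    IsMayerVietorisBoundary R A B n z w ↔ mvBoundary h n z = w := by
  constructor
  · intro hw
    have := (isMayerVietorisBoundary_mvBoundary h z).add (hw.smul (-1))
    rw [neg_one_smul, neg_one_smul, add_neg_cancel, ← sub_eq_add_neg] at this
    exact sub_eq_zero.1 (this.eq_zero h)
  · rintro rfl
    exact isMayerVietorisBoundary_mvBoundary h z

/-- If `c` is the boundary of `e` in `A ∩ B`, subtracting `e` from both `a` and `b` makes them
cycles and leaves their difference unchanged. -/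
lemma exists_of_mvBoundary_eq_zero (h : interior A ∪ interior B = Set.univ)
    {z : singH R (n + 1) Z} (hz : mvBoundary h n z = 0) :
    ∃ a b, z = singHMap R (n + 1) (subIncl A) a - singHMap R (n + 1) (subIncl B) b := by
  obtain ⟨a, b, c, ha, hb, hc, rfl, h0⟩ :=
    isMayerVietorisBoundary_iff.1 ((isMayerVietorisBoundary_iff_eq h).2 hz)
  obtain ⟨e, rfl⟩ := chainClass_eq_zero_iff.1 h0
  have hA : IsCycle R (a - chainMap R (interLeft A B) (n + 1) e) := .of_bd_eq_zero (by
    rw [map_sub, ha, bd_chainMap, sub_self])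
  have hB : IsCycle R (b - chainMap R (interRight A B) (n + 1) e) := .of_bd_eq_zero (by
    rw [map_sub, hb, bd_chainMap, sub_self])
  refine ⟨chainClass _ hA, chainClass _ hB, ?_⟩
  rw [map_chainClass, map_chainClass, ← chainClass_sub]
  refine chainClass_congr ?_
  have : chainMap R (subIncl A) (n + 1) (chainMap R (interLeft A B) (n + 1) e) =
      chainMap R (subIncl B) (n + 1) (chainMap R (interRight A B) (n + 1) e) :=
    chainMap_congr (by rfl) e
  rw [map_sub, map_sub, this]
  abel

lemma mvBoundary_mem_ker (h : interior A ∪ interior B = Set.univ) (z : singH R (n + 1) Z) :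
    singHMap R n (interLeft A B) (mvBoundary h n z) = 0 ∧
      singHMap R n (interRight A B) (mvBoundary h n z) = 0 := by
  obtain ⟨a, b, c, ha, hb, hc, -, h0⟩ :=
    isMayerVietorisBoundary_iff.1 (isMayerVietorisBoundary_mvBoundary h z)
  rw [← h0, map_chainClass, map_chainClass]
  exact ⟨chainClass_eq_zero_iff.2 ⟨a, ha⟩, chainClass_eq_zero_iff.2 ⟨b, hb⟩⟩

lemma exists_mvBoundary_eq (h : interior A ∪ interior B = Set.univ)
    {w : singH R n (TopCat.of ↥(A ∩ B))} (hA : singHMap R n (interLeft A B) w = 0)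
    (hB : singHMap R n (interRight A B) w = 0) : ∃ z, mvBoundary h n z = w := by
  obtain ⟨c, hc, rfl⟩ := exists_chainClass w
  rw [map_chainClass] at hA hB
  obtain ⟨a, ha⟩ := chainClass_eq_zero_iff.1 hA
  obtain ⟨b, hb⟩ := chainClass_eq_zero_iff.1 hB
  exact ⟨_, (isMayerVietorisBoundary_iff_eq h).1
    (isMayerVietorisBoundary_iff.2 ⟨a, b, c, ha, hb, hc, rfl, rfl⟩)⟩

/-- The restriction of a continuous map to subspaces. -/
def restrictMap {Z' : TopCat.{u}} (F : Z ⟶ Z') {A : Set Z} {A' : Set Z'} (h : ∀ x ∈ A, F x ∈ A') :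
    TopCat.of A ⟶ TopCat.of A' :=
  TopCat.ofHom ⟨Set.MapsTo.restrict F A A' h, F.hom.continuous.restrict h⟩

lemma mvBoundary_map (h : interior A ∪ interior B = Set.univ) {Z' : TopCat.{u}} {A' B' : Set Z'}
    (h' : interior A' ∪ interior B' = Set.univ) (F : Z ⟶ Z') (hA : ∀ x ∈ A, F x ∈ A')
    (hB : ∀ x ∈ B, F x ∈ B') (z : singH R (n + 1) Z) :
    mvBoundary h' n (singHMap R (n + 1) F z) =
      singHMap R n (restrictMap F (A := A ∩ B) (A' := A' ∩ B') fun x hx =>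
        ⟨hA x hx.1, hB x hx.2⟩) (mvBoundary h n z) := by
  obtain ⟨a, b, c, ha, hb, hc, h1, h2⟩ :=
    isMayerVietorisBoundary_iff.1 (isMayerVietorisBoundary_mvBoundary h z)
  rw [← h2, map_chainClass]
  refine (isMayerVietorisBoundary_iff_eq h').1 (isMayerVietorisBoundary_iff.2
    ⟨chainMap R (restrictMap F hA) _ a, chainMap R (restrictMap F hB) _ b, _, ?_, ?_, hc.map _, ?_,
      rfl⟩)
  · rw [bd_chainMap, ha]
    exact chainMap_congr (by rfl) c
  · rw [bd_chainMap, hb]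
    exact chainMap_congr (by rfl) c
  · rw [← h1, map_chainClass]
    refine chainClass_congr ?_
    rw [map_sub]
    exact congrArg₂ _ (chainMap_congr (by rfl) a) (chainMap_congr (by rfl) b)

end MayerVietoris


/-! ### Homotopy invariance, constant maps and empty spaces. -/

section HomotopyInvariance

variable (R : Type u) [CommRing R] {X Y : TopCat.{u}} (n : ℕ)

lemma homotopic_of_continuous {f g : X ⟶ Y} (H : unitInterval × X → Y) (hH : Continuous H)
    (h0 : ∀ x, H (0, x) = f x) (h1 : ∀ x, H (1, x) = g x) :
    ContinuousMap.Homotopic f.hom g.hom :=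
  ⟨{ toFun := H, continuous_toFun := hH, map_zero_left := h0, map_one_left := h1 }⟩

lemma singHMap_eq_of_homotopic {f g : X ⟶ Y} (h : ContinuousMap.Homotopic f.hom g.hom) :
    singHMap R n f = singHMap R n g := by
  obtain ⟨H⟩ := h
  exact congrArg ModuleCat.Hom.hom
    (TopCat.Homotopy.congr_homologyMap_singularChainComplexFunctor (f := f) (g := g) H
      (ModuleCat.of R R) n)

/-- A constant map factors through a point, which has no homology in positive degrees. -/
lemma singHMap_constMap (y : Y) (x : singH R (n + 1) X) :
    singHMap R (n + 1) (constMap X y) x = 0 := by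
  let p : TopCat.{u} := TopCat.of PUnit.{u + 1}
  let f : X ⟶ p := TopCat.ofHom ⟨fun _ => PUnit.unit, continuous_const⟩
  let g : p ⟶ Y := TopCat.ofHom ⟨fun _ => y, continuous_const⟩
  have h0 : Limits.IsZero (singH R (n + 1) p) :=
    isZero_singularHomologyFunctor_of_totallyDisconnectedSpace _ _ _ _ (Nat.succ_ne_zero n)
  have : Subsingleton (singH R (n + 1) p) := ModuleCat.subsingleton_of_isZero h0
  change singHMap R (n + 1) (f ≫ g) x = 0
  rw [singHMap_comp, Subsingleton.elim (singHMap R (n + 1) f x) 0, map_zero]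

lemma subsingleton_singH_of_isEmpty [IsEmpty X] : Subsingleton (singH R n X) := by
  have : IsEmpty ((TopCat.toSSet.obj X).obj (.op (.mk n))) :=
    ⟨fun σ => IsEmpty.false (simplexMap (q := n) σ (Nonempty.some inferInstance))⟩
  have : Subsingleton ((singChains R X).X n) := (simplexBasis R X n).repr.toEquiv.subsingleton
  refine ⟨fun a b => ?_⟩
  obtain ⟨x, hx, rfl⟩ := exists_chainClass a
  obtain ⟨y, hy, rfl⟩ := exists_chainClass b
  exact chainClass_congr (Subsingleton.elim x y)

end HomotopyInvariance

/-! ### The kernel of the map to the cone is reduced homology. -/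

section Cone

variable (R : Type u) [CommRing R] (X : TopCat.{u}) (n : ℕ)

/-- A constant map of `X` factors through the base inclusion of the cone. Conversely the base
inclusion contracts to the apex, so up to homotopy it factors through the constant map. In this form
the kernel is the image of a projection. -/
lemma mem_kerCone_iff (x₀ : X) (x : singH R n X) :
    x ∈ kerCone R X n ↔ singHMap R n (constMap X x₀) x = 0 := by
  constructor
  · intro hx
    change singHMap R n (coneIncl X ≫ constMap (topCone X) x₀) x = 0
    rw [singHMap_comp, show singHMap R n (coneIncl X) x = 0 from hx, map_zero]
  · intro hx
    change singHMap R n (coneIncl X) x = 0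
    let c : topCone X := Quot.mk _ (x₀, 0)
    have h : ContinuousMap.Homotopic (coneIncl X).hom (constMap X x₀ ≫ constMap X c).hom :=
      ⟨{ toFun p := Quot.mk _ (p.2, unitInterval.symm p.1)
         continuous_toFun := continuous_quot_mk.comp (by fun_prop)
         map_zero_left x := by
          change Quot.mk _ (x, unitInterval.symm 0) = _
          rw [unitInterval.symm_zero]
          rfl
         map_one_left x := by
          change Quot.mk _ (x, unitInterval.symm 1) = _
          rw [unitInterval.symm_one]
          exact Quot.sound (ConeRel.zero _ _) }⟩
    rw [singHMap_eq_of_homotopic R n h, singHMap_comp, hx, map_zero]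

end Cone

/-! ### Coordinates and deformations in the join. -/

section JoinTopology

open scoped unitInterval

variable {X Y : TopCat.{u}}

/-- The point `[x, y, t]` of the join. -/
abbrev joinMk (p : X × Y × I) : topJoin X Y := Quot.mk _ p

/-- The parameter `t` of the point `[x, y, t]`. -/
def joinParam (j : topJoin X Y) : I :=
  Quot.lift (fun p : X × Y × I => p.2.2) (by rintro _ _ (_ | _) <;> rfl) j

lemma joinParam_mk (p : X × Y × I) : joinParam (joinMk p) = p.2.2 := rfl

lemma continuous_joinParam : Continuous (joinParam (X := X) (Y := Y)) :=
  continuous_quot_lift _ (by fun_prop)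

lemma mem_joinLower_iff {j : topJoin X Y} : j ∈ joinLower X Y ↔ (joinParam j : ℝ) ≤ 3 / 4 := by
  constructor
  · rintro ⟨p, hp, rfl⟩
    exact hp
  · induction j using Quot.ind
    exact fun h => ⟨_, h, rfl⟩

lemma mem_joinUpper_iff {j : topJoin X Y} : j ∈ joinUpper X Y ↔ 1 / 4 ≤ (joinParam j : ℝ) := by
  constructor
  · rintro ⟨p, hp, rfl⟩
    exact hp
  · induction j using Quot.ind
    exact fun h => ⟨_, h, rfl⟩

variable (X Y) in
lemma interior_joinLower_union_joinUpper :
    interior (joinLower X Y) ∪ interior (joinUpper X Y) = Set.univ := by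
  have hc : Continuous fun j : topJoin X Y => (joinParam j : ℝ) :=
    continuous_subtype_val.comp continuous_joinParam
  have h1 : {j : topJoin X Y | (joinParam j : ℝ) < 3 / 4} ⊆ interior (joinLower X Y) :=
    interior_maximal (fun j hj => mem_joinLower_iff.2 (le_of_lt hj))
      (isOpen_lt hc continuous_const)
  have h2 : {j : topJoin X Y | 1 / 4 < (joinParam j : ℝ)} ⊆ interior (joinUpper X Y) :=
    interior_maximal (fun j hj => mem_joinUpper_iff.2 (le_of_lt hj))
      (isOpen_lt continuous_const hc)
  refine Set.eq_univ_of_forall fun j => ?_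
  rcases lt_or_ge (joinParam j : ℝ) (3 / 4) with h | h
  · exact Or.inl (h1 h)
  · exact Or.inr (h2 (show (1 / 4 : ℝ) < joinParam j by linarith))

open scoped Classical in
/-- The coordinate `x` of the point `[x, y, t]`, for `t ≠ 0`. -/
def joinFst (x₀ : X) (j : topJoin X Y) : X :=
  Quot.lift (fun p : X × Y × I => if p.2.2 = 0 then x₀ else p.1)
    (by rintro _ _ (_ | _) <;> simp) j

open scoped Classical in
/-- The coordinate `y` of the point `[x, y, t]`, for `t ≠ 1`. -/
def joinSnd (y₀ : Y) (j : topJoin X Y) : Y :=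
  Quot.lift (fun p : X × Y × I => if p.2.2 = 1 then y₀ else p.2.1)
    (by rintro _ _ (_ | _) <;> simp) j

lemma joinFst_mk (x₀ : X) {p : X × Y × I} (hp : p.2.2 ≠ 0) : joinFst x₀ (joinMk p) = p.1 :=
  if_neg hp

lemma joinSnd_mk (y₀ : Y) {p : X × Y × I} (hp : p.2.2 ≠ 1) : joinSnd y₀ (joinMk p) = p.2.1 :=
  if_neg hp

/-- Over the open set `t ≠ 0` continuity can be tested on `X × Y × [0, 1]`, where the function is
the first coordinate; the default value `x₀` occurs only at `t = 0`. -/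
lemma continuousOn_joinFst (x₀ : X) :
    ContinuousOn (joinFst (Y := Y) x₀) {j | joinParam j ≠ 0} := by
  have ho : IsOpen {j : topJoin X Y | joinParam j ≠ 0} :=
    isOpen_ne.preimage continuous_joinParam
  rw [isQuotientMap_quot_mk.continuousOn_isOpen_iff ho]
  exact continuous_fst.continuousOn.congr fun p hp => joinFst_mk x₀ hp

lemma continuousOn_joinSnd (y₀ : Y) :
    ContinuousOn (joinSnd (X := X) y₀) {j | joinParam j ≠ 1} := by
  have ho : IsOpen {j : topJoin X Y | joinParam j ≠ 1} :=
    isOpen_ne.preimage continuous_joinParam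
  rw [isQuotientMap_quot_mk.continuousOn_isOpen_iff ho]
  exact (continuous_fst.comp continuous_snd).continuousOn.congr fun p hp => joinSnd_mk y₀ hp

lemma joinParam_ne_one {j : topJoin X Y} (h : j ∈ joinLower X Y) : joinParam j ≠ 1 := by
  rw [mem_joinLower_iff] at h
  intro h'
  rw [h'] at h
  norm_num at h

lemma joinParam_ne_zero {j : topJoin X Y} (h : j ∈ joinUpper X Y) : joinParam j ≠ 0 := by
  rw [mem_joinUpper_iff] at h
  intro h'
  rw [h'] at h
  norm_num at h

lemma joinMk_eq (x₀ : X) (y₀ : Y) {j : topJoin X Y} (hA : j ∈ joinLower X Y)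
    (hB : j ∈ joinUpper X Y) : joinMk (joinFst x₀ j, joinSnd y₀ j, joinParam j) = j := by
  have h1 := joinParam_ne_one hA
  have h2 := joinParam_ne_zero hB
  induction j using Quot.ind with
  | mk p =>
    rw [joinFst_mk x₀ (p := p) h2, joinSnd_mk y₀ (p := p) h1]
    rfl

/-- The projection of the lower part of the join to `Y`. -/
def lowerProj (y₀ : Y) : TopCat.of (joinLower X Y) ⟶ Y :=
  TopCat.ofHom ⟨fun j => joinSnd y₀ j.1, (continuousOn_joinSnd y₀).comp_continuous
    continuous_subtype_val fun j => joinParam_ne_one j.2⟩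

/-- The projection of the upper part of the join to `X`. -/
def upperProj (x₀ : X) : TopCat.of (joinUpper X Y) ⟶ X :=
  TopCat.ofHom ⟨fun j => joinFst x₀ j.1, (continuousOn_joinFst x₀).comp_continuous
    continuous_subtype_val fun j => joinParam_ne_zero j.2⟩

/-- The projection of the middle part of the join to `X × Y`. -/
def midProj (x₀ : X) (y₀ : Y) :
    TopCat.of ↥(joinLower X Y ∩ joinUpper X Y) ⟶ TopCat.of (X × Y) :=
  TopCat.ofHom ⟨fun j => (joinFst x₀ j.1, joinSnd y₀ j.1),
    ((continuousOn_joinFst x₀).comp_continuous continuous_subtype_val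
      fun j => joinParam_ne_zero j.2.2).prodMk
    ((continuousOn_joinSnd y₀).comp_continuous continuous_subtype_val
      fun j => joinParam_ne_one j.2.1)⟩

/-- The point `1/2` of the unit interval. -/
abbrev unitHalf : I := ⟨1 / 2, by norm_num, by norm_num⟩

lemma unitHalf_ne_zero : unitHalf ≠ 0 := by
  intro h
  have := congrArg Subtype.val h
  norm_num at this

lemma unitHalf_ne_one : unitHalf ≠ 1 := by
  intro h
  have := congrArg Subtype.val h
  norm_num at this

lemma joinMid_midProj (x₀ : X) (y₀ : Y) : joinMid X Y ≫ midProj x₀ y₀ = 𝟙 _ := by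
  ext p
  · exact joinFst_mk x₀ (p := (p.1, p.2, unitHalf)) unitHalf_ne_zero
  · exact joinSnd_mk y₀ (p := (p.1, p.2, unitHalf)) unitHalf_ne_one

lemma joinMid_lowerProj (y₀ : Y) :
    joinMid X Y ≫ interLeft _ _ ≫ lowerProj y₀ = topSnd X Y := by
  ext p
  exact joinSnd_mk y₀ (p := (p.1, p.2, unitHalf)) unitHalf_ne_one

lemma joinMid_upperProj (x₀ : X) :
    joinMid X Y ≫ interRight _ _ ≫ upperProj x₀ = topFst X Y := by
  ext p
  exact joinFst_mk x₀ (p := (p.1, p.2, unitHalf)) unitHalf_ne_zero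

/-- The point `(1 - s) t + s t'` of the unit interval. -/
def unitLine (t t' s : I) : I :=
  ⟨(1 - s) * t + s * t', convex_Icc (0 : ℝ) 1 t.2 t'.2 (sub_nonneg.2 s.2.2) s.2.1 (by ring)⟩

lemma continuous_unitLine : Continuous fun p : I × I × I => unitLine p.1 p.2.1 p.2.2 :=
  Continuous.subtype_mk (by fun_prop) _

lemma unitLine_zero (t t' : I) : unitLine t t' 0 = t := Subtype.ext (by simp [unitLine])

lemma unitLine_one (t t' : I) : unitLine t t' 1 = t' := Subtype.ext (by simp [unitLine])

lemma unitLine_le {t t' s : I} {c : ℝ} (h : (t : ℝ) ≤ c) (h' : (t' : ℝ) ≤ c) :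
    (unitLine t t' s : ℝ) ≤ c :=
  convex_Iic c h h' (sub_nonneg.2 s.2.2) s.2.1 (by ring)

lemma le_unitLine {t t' s : I} {c : ℝ} (h : c ≤ (t : ℝ)) (h' : c ≤ (t' : ℝ)) :
    c ≤ (unitLine t t' s : ℝ) :=
  convex_Ici c h h' (sub_nonneg.2 s.2.2) s.2.1 (by ring)

/-- The parameter moves linearly from `1/2` to its own value and stays between `1/4` and `3/4` by
convexity. -/
lemma midProj_joinMid (x₀ : X) (y₀ : Y) :
    ContinuousMap.Homotopic (midProj x₀ y₀ ≫ joinMid X Y).hom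
      (𝟙 (TopCat.of ↥(joinLower X Y ∩ joinUpper X Y)) : _ ⟶ _).hom := by
  refine homotopic_of_continuous (fun p => ⟨joinMk ((midProj x₀ y₀ p.2).1, (midProj x₀ y₀ p.2).2,
    unitLine unitHalf (joinParam p.2.1) p.1), ?_, ?_⟩) ?_ ?_ ?_
  · exact mem_joinLower_iff.2 (unitLine_le (by norm_num) (mem_joinLower_iff.1 p.2.2.1))
  · exact mem_joinUpper_iff.2 (le_unitLine (by norm_num) (mem_joinUpper_iff.1 p.2.2.2))
  · refine Continuous.subtype_mk (continuous_quot_mk.comp ?_) _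
    have h1 : Continuous fun p : I × TopCat.of ↥(joinLower X Y ∩ joinUpper X Y) =>
        midProj x₀ y₀ p.2 := (midProj x₀ y₀).hom.continuous.comp continuous_snd
    have h2 : Continuous fun p : I × TopCat.of ↥(joinLower X Y ∩ joinUpper X Y) =>
        unitLine unitHalf (joinParam p.2.1) p.1 :=
      continuous_unitLine.comp (continuous_const.prodMk ((continuous_joinParam.comp
        (continuous_subtype_val.comp continuous_snd)).prodMk continuous_fst))
    exact (continuous_fst.comp h1).prodMk ((continuous_snd.comp h1).prodMk h2)
  · intro j
    refine Subtype.ext ?_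
    change joinMk (_, _, unitLine unitHalf _ 0) = _
    rw [unitLine_zero]
    rfl
  · intro j
    refine Subtype.ext ?_
    change joinMk (_, _, unitLine unitHalf _ 1) = _
    rw [unitLine_one]
    exact joinMk_eq x₀ y₀ j.2.1 j.2.2

/-- The section `y ↦ [x₀, y, 0]` of the lower part. -/
def lowerSection (x₀ : X) : Y ⟶ TopCat.of (joinLower X Y) :=
  TopCat.ofHom ⟨fun y => ⟨joinMk (x₀, y, 0), mem_joinLower_iff.2 (by
    rw [joinParam_mk]; norm_num)⟩, (continuous_quot_mk.comp (by fun_prop)).subtype_mk _⟩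

/-- The section `x ↦ [x, y₀, 1]` of the upper part. -/
def upperSection (y₀ : Y) : X ⟶ TopCat.of (joinUpper X Y) :=
  TopCat.ofHom ⟨fun x => ⟨joinMk (x, y₀, 1), mem_joinUpper_iff.2 (by
    rw [joinParam_mk]; norm_num)⟩, (continuous_quot_mk.comp (by fun_prop)).subtype_mk _⟩

/-- Lowering `t` from `1/2` to `0` stays in the lower part, and at `t = 0` the coordinate `x` may be
replaced by `x₀`. -/
lemma joinMid_interLeft (x₀ : X) :
    ContinuousMap.Homotopic (joinMid X Y ≫ interLeft _ _).hom
      (topSnd X Y ≫ lowerSection x₀).hom := by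
  refine homotopic_of_continuous
    (fun p => ⟨joinMk (p.2.1, p.2.2, unitLine unitHalf 0 p.1), ?_⟩) ?_ ?_ ?_
  · exact mem_joinLower_iff.2 (unitLine_le (by norm_num) (by norm_num))
  · refine Continuous.subtype_mk (continuous_quot_mk.comp ?_) _
    have h2 : Continuous fun p : I × (TopCat.of (X × Y)) => unitLine unitHalf 0 p.1 :=
      continuous_unitLine.comp (continuous_const.prodMk (continuous_const.prodMk continuous_fst))
    exact (continuous_fst.comp continuous_snd).prodMk ((continuous_snd.comp continuous_snd).prodMk h2)
  · intro p
    refine Subtype.ext ?_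
    change joinMk (_, _, unitLine unitHalf _ 0) = _
    rw [unitLine_zero]
    rfl
  · intro p
    refine Subtype.ext ?_
    change joinMk (_, _, unitLine unitHalf _ 1) = _
    rw [unitLine_one]
    exact Quot.sound (JoinRel.zero _ _ _)

lemma joinMid_interRight (y₀ : Y) :
    ContinuousMap.Homotopic (joinMid X Y ≫ interRight _ _).hom
      (topFst X Y ≫ upperSection y₀).hom := by
  refine homotopic_of_continuous
    (fun p => ⟨joinMk (p.2.1, p.2.2, unitLine unitHalf 1 p.1), ?_⟩) ?_ ?_ ?_
  · exact mem_joinUpper_iff.2 (le_unitLine (by norm_num) (by norm_num))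
  · refine Continuous.subtype_mk (continuous_quot_mk.comp ?_) _
    have h2 : Continuous fun p : I × (TopCat.of (X × Y)) => unitLine unitHalf 1 p.1 :=
      continuous_unitLine.comp (continuous_const.prodMk (continuous_const.prodMk continuous_fst))
    exact (continuous_fst.comp continuous_snd).prodMk ((continuous_snd.comp continuous_snd).prodMk h2)
  · intro p
    refine Subtype.ext ?_
    change joinMk (_, _, unitLine unitHalf _ 0) = _
    rw [unitLine_zero]
    rfl
  · intro p
    refine Subtype.ext ?_
    change joinMk (_, _, unitLine unitHalf _ 1) = _
    rw [unitLine_one]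
    exact Quot.sound (JoinRel.one _ _ _)

/-- The map `([x, y, t], s) ↦ [x, y, φ (t, s)]`. -/
def joinReparam (φ : I × I → I) (h0 : ∀ s, φ (0, s) = 0) (h1 : ∀ s, φ (1, s) = 1)
    (p : topJoin X Y × I) : topJoin X Y :=
  Quot.map (ra := JoinRel X Y) (rb := JoinRel X Y)
    (fun w : X × Y × I => (w.1, w.2.1, φ (w.2.2, p.2)))
    (by
      rintro _ _ (⟨x, x', y⟩ | ⟨x, y, y'⟩)
      · simp only [h0]; exact JoinRel.zero _ _ _
      · simp only [h1]; exact JoinRel.one _ _ _) p.1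

lemma continuous_joinReparam {φ : I × I → I} (hφ : Continuous φ) (h0 : ∀ s, φ (0, s) = 0)
    (h1 : ∀ s, φ (1, s) = 1) : Continuous (joinReparam (X := X) (Y := Y) φ h0 h1) := by
  -- The interval is locally compact, so its product with the quotient map is again a quotient map.
  refine isQuotientMap_quot_mk.continuous_lift_prod_left ?_
  change Continuous fun p : (X × Y × I) × I => joinMk (p.1.1, p.1.2.1, φ (p.1.2.2, p.2))
  exact continuous_quot_mk.comp (by fun_prop)

lemma subIncl_joinLower_homotopic (x₀ : X) (y₀ : Y) :
    ContinuousMap.Homotopic (subIncl (joinLower X Y)).hom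
      (constMap (TopCat.of (joinLower X Y)) (joinMk (x₀, y₀, 1) : topJoin X Y)).hom := by
  -- The term `(1 - s) t` lowers `t` to `0`. The term `4 t - 3` keeps `t = 1` fixed, as descent to
  -- the join requires; it is at most `t`, so the motion starts at the identity, and at most `0` for
  -- `t ≤ 3/4`, so the lower part ends at `t = 0`.
  let φ : I × I → I := fun p =>
    ⟨max ((1 - p.2) * p.1) (4 * p.1 - 3), le_max_of_le_left (mul_nonneg (sub_nonneg.2 p.2.2.2) p.1.2.1),
      max_le (mul_le_one₀ (by linarith [p.2.2.1]) p.1.2.1 p.1.2.2) (by linarith [p.1.2.2])⟩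
  have hφ : Continuous φ := Continuous.subtype_mk (by fun_prop) _
  have h0 : ∀ s, φ (0, s) = 0 := fun s => Subtype.ext (by simp [φ])
  have h1 : ∀ s, φ (1, s) = 1 := fun s => Subtype.ext (by
    have := s.2.1
    simp only [φ, Set.Icc.coe_one, mul_one]
    rw [max_eq_right] <;> linarith)
  have H1 : ContinuousMap.Homotopic (subIncl (joinLower X Y)).hom
      (lowerProj y₀ ≫ lowerSection x₀ ≫ subIncl _).hom := by
    refine homotopic_of_continuous (fun p => joinReparam φ h0 h1 (p.2.1, p.1))
      ((continuous_joinReparam hφ h0 h1).comp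
        ((continuous_subtype_val.comp continuous_snd).prodMk continuous_fst)) ?_ ?_
    · rintro ⟨j, hj⟩
      induction j using Quot.ind with
      | mk p =>
        change joinMk (p.1, p.2.1, φ (p.2.2, 0)) = joinMk p
        have : φ (p.2.2, 0) = p.2.2 := Subtype.ext (by
          have := p.2.2.2.2
          simp only [φ, Set.Icc.coe_zero]
          rw [max_eq_left] <;> linarith)
        rw [this]
    · rintro ⟨j, hj⟩
      have h := joinParam_ne_one hj
      rw [mem_joinLower_iff] at hj
      induction j using Quot.ind with
      | mk p =>
        change joinMk (p.1, p.2.1, φ (p.2.2, 1)) = joinMk (x₀, joinSnd y₀ (joinMk p), 0)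
        rw [joinSnd_mk y₀ (p := p) h]
        have : φ (p.2.2, 1) = 0 := Subtype.ext (by
          have h' : (p.2.2 : ℝ) ≤ 3 / 4 := hj
          simp only [φ, Set.Icc.coe_one, Set.Icc.coe_zero]
          rw [max_eq_left] <;> linarith)
        rw [this]
        exact Quot.sound (JoinRel.zero _ _ _)
  -- Moving `t` from `0` to `1` along the fixed `x₀` ends where `y` no longer matters. This leaves
  -- the lower part but stays in the join.
  have H2 : ContinuousMap.Homotopic (lowerSection x₀ ≫ subIncl (joinLower X Y)).hom
      (constMap Y (joinMk (x₀, y₀, 1) : topJoin X Y)).hom :=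
    ⟨{ toFun := fun p => joinMk (x₀, p.2, p.1)
       continuous_toFun := continuous_quot_mk.comp (by fun_prop)
       map_zero_left := fun _ => rfl
       map_one_left := fun _ => Quot.sound (JoinRel.one _ _ _) }⟩
  exact H1.trans (H2.comp (.refl (lowerProj y₀).hom))

lemma subIncl_joinUpper_homotopic (x₀ : X) (y₀ : Y) :
    ContinuousMap.Homotopic (subIncl (joinUpper X Y)).hom
      (constMap (TopCat.of (joinUpper X Y)) (joinMk (x₀, y₀, 0) : topJoin X Y)).hom := by
  -- The mirror image: the first term raises `t` to `1`, while `4 t` keeps `t = 0` fixed and is at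
  -- least `1` for `t ≥ 1/4`.
  let φ : I × I → I := fun p =>
    ⟨min ((1 - p.2) * p.1 + p.2) (4 * p.1),
      le_min (add_nonneg (mul_nonneg (sub_nonneg.2 p.2.2.2) p.1.2.1) p.2.2.1)
        (by linarith [p.1.2.1]),
      min_le_of_left_le (by nlinarith [p.1.2.2, p.2.2.2])⟩
  have hφ : Continuous φ := Continuous.subtype_mk (by fun_prop) _
  have h0 : ∀ s, φ (0, s) = 0 := fun s => Subtype.ext (by simp [φ, s.2.1])
  have h1 : ∀ s, φ (1, s) = 1 := fun s => Subtype.ext (by simp [φ])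
  have H1 : ContinuousMap.Homotopic (subIncl (joinUpper X Y)).hom
      (upperProj x₀ ≫ upperSection y₀ ≫ subIncl _).hom := by
    refine homotopic_of_continuous (fun p => joinReparam φ h0 h1 (p.2.1, p.1))
      ((continuous_joinReparam hφ h0 h1).comp
        ((continuous_subtype_val.comp continuous_snd).prodMk continuous_fst)) ?_ ?_
    · rintro ⟨j, hj⟩
      induction j using Quot.ind with
      | mk p =>
        change joinMk (p.1, p.2.1, φ (p.2.2, 0)) = joinMk p
        have : φ (p.2.2, 0) = p.2.2 := Subtype.ext (by
          have := p.2.2.2.1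
          simp only [φ, Set.Icc.coe_zero]
          rw [min_eq_left] <;> linarith)
        rw [this]
    · rintro ⟨j, hj⟩
      have h := joinParam_ne_zero hj
      rw [mem_joinUpper_iff] at hj
      induction j using Quot.ind with
      | mk p =>
        change joinMk (p.1, p.2.1, φ (p.2.2, 1)) = joinMk (joinFst x₀ (joinMk p), y₀, 1)
        rw [joinFst_mk x₀ (p := p) h]
        have : φ (p.2.2, 1) = 1 := Subtype.ext (by
          have h' : 1 / 4 ≤ (p.2.2 : ℝ) := hj
          simp only [φ, Set.Icc.coe_one]
          rw [min_eq_left] <;> linarith)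
        rw [this]
        exact Quot.sound (JoinRel.one _ _ _)
  have H2 : ContinuousMap.Homotopic (upperSection y₀ ≫ subIncl (joinUpper X Y)).hom
      (constMap X (joinMk (x₀, y₀, 0) : topJoin X Y)).hom :=
    ⟨{ toFun := fun p => joinMk (p.2, y₀, unitInterval.symm p.1)
       continuous_toFun := continuous_quot_mk.comp (by fun_prop)
       map_zero_left := fun x => by
        change joinMk (x, y₀, unitInterval.symm 0) = _
        rw [unitInterval.symm_zero]
        rfl
       map_one_left := fun x => by
        change joinMk (x, y₀, unitInterval.symm 1) = _
        rw [unitInterval.symm_one]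
        exact Quot.sound (JoinRel.zero _ _ _) }⟩
  exact H1.trans (H2.comp (.refl (upperProj x₀).hom))

end JoinTopology


/-! ### The Künneth map on the tensor product of kernels. -/

section Kuenneth

open scoped TensorProduct DirectSum

variable {R : Type u} [CommRing R] {X Y X' Y' : TopCat.{u}} {n : ℕ}

lemma homologyCross_chainClass {p q : ℕ} (h : p + q = n) {a : (singChains R X).X p}
    {b : (singChains R Y).X q} (ha : IsCycle R a) (hb : IsCycle R b) :
    ∃ hc, homologyCross R h (chainClass a ha) (chainClass b hb) =
      chainClass (chainCross R p q n a b) hc := by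
  have e : cycleChain R n _ (cycleCross R h (cycleOf R p X a ha) (cycleOf R q Y b hb)) =
      chainCross R p q n a b := by
    rw [cycleChain_cycleCross, cycleChain_cycleOf, cycleChain_cycleOf]
  refine ⟨e ▸ fun m => d_cycleChain R n m _ _, ?_⟩
  rw [chainClass, chainClass, homologyCross_apply, cycleClass_eq_chainClass]
  exact chainClass_congr e

lemma map_homologyCross {p q : ℕ} (h : p + q = n) (f : X ⟶ X') (g : Y ⟶ Y') (x : singH R p X)
    (y : singH R q Y) : singHMap R n (topProdMap f g) (homologyCross R h x y) =
      homologyCross R h (singHMap R p f x) (singHMap R q g y) := by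
  obtain ⟨a, ha, rfl⟩ := exists_chainClass x
  obtain ⟨b, hb, rfl⟩ := exists_chainClass y
  rw [map_chainClass, map_chainClass]
  obtain ⟨hc, h1⟩ := homologyCross_chainClass h ha hb
  obtain ⟨hc', h2⟩ := homologyCross_chainClass h (ha.map f) (hb.map g)
  rw [h1, h2, map_chainClass]
  exact chainClass_congr (singChainsMap_chainCross R f g p q n a b)

variable (R n) in
/-- The map `f_* ⊗ g_*` on the degree `n` part of `H_*(X) ⊗ H_*(Y)`. -/
def homologyTensorMap (f : X ⟶ X') (g : Y ⟶ Y') :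
    homologyTensor R X Y n →ₗ[R] homologyTensor R X' Y' n :=
  DirectSum.lmap fun i => TensorProduct.map (singHMap R i.1.1 f) (singHMap R i.1.2 g)

lemma homologyTensor_ext {M : Type*} [AddCommGroup M] [Module R M]
    {f g : homologyTensor R X Y n →ₗ[R] M}
    (h : ∀ i x y, f (DirectSum.lof R (Finset.HasAntidiagonal.antidiagonal n)
      (fun i => singH R i.1.1 X ⊗[R] singH R i.1.2 Y) i (x ⊗ₜ y)) =
      g (DirectSum.lof R (Finset.HasAntidiagonal.antidiagonal n)
      (fun i => singH R i.1.1 X ⊗[R] singH R i.1.2 Y) i (x ⊗ₜ y))) : f = g :=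
  DirectSum.linearMap_ext R fun i => TensorProduct.ext' fun x y => h i x y

lemma kerTensor_ext {M : Type*} [AddCommGroup M] [Module R M]
    {f g : kerTensor R X Y n →ₗ[R] M}
    (h : ∀ i x y, f (DirectSum.lof R (Finset.HasAntidiagonal.antidiagonal n)
      (fun i => kerCone R X i.1.1 ⊗[R] kerCone R Y i.1.2) i (x ⊗ₜ y)) =
      g (DirectSum.lof R (Finset.HasAntidiagonal.antidiagonal n)
      (fun i => kerCone R X i.1.1 ⊗[R] kerCone R Y i.1.2) i (x ⊗ₜ y))) : f = g :=
  DirectSum.linearMap_ext R fun i => TensorProduct.ext' fun x y => h i x y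

lemma map_kunnethMap (f : X ⟶ X') (g : Y ⟶ Y') (t : homologyTensor R X Y n) :
    singHMap R n (topProdMap f g) (kunnethMap R X Y n t) =
      kunnethMap R X' Y' n (homologyTensorMap R n f g t) := by
  have : singHMap R n (topProdMap f g) ∘ₗ kunnethMap R X Y n =
      kunnethMap R X' Y' n ∘ₗ homologyTensorMap R n f g := by
    refine homologyTensor_ext fun i x y => ?_
    rw [LinearMap.comp_apply, LinearMap.comp_apply, homologyTensorMap, DirectSum.lmap_lof,
      kunnethMap, kunnethMap, DirectSum.toModule_lof, DirectSum.toModule_lof,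
      TensorProduct.map_tmul, TensorProduct.lift.tmul, TensorProduct.lift.tmul, map_homologyCross]
  exact LinearMap.congr_fun this t

lemma kerTensorIncl_kerTensorMap (f : X ⟶ X) (g : Y ⟶ Y) (t : kerTensor R X Y n) :
    kerTensorIncl R X Y n (kerTensorMap R n f g t) =
      homologyTensorMap R n f g (kerTensorIncl R X Y n t) := by
  have : kerTensorIncl R X Y n ∘ₗ kerTensorMap R n f g =
      homologyTensorMap R n f g ∘ₗ kerTensorIncl R X Y n := by
    refine kerTensor_ext fun i x y => ?_
    rw [LinearMap.comp_apply, LinearMap.comp_apply, kerTensorMap, kerTensorIncl, homologyTensorMap,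
      DirectSum.lmap_lof, DirectSum.lmap_lof, DirectSum.lmap_lof, DirectSum.lmap_lof]
    rfl
  exact LinearMap.congr_fun this t

section Reduced

variable (R)

/-- The projection `x ↦ x - c_* x` to `Ker i_X`, where `c` is a constant map. -/
def reduce (x₀ : X) (p : ℕ) : singH R p X →ₗ[R] kerCone R X p :=
  (LinearMap.id - singHMap R p (constMap X x₀)).codRestrict _ fun x => by
    rw [mem_kerCone_iff R X p x₀, LinearMap.sub_apply, map_sub, LinearMap.id_apply,
      ← singHMap_comp]
    exact sub_self _

lemma coe_reduce (x₀ : X) (p : ℕ) (x : singH R p X) :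
    (reduce R x₀ p x : singH R p X) = x - singHMap R p (constMap X x₀) x := rfl

lemma reduce_coe (x₀ : X) (p : ℕ) (x : kerCone R X p) : reduce R x₀ p x = x :=
  Subtype.ext (by rw [coe_reduce, (mem_kerCone_iff R X p x₀ x.1).1 x.2, sub_zero])

/-- The tensor product of the projections to `Ker i_X` and `Ker i_Y`. -/
def reduceTensor (x₀ : X) (y₀ : Y) (n : ℕ) : homologyTensor R X Y n →ₗ[R] kerTensor R X Y n :=
  DirectSum.lmap fun i => TensorProduct.map (reduce R x₀ i.1.1) (reduce R y₀ i.1.2)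

lemma reduceTensor_kerTensorIncl (x₀ : X) (y₀ : Y) (t : kerTensor R X Y n) :
    reduceTensor R x₀ y₀ n (kerTensorIncl R X Y n t) = t := by
  have : reduceTensor R x₀ y₀ n ∘ₗ kerTensorIncl R X Y n = LinearMap.id := by
    refine kerTensor_ext (M := kerTensor R X Y n) fun i x y => ?_
    rw [LinearMap.comp_apply, kerTensorIncl, reduceTensor, DirectSum.lmap_lof, DirectSum.lmap_lof,
      TensorProduct.map_tmul, TensorProduct.map_tmul, Submodule.subtype_apply,
      Submodule.subtype_apply, reduce_coe, reduce_coe]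
    rfl
  exact LinearMap.congr_fun this t

/-- The four terms come from expanding the tensor product of the two projections `1 - c_*`. -/
lemma kerTensorIncl_reduceTensor (x₀ : X) (y₀ : Y) (t : homologyTensor R X Y n) :
    kerTensorIncl R X Y n (reduceTensor R x₀ y₀ n t) =
      t - homologyTensorMap R n (constMap X x₀) (𝟙 Y) t -
        homologyTensorMap R n (𝟙 X) (constMap Y y₀) t +
        homologyTensorMap R n (constMap X x₀) (constMap Y y₀) t := by
  have : kerTensorIncl R X Y n ∘ₗ reduceTensor R x₀ y₀ n =
      LinearMap.id - homologyTensorMap R n (constMap X x₀) (𝟙 Y) -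
        homologyTensorMap R n (𝟙 X) (constMap Y y₀) +
        homologyTensorMap R n (constMap X x₀) (constMap Y y₀) := by
    refine homologyTensor_ext fun i x y => ?_
    simp only [LinearMap.comp_apply, LinearMap.add_apply, LinearMap.sub_apply, LinearMap.id_apply,
      homologyTensorMap, kerTensorIncl, reduceTensor, DirectSum.lmap_lof, TensorProduct.map_tmul,
      Submodule.subtype_apply, coe_reduce, singHMap_id, TensorProduct.sub_tmul,
      TensorProduct.tmul_sub, map_sub]
    abel
  exact LinearMap.congr_fun this t

/-- The projections onto the kernels provide a retraction, so no flatness is involved. -/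
lemma kerTensorIncl_injective (x₀ : X) (y₀ : Y) : Function.Injective (kerTensorIncl R X Y n) :=
  Function.LeftInverse.injective (reduceTensor_kerTensorIncl R (n := n) x₀ y₀)

lemma homologyTensorMap_const_left (x₀ : X) (g : Y ⟶ Y') (t : kerTensor R X Y n) :
    homologyTensorMap R n (constMap X x₀) g (kerTensorIncl R X Y n t) = 0 := by
  have : homologyTensorMap R n (constMap X x₀) g ∘ₗ kerTensorIncl R X Y n = 0 := by
    refine kerTensor_ext fun i x y => ?_
    rw [LinearMap.comp_apply, kerTensorIncl, homologyTensorMap, DirectSum.lmap_lof,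
      DirectSum.lmap_lof, TensorProduct.map_tmul, TensorProduct.map_tmul, Submodule.subtype_apply,
      (mem_kerCone_iff R X _ x₀ x.1).1 x.2, TensorProduct.zero_tmul, map_zero]
    rfl
  exact LinearMap.congr_fun this t

lemma homologyTensorMap_const_right (y₀ : Y) (f : X ⟶ X') (t : kerTensor R X Y n) :
    homologyTensorMap R n f (constMap Y y₀) (kerTensorIncl R X Y n t) = 0 := by
  have : homologyTensorMap R n f (constMap Y y₀) ∘ₗ kerTensorIncl R X Y n = 0 := by
    refine kerTensor_ext fun i x y => ?_
    rw [LinearMap.comp_apply, kerTensorIncl, homologyTensorMap, DirectSum.lmap_lof,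
      DirectSum.lmap_lof, TensorProduct.map_tmul, TensorProduct.map_tmul, Submodule.subtype_apply,
      Submodule.subtype_apply, (mem_kerCone_iff R Y _ y₀ y.1).1 y.2, TensorProduct.tmul_zero,
      map_zero]
    rfl
  exact LinearMap.congr_fun this t

/-- The Künneth map sends `Ker i_X ⊗ Ker i_Y` to classes with trivial projections. -/
lemma topSnd_kunnethMap_kerTensorIncl (x₀ : X) (t : kerTensor R X Y n) :
    singHMap R n (topSnd X Y) (kunnethMap R X Y n (kerTensorIncl R X Y n t)) = 0 := by
  -- The second projection does not notice that the first coordinate is made constant, and a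
  -- constant map kills the kernel in the first factor.
  change singHMap R n (topProdMap (constMap X x₀) (𝟙 Y) ≫ topSnd X Y) _ = 0
  rw [singHMap_comp, map_kunnethMap, homologyTensorMap_const_left, map_zero, map_zero]

lemma topFst_kunnethMap_kerTensorIncl (y₀ : Y) (t : kerTensor R X Y n) :
    singHMap R n (topFst X Y) (kunnethMap R X Y n (kerTensorIncl R X Y n t)) = 0 := by
  change singHMap R n (topProdMap (𝟙 X) (constMap Y y₀) ≫ topFst X Y) _ = 0
  rw [singHMap_comp, map_kunnethMap, homologyTensorMap_const_right, map_zero, map_zero]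

/-- The inclusion after the projection differs from `t` by three terms. Under the Künneth map they
come from self-maps of `X × Y` that factor through one of the two coordinate projections, so they
vanish; injectivity of the Künneth map concludes. -/
lemma exists_kerTensorIncl_eq (x₀ : X) (y₀ : Y)
    (hK : Function.Injective (kunnethMap R X Y n))
    (t : homologyTensor R X Y n) (h1 : singHMap R n (topFst X Y) (kunnethMap R X Y n t) = 0)
    (h2 : singHMap R n (topSnd X Y) (kunnethMap R X Y n t) = 0) :
    kerTensorIncl R X Y n (reduceTensor R x₀ y₀ n t) = t := by
  let i₁ : X ⟶ TopCat.of (X × Y) := TopCat.ofHom ⟨fun x => (x, y₀), by fun_prop⟩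
  let i₂ : Y ⟶ TopCat.of (X × Y) := TopCat.ofHom ⟨fun y => (x₀, y), by fun_prop⟩
  have e1 : kunnethMap R X Y n (homologyTensorMap R n (constMap X x₀) (𝟙 Y) t) = 0 := by
    have h : topProdMap (constMap X x₀) (𝟙 Y) = topSnd X Y ≫ i₂ := rfl
    rw [← map_kunnethMap, h, singHMap_comp, h2, map_zero]
  have e2 : kunnethMap R X Y n (homologyTensorMap R n (𝟙 X) (constMap Y y₀) t) = 0 := by
    have h : topProdMap (𝟙 X) (constMap Y y₀) = topFst X Y ≫ i₁ := rfl
    rw [← map_kunnethMap, h, singHMap_comp, h1, map_zero]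
  have e3 : kunnethMap R X Y n (homologyTensorMap R n (constMap X x₀) (constMap Y y₀) t) = 0 := by
    have h : topProdMap (constMap X x₀) (constMap Y y₀) = topFst X Y ≫ constMap X ((x₀, y₀) : TopCat.of (X × Y)) := rfl
    rw [← map_kunnethMap, h, singHMap_comp, h1, map_zero]
  apply hK
  rw [kerTensorIncl_reduceTensor, map_add, map_sub, map_sub, e1, e2, e3]
  simp

end Reduced

end Kuenneth

/-! ### The homology of the join. -/

section JoinHomology

variable (R : Type u) [CommRing R] (X Y : TopCat.{u}) (n : ℕ)

/-- The Mayer-Vietoris boundary of the join. -/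
abbrev joinBoundary : singH R (n + 1) (topJoin X Y) →ₗ[R]
    singH R n (TopCat.of ↥(joinLower X Y ∩ joinUpper X Y)) :=
  mvBoundary (interior_joinLower_union_joinUpper X Y) n

/-- The map `s_* ∘ κ`. -/
def kerTensorMid : kerTensor R X Y n →ₗ[R]
    singH R n (TopCat.of ↥(joinLower X Y ∩ joinUpper X Y)) :=
  singHMap R n (joinMid X Y) ∘ₗ kunnethMap R X Y n ∘ₗ kerTensorIncl R X Y n

variable {X Y n}

lemma joinMap_mem_joinLower (f : X ⟶ X) (g : Y ⟶ Y) (j : topJoin X Y) (hj : j ∈ joinLower X Y) :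
    joinMap f g j ∈ joinLower X Y := by
  obtain ⟨p, hp, rfl⟩ := hj
  exact ⟨(f p.1, g p.2.1, p.2.2), hp, rfl⟩

lemma joinMap_mem_joinUpper (f : X ⟶ X) (g : Y ⟶ Y) (j : topJoin X Y) (hj : j ∈ joinUpper X Y) :
    joinMap f g j ∈ joinUpper X Y := by
  obtain ⟨p, hp, rfl⟩ := hj
  exact ⟨(f p.1, g p.2.1, p.2.2), hp, rfl⟩

/-- The restriction of `f ⋆ g` to the middle part of the join. -/
def joinMapMid (f : X ⟶ X) (g : Y ⟶ Y) : TopCat.of ↥(joinLower X Y ∩ joinUpper X Y) ⟶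
    TopCat.of ↥(joinLower X Y ∩ joinUpper X Y) :=
  restrictMap (joinMap f g) fun j hj =>
    ⟨joinMap_mem_joinLower f g j hj.1, joinMap_mem_joinUpper f g j hj.2⟩

lemma joinBoundary_map (f : X ⟶ X) (g : Y ⟶ Y) (z : singH R (n + 1) (topJoin X Y)) :
    joinBoundary R X Y n (singHMap R (n + 1) (joinMap f g) z) =
      singHMap R n (joinMapMid f g) (joinBoundary R X Y n z) :=
  mvBoundary_map _ _ (joinMap f g) (joinMap_mem_joinLower f g) (joinMap_mem_joinUpper f g) z

lemma kerTensorMid_map (f : X ⟶ X) (g : Y ⟶ Y) (t : kerTensor R X Y n) :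
    kerTensorMid R X Y n (kerTensorMap R n f g t) =
      singHMap R n (joinMapMid f g) (kerTensorMid R X Y n t) := by
  simp only [kerTensorMid, LinearMap.comp_apply]
  rw [kerTensorIncl_kerTensorMap, ← map_kunnethMap, ← singHMap_comp, ← singHMap_comp]
  rfl

lemma joinMid_singHMap_injective (x₀ : X) (y₀ : Y) : Function.Injective (singHMap R n (joinMid X Y)) := by
  refine Function.LeftInverse.injective (g := singHMap R n (midProj x₀ y₀)) fun v => ?_
  rw [← singHMap_comp, joinMid_midProj, singHMap_id]

lemma joinMid_midProj_singHMap (x₀ : X) (y₀ : Y)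
    (w : singH R n (TopCat.of ↥(joinLower X Y ∩ joinUpper X Y))) :
    singHMap R n (joinMid X Y) (singHMap R n (midProj x₀ y₀) w) = w := by
  rw [← singHMap_comp, singHMap_eq_of_homotopic R n (midProj_joinMid x₀ y₀), singHMap_id]

lemma kerTensorMid_injective (x₀ : X) (y₀ : Y)
    (hK : Function.Injective (kunnethMap R X Y n)) :
    Function.Injective (kerTensorMid R X Y n) :=
  (joinMid_singHMap_injective R x₀ y₀).comp (hK.comp (kerTensorIncl_injective R x₀ y₀))

/-- The kernel of the boundary comes from the homology of the two parts in degree `n + 1 > 0`, and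
both inclusions in the join are null-homotopic. -/
lemma joinBoundary_injective (x₀ : X) (y₀ : Y) : Function.Injective (joinBoundary R X Y n) := by
  rw [injective_iff_map_eq_zero]
  intro z hz
  obtain ⟨a, b, rfl⟩ := exists_of_mvBoundary_eq_zero _ hz
  rw [singHMap_eq_of_homotopic R _ (subIncl_joinLower_homotopic x₀ y₀),
    singHMap_eq_of_homotopic R _ (subIncl_joinUpper_homotopic x₀ y₀), singHMap_constMap,
    singHMap_constMap, sub_zero]

/-- By exactness the image of the boundary consists of the classes that vanish in both parts. These
parts retract homotopically onto `Y` and `X`, so on `X × Y` the condition is that both projections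
vanish, which characterizes the tensor product of the kernels. -/
lemma range_joinBoundary (x₀ : X) (y₀ : Y)
    (hK : Function.Bijective (kunnethMap R X Y n)) :
    LinearMap.range (joinBoundary R X Y n) = LinearMap.range (kerTensorMid R X Y n) := by
  apply le_antisymm
  · rintro _ ⟨z, rfl⟩
    obtain ⟨hA, hB⟩ := mvBoundary_mem_ker (interior_joinLower_union_joinUpper X Y) z
    obtain ⟨t, ht⟩ := hK.2 (singHMap R n (midProj x₀ y₀) (joinBoundary R X Y n z))
    have hs : singHMap R n (joinMid X Y) (kunnethMap R X Y n t) = joinBoundary R X Y n z := by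
      rw [ht, joinMid_midProj_singHMap]
    refine ⟨reduceTensor R x₀ y₀ n t, ?_⟩
    rw [kerTensorMid, LinearMap.comp_apply, LinearMap.comp_apply,
      exists_kerTensorIncl_eq R x₀ y₀ hK.1 t, hs]
    · rw [← joinMid_upperProj x₀, singHMap_comp, singHMap_comp, hs, hB, map_zero]
    · rw [← joinMid_lowerProj y₀, singHMap_comp, singHMap_comp, hs, hA, map_zero]
  · rintro _ ⟨t, rfl⟩
    rw [kerTensorMid, LinearMap.comp_apply, LinearMap.comp_apply]
    refine exists_mvBoundary_eq _ ?_ ?_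
    · rw [← singHMap_comp, singHMap_eq_of_homotopic R n (joinMid_interLeft x₀), singHMap_comp,
        topSnd_kunnethMap_kerTensorIncl R x₀, map_zero]
    · rw [← singHMap_comp, singHMap_eq_of_homotopic R n (joinMid_interRight y₀), singHMap_comp,
        topFst_kunnethMap_kerTensorIncl R y₀, map_zero]

/-- The isomorphism of the homology of the join with the tensor product of kernels. -/
def joinEquiv (x₀ : X) (y₀ : Y)
    (hK : Function.Bijective (kunnethMap R X Y n)) :
    singH R (n + 1) (topJoin X Y) ≃ₗ[R] kerTensor R X Y n :=
  (LinearEquiv.ofInjective _ (joinBoundary_injective R x₀ y₀)).trans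
    ((LinearEquiv.ofEq _ _ (range_joinBoundary R x₀ y₀ hK)).trans
      (LinearEquiv.ofInjective _ (kerTensorMid_injective R x₀ y₀ hK.1)).symm)

lemma kerTensorMid_joinEquiv (x₀ : X) (y₀ : Y)
    (hK : Function.Bijective (kunnethMap R X Y n))
    (z : singH R (n + 1) (topJoin X Y)) :
    kerTensorMid R X Y n (joinEquiv R x₀ y₀ hK z) = joinBoundary R X Y n z := by
  have h := LinearEquiv.apply_symm_apply
    (LinearEquiv.ofInjective _ (kerTensorMid_injective R x₀ y₀ hK.1))
    (LinearEquiv.ofEq _ _ (range_joinBoundary R x₀ y₀ hK)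
      (LinearEquiv.ofInjective _ (joinBoundary_injective R x₀ y₀) z))
  exact congrArg Subtype.val h

lemma subsingleton_kerTensor (h : IsEmpty X ∨ IsEmpty Y) : Subsingleton (kerTensor R X Y n) := by
  refine ⟨fun a b => DFinsupp.ext fun i => ?_⟩
  rcases h with h | h
  · have := subsingleton_singH_of_isEmpty R (X := X) i.1.1
    exact Subsingleton.elim _ _
  · have := subsingleton_singH_of_isEmpty R (X := Y) i.1.2
    exact Subsingleton.elim _ _

lemma isEmpty_topJoin (h : IsEmpty X ∨ IsEmpty Y) : IsEmpty (topJoin X Y) := by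
  refine ⟨fun j => ?_⟩
  obtain ⟨p, -⟩ := Quot.exists_rep j
  rcases h with h | h
  · exact h.false p.1
  · exact h.false p.2.1

end JoinHomology

theorem proposition1p3 (X Y : TopCat.{u})
    (hTor : ∀ i j : ℕ, Limits.IsZero (((Tor (ModuleCat.{u} IntRing.{u}) 1).obj
      (singH IntRing.{u} i X)).obj (singH IntRing.{u} j Y)))
    (n : ℕ) :
    ∃ Φ : singH IntRing.{u} (n + 1) (topJoin X Y) ≃ₗ[IntRing.{u}] kerTensor IntRing.{u} X Y n,
      (∀ z w, IsMayerVietorisBoundary IntRing.{u} (joinLower X Y) (joinUpper X Y) n z w ↔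
        singHMap IntRing.{u} n (joinMid X Y) (kunnethMap IntRing.{u} X Y n
          (kerTensorIncl IntRing.{u} X Y n (Φ z))) = w) ∧
      ∀ (f : X ⟶ X) (g : Y ⟶ Y) (z : singH IntRing.{u} (n + 1) (topJoin X Y)),
        Φ (singHMap IntRing.{u} (n + 1) (joinMap f g) z) =
          kerTensorMap IntRing.{u} n f g (Φ z) := by
  -- Base points are needed for the projections and contractions. If a factor is empty, the join, a
  -- quotient of `X × Y × [0, 1]`, is empty and all modules vanish.
  by_cases h : IsEmpty X ∨ IsEmpty Y
  · have h1 := subsingleton_kerTensor IntRing.{u} (n := n) h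
    have h2 := isEmpty_topJoin h
    have h3 := subsingleton_singH_of_isEmpty IntRing.{u} (X := topJoin X Y) (n + 1)
    have h4 : IsEmpty (TopCat.of ↥(joinLower X Y ∩ joinUpper X Y)) := ⟨fun j => h2.false j.1⟩
    have h5 := subsingleton_singH_of_isEmpty IntRing.{u}
      (X := TopCat.of ↥(joinLower X Y ∩ joinUpper X Y)) n
    refine ⟨{ (0 : singH IntRing.{u} (n + 1) (topJoin X Y) →ₗ[IntRing.{u}]
      kerTensor IntRing.{u} X Y n) with
        invFun := 0
        left_inv := fun _ => Subsingleton.elim _ _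
        right_inv := fun _ => Subsingleton.elim _ _ }, fun z w => ?_, fun f g z =>
          Subsingleton.elim _ _⟩
    rw [isMayerVietorisBoundary_iff_eq (interior_joinLower_union_joinUpper X Y)]
    exact iff_of_true (Subsingleton.elim _ _) (Subsingleton.elim _ _)
  · rw [not_or, not_isEmpty_iff, not_isEmpty_iff] at h
    obtain ⟨⟨x₀⟩, ⟨y₀⟩⟩ := h
    have hK : Function.Bijective (kunnethMap IntRing.{u} X Y n) :=
      ⟨kunnethMap_injective IntRing.{u} X Y n, kunnethMap_surjective IntRing.{u} X Y hTor n⟩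
    refine ⟨joinEquiv IntRing.{u} x₀ y₀ hK, fun z w => ?_, fun f g z => ?_⟩
    · rw [isMayerVietorisBoundary_iff_eq (interior_joinLower_union_joinUpper X Y),
        ← kerTensorMid_joinEquiv IntRing.{u} x₀ y₀ hK]
      rfl
    · apply kerTensorMid_injective IntRing.{u} x₀ y₀ hK.1
      rw [kerTensorMid_joinEquiv, joinBoundary_map, kerTensorMid_map, kerTensorMid_joinEquiv]

end
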